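/- Let $\kappa\ge 1$, $r\ge 1$ and $\beta>0$. Let $0<x_0<x_1<\dots<x_{r-1}<x_r=1$ and let $0=\gamma_0\le\gamma_1\le\dots\le\gamma_r$ be symmetric positive-semidefinite real $\kappa\times\kappa$ matrices, where $A\le B$ means that $B-A$ is positive-semidefinite (for example, but not necessarily, with $\gamma_r=\mathrm{diag}(d_1,\dots,d_\kappa)$ for the vector $d$ below). Let $(v_\alpha)_{\alpha\in\mathbb N^r}$ be the weights of the Ruelle probability cascades with parameters $x_0<\dots<x_{r-1}$: for every $0\le p\le r-1$ and $a\in\mathbb N^p$ let $u_{a1}>u_{a2}>\dots$ be the decreasing enumeration of a Poisson process on $(0,\infty)$ with mean measure $x_p t^{-1-x_p}\,dt$, independently over all $a$; then $v_\alpha=w_\alpha/\sum_{\alpha'}w_{\alpha'}$ with $w_\alpha=\prod_{p=1}^{r}u_{\alpha_1\dots\alpha_p}$. For $\alpha,\alpha'\in\mathbb N^r$ let $\alpha\wedge\alpha'\in\{0,\dots,r\}$ be the number of initial coordinates that they have in common. Let $(Z_i^\alpha(k))_{\alpha\in\mathbb N^r,k\le\kappa}$, $i\ge1$, be independent copies,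 independent of $(u_a)$, of a centred Gaussian process $(Z^\alpha(k))$ with $\mathbb E\,Z^{\alpha}(k)Z^{\alpha'}(k')=2(\gamma_{\alpha\wedge\alpha'})_{k,k'}$. For $d$ in $\mathcal D=\{d\in[0,\infty)^\kappa:\sum_k d_k=1\}$ let $\Sigma_N(d)$ be the set of $\sigma\in\{1,\dots,\kappa\}^N$ with exactly $Nd_k$ coordinates equal to $k$ for every $k$, let $\mathcal D_N=\{d\in\mathcal D:\Sigma_N(d)\neq\emptyset\}$, and for $d\in\mathcal D_N$ let $$f_N(d)=\frac1N\,\mathbb E\log\sum_{\alpha\in\mathbb N^r}v_\alpha\sum_{\sigma\in\Sigma_N(d)}\exp\Bigl(\beta\sum_{i\le N}Z_i^\alpha(\sigma_i)\Bigr).$$ For $\lambda\in\mathbb R^{\kappa-1}$, with the convention $\lambda_\kappa=0$, let $z_1,\dots,z_r$ be independent centred Gaussian vectors in $\mathbb R^\kappa$ with covariance matrices $2(\gamma_p-\gamma_{p-1})$, let $$X_r=\log\sum_{k\le\kappa}\exp\Bigl(\beta\sum_{1\le p\le r}z_p(k)+\lambda_k\Bigr),\qquad X_p=\frac1{x_p}\log\mathbb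 E_p\exp(x_pX_{p+1})\quad(0\le p\le r-1),$$ where $\mathbb E_p$ is the expectation in $z_{p+1}$ only, and let $\Phi(\lambda)=X_0$, which is non-random. Let $d^N\in\mathcal D_N$ for all $N\ge1$ and $d^N\to d$ as $N\to\infty$. Then the series $\sum_\alpha w_\alpha$ and the series over $\alpha$ in the definition of $f_N(d^N)$ converge almost surely, the logarithm in that definition is integrable, the function $\lambda\mapsto-\sum_{k\le\kappa-1}\lambda_kd_k+\Phi(\lambda)$ is bounded from below, and $$\lim_{N\to\infty}f_N(d^N)=\inf_{\lambda\in\mathbb R^{\kappa-1}}\Bigl(-\sum_{k\le\kappa-1}\lambda_kd_k+\Phi(\lambda)\Bigr).$$ -/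

import Mathlib

open MeasureTheory ProbabilityTheory Filter Topology
open scoped ENNReal NNReal

namespace PottsCascade

noncomputable section

/-! ### Configurations with constrained state sizes -/

open Classical in
/-- `Σ(d)`: the configurations of `N` spins with values in `κ` states such that exactly `N d_k`
spins are in the state `k`, for every `k`. -/
def constrainedConfigs {κ : ℕ} (N : ℕ) (d : Fin κ → ℝ) : Finset (Fin N → Fin κ) :=
  Finset.univ.filter fun σ => ∀ k, ((Finset.univ.filter fun i => σ i = k).card : ℝ) = N * d k

/-- `D_N`: the proportions `d` (nonnegative coordinates with sum one) for which `Σ(d)` is not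
empty. -/
def admissibleSizes (κ N : ℕ) : Set (Fin κ → ℝ) :=
  {d | d ∈ stdSimplex ℝ (Fin κ) ∧ (constrainedConfigs N d).Nonempty}

/-! ### Poisson processes and the Ruelle probability cascades -/

section Probability

variable {Ω : Type*} [MeasurableSpace Ω]

/-- The number of points of the random sequence `u` in the set `B`. -/
def pointCount (u : ℕ → Ω → ℝ) (B : Set ℝ) (ω : Ω) : ℕ∞ :=
  {n : ℕ | u n ω ∈ B}.encard

/-- `u 0 > u 1 > ...` is the decreasing enumeration of a Poisson point process on `(0, ∞)` with
mean measure `ν`: the numbers of points in disjoint Borel sets are independent, and the number of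
points in a Borel set `B` with `ν B < ∞` has the Poisson distribution with mean `ν B`. -/
structure IsDecreasingPoisson (u : ℕ → Ω → ℝ) (ν : Measure ℝ) (P : Measure Ω) : Prop where
  measurable : ∀ n, Measurable (u n)
  pos : ∀ᵐ ω ∂P, ∀ n, 0 < u n ω
  strictAnti : ∀ᵐ ω ∂P, StrictAnti fun n => u n ω
  poisson : ∀ B : Set ℝ, MeasurableSet B → ν B ≠ ∞ → ∀ k : ℕ,
    P {ω | pointCount u B ω = k} = poissonMeasure (ν B).toNNReal {k}
  indep : ∀ (l : ℕ) (B : Fin l → Set ℝ), (∀ j, MeasurableSet (B j)) →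
    Pairwise (Function.onFun Disjoint B) → iIndepFun (fun j => pointCount u (B j)) P

/-- The measure `ζ t ^ (-1 - ζ) dt` on `(0, ∞)`. -/
def powerIntensity (ζ : ℝ) : Measure ℝ :=
  (volume.restrict (Set.Ioi 0)).withDensity fun t => ENNReal.ofReal (ζ * t ^ (-1 - ζ))

/-- The non-leaf vertices of the tree `ℕ^0 ∪ ℕ^1 ∪ ... ∪ ℕ^r`: a depth `p < r` and an element of
`ℕ^p`. The leaves are the functions `Fin r → ℕ`. -/
abbrev Vertex (r : ℕ) : Type := Σ p : Fin r, (Fin p → ℕ)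

/-- The vertex at depth `p` on the path from the root to the leaf `α`. -/
def ancestor {r : ℕ} (α : Fin r → ℕ) (p : Fin r) : Vertex r :=
  ⟨p, fun j => α (Fin.castLE p.isLt.le j)⟩

/-- The points attached to the vertices that generate the Ruelle probability cascades with
parameters `x_0, ..., x_{r-1}`: for different non-leaf vertices `a` the sequences `(u a n)_n` are
independent, and if `a` is at depth `p` then `(u a n)_n` is the decreasing enumeration of a
Poisson process with mean measure `x_p t ^ (-1 - x_p) dt`; the point `u a n` is attached to the
`n`-th child of `a`. -/
structure IsRuelleCascade {r : ℕ} (x : Fin (r + 1) → ℝ) (u : Vertex r → ℕ → Ω → ℝ)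
    (P : Measure Ω) : Prop where
  poisson : ∀ a : Vertex r, IsDecreasingPoisson (u a) (powerIntensity (x a.1.castSucc)) P
  indep : iIndepFun (fun (a : Vertex r) (ω : Ω) (n : ℕ) => u a n ω) P

/-- The unnormalized weight `w_α` of the leaf `α`: the product of the points attached to the
vertices on the path from the root (not included) to `α` (included). -/
def leafWeight {r : ℕ} (u : Vertex r → ℕ → Ω → ℝ) (α : Fin r → ℕ) (ω : Ω) : ℝ :=
  ∏ p : Fin r, u (ancestor α p) (α p) ω

/-- The weight `v_α = w_α / ∑_β w_β` of the Ruelle probability cascades. -/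
def cascadeWeight {r : ℕ} (u : Vertex r → ℕ → Ω → ℝ) (α : Fin r → ℕ) (ω : Ω) : ℝ :=
  leafWeight u α ω / ∑' α' : Fin r → ℕ, leafWeight u α' ω

/-- `α ∧ α'`: the number of initial coordinates that the leaves `α` and `α'` have in common. -/
def commonDepth {r : ℕ} (α α' : Fin r → ℕ) : Fin (r + 1) :=
  ⟨Nat.findGreatest (fun p => ∀ j : Fin r, (j : ℕ) < p → α j = α' j) r,
    Nat.lt_succ_of_le (Nat.findGreatest_le r)⟩

/-- The processes `(Z_i^α(k))_{α,k}` are independent copies, for `i = 0, 1, 2, ...`, of a centred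
Gaussian process with covariance `Cov (Z^α(k), Z^α'(k')) = 2 γ_{α ∧ α'} k k'`. -/
structure IsCascadeField {r κ : ℕ} (γ : Fin (r + 1) → Matrix (Fin κ) (Fin κ) ℝ)
    (Z : ℕ → (Fin r → ℕ) → Fin κ → Ω → ℝ) (P : Measure Ω) : Prop where
  measurable : ∀ i α k, Measurable (Z i α k)
  gaussian : ∀ i, IsGaussianProcess (fun q : (Fin r → ℕ) × Fin κ => Z i q.1 q.2) P
  mean : ∀ i α k, ∫ ω, Z i α k ω ∂P = 0
  cov : ∀ i α α' k k', cov[Z i α k, Z i α' k'; P] = 2 * γ (commonDepth α α') k k'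
  indep : iIndepFun (fun (i : ℕ) (ω : Ω) (α : Fin r → ℕ) (k : Fin κ) => Z i α k ω) P

/-! ### The constrained functional -/

/-- `v_α ∑_{σ ∈ Σ(d)} exp (β ∑_{i ≤ N} Z_i^α(σ_i))`. -/
def constrainedTerm {r κ : ℕ} (β : ℝ) (u : Vertex r → ℕ → Ω → ℝ)
    (Z : ℕ → (Fin r → ℕ) → Fin κ → Ω → ℝ) (N : ℕ) (d : Fin κ → ℝ) (α : Fin r → ℕ)
    (ω : Ω) : ℝ :=
  cascadeWeight u α ω *
    ∑ σ ∈ constrainedConfigs N d, Real.exp (β * ∑ i : Fin N, Z i α (σ i) ω)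

/-- `log ∑_α v_α ∑_{σ ∈ Σ(d)} exp (β ∑_{i ≤ N} Z_i^α(σ_i))`. -/
def logPartition {r κ : ℕ} (β : ℝ) (u : Vertex r → ℕ → Ω → ℝ)
    (Z : ℕ → (Fin r → ℕ) → Fin κ → Ω → ℝ) (N : ℕ) (d : Fin κ → ℝ) (ω : Ω) : ℝ :=
  Real.log (∑' α : Fin r → ℕ, constrainedTerm β u Z N d α ω)

/-- `f_N(d) = (1/N) E log ∑_α v_α ∑_{σ ∈ Σ(d)} exp (β ∑_{i ≤ N} Z_i^α(σ_i))`. -/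
def constrainedFunctional {r κ : ℕ} (P : Measure Ω) (β : ℝ) (u : Vertex r → ℕ → Ω → ℝ)
    (Z : ℕ → (Fin r → ℕ) → Fin κ → Ω → ℝ) (N : ℕ) (d : Fin κ → ℝ) : ℝ :=
  (1 / (N : ℝ)) * ∫ ω, logPartition β u Z N d ω ∂P

end Probability

/-! ### The decoupled functional -/

/-- The recursion `X_r, ..., X_0`, with `κ = m + 1` states. Since `X_r` depends on
`z_1, ..., z_r` only through their sum, `X_p` depends on `z_1, ..., z_p` only through their sum,
and `parisiX β lam x γ p y` is the value of `X_p` when `z_1 + ... + z_p = y`. The vector `z_{p+1}`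
is centred Gaussian with covariance `2 (γ_{p+1} - γ_p)`. The multipliers `lam` are
extended by zero to the last state. -/
def parisiX {r m : ℕ} (β : ℝ) (lam : Fin m → ℝ) (x : Fin (r + 1) → ℝ)
    (γ : Fin (r + 1) → Matrix (Fin (m + 1)) (Fin (m + 1)) ℝ) :
    Fin (r + 1) → EuclideanSpace ℝ (Fin (m + 1)) → ℝ :=
  Fin.reverseInduction (motive := fun _ => EuclideanSpace ℝ (Fin (m + 1)) → ℝ)
    (fun y => Real.log (∑ k : Fin (m + 1),
      Real.exp (β * y k + Fin.snoc (α := fun _ => ℝ) lam 0 k)))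
    (fun p X y =>
      if x p.castSucc = 0 then
        ∫ z, X (y + z) ∂(multivariateGaussian 0 ((2 : ℝ) • (γ p.succ - γ p.castSucc)))
      else
        (1 / x p.castSucc) * Real.log (∫ z, Real.exp (x p.castSucc * X (y + z))
          ∂(multivariateGaussian 0 ((2 : ℝ) • (γ p.succ - γ p.castSucc)))))

/-- `Φ(λ, r, x, γ) = X_0`. -/
def parisiPhi {r m : ℕ} (β : ℝ) (lam : Fin m → ℝ) (x : Fin (r + 1) → ℝ)
    (γ : Fin (r + 1) → Matrix (Fin (m + 1)) (Fin (m + 1)) ℝ) : ℝ :=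
  parisiX β lam x γ 0 0

/-- `-∑_{k ≤ κ-1} λ_k d_k + Φ(λ, r, x, γ)`. -/
def decoupledBound {r m : ℕ} (β : ℝ) (x : Fin (r + 1) → ℝ)
    (γ : Fin (r + 1) → Matrix (Fin (m + 1)) (Fin (m + 1)) ℝ) (d : Fin (m + 1) → ℝ)
    (lam : Fin m → ℝ) : ℝ :=
  -∑ k : Fin m, lam k * d k.castSucc + parisiPhi β lam x γ

end

end PottsCascade

open PottsCascade

/-! The proof computes $N f_N(d)$ exactly as a superadditive function of the integer vector $n=Nd$,
and then identifies its asymptotic slope by convex duality.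

Exact formula. For a nonnegative function $f$ of the field on $N$ sites let $V_r=f$ and
$V_p(y)^{x_p}=\int V_{p+1}(y+z)^{x_p}$, integrated over the increment law (`cascadeRec`). The field
has the law of sums of independent Gaussian increments along the edges of the tree
(`IsCascadeField.map_eq`). Averaging over one generation, the Laplace functional of a marked Poisson
process and the scaling of $t^{-1-x_p}dt$ turn a sum of $C_{p+1}(wV_{p+1})^{x_{p+1}}$ into a sum of
$C_p(wV_p)^{x_p}$ with $C_p$ depending only on $x$ (`lintegral_vertex`,
`IsMarkedCascade.lintegral_level`). At the root this gives $E\exp(-c\sum_\alpha w_\alpha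
f(Z^\alpha))=\exp(-C_0(cV_0)^{x_0})$ (`hasStableLaplace_cascadeSum`). The total weight is the case
$f=1$, $V_0=1$; comparing moments of small order and differentiating at order zero shows that the
two expected logarithms differ by $\log V_0$ (`HasStableLaplace.integral_log_sub`). Therefore $N
f_N(d)=a(n)$, where $a$ is `countEnergy` (`logPartition_spec`).

Properties of $a$. It is nonnegative by Jensen's inequality applied to one configuration, and
superadditive because the recursion is multiplicative over disjoint blocks of sites and
concatenation adds the counts (`countEnergy_add_le`). Write $\Phi$ for the one-spin functional with
multipliers. The $N$-fold product of one-spin sums contains every configuration with counts $n$, so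
$\lambda\cdot n+a(n)\le|n|\Phi(\lambda)$ (`sum_mul_add_countEnergy_le`). In the other direction
$V_0^{x_0}$ is subadditive in $f$ (`cascadeRec_sum_rpow_le`) and there are only polynomially many
count vectors. So if $\lambda\cdot n+a(n)\le 0$ for all $n$ supported in $S$, the one-spin
functional restricted to $S$ is at most $0$ (`multiplierValue_le_one`), and sending
$\lambda_k\to-\infty$ off $S$ makes $\Phi\le\varepsilon$.

Duality (`tendsto_superadditive_div`). The upper bound is immediate. For the lower one let $S$ be
the support of $d$ and $b$ a number below the infimum. Superadditivity makes the region below the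
homogeneous envelope of $a$ an open convex cone. If $(d,b)$ were outside, Hahn–Banach would give
$\lambda$ with $\lambda\cdot n+a(n)\le0$ on $S$ and $\lambda\cdot d+b\ge0$, and the infimum would be
at most $b+\varepsilon$. So some $l/q$ lies strictly below $d$ on $S$ with $a(l)/q>b$, and packing
about $N/q$ copies of $l$ into the counts gives the bound. Working on $S$ allows $d$ on the boundary
of the simplex. The normalization $\lambda_\kappa=0$ costs nothing because $\sum_k d_k=1$
(`range_decoupledBound`). -/

namespace PottsCascade
noncomputable section

/-! ### The recursion on nonnegative functions -/

section Recursion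

variable {E E' : Type*} [MeasurableSpace E] [MeasurableSpace E'] [AddZeroClass E]
  [AddZeroClass E'] {r : ℕ}

/-- The recursion `V_r = f`, `V_p(y) = (∫ V_{p+1}(y + z) ^ x_p dμ_p(z)) ^ (1 / x_p)`. -/
def cascadeRec (x : Fin (r + 1) → ℝ) (μ : Fin r → Measure E) (f : E → ℝ≥0∞) :
    Fin (r + 1) → E → ℝ≥0∞ :=
  Fin.reverseInduction (motive := fun _ => E → ℝ≥0∞) f
    (fun p V y => (∫⁻ z, V (y + z) ^ x p.castSucc ∂(μ p)) ^ (1 / x p.castSucc))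

variable {x : Fin (r + 1) → ℝ} {μ : Fin r → Measure E} {μ' : Fin r → Measure E'}
  {f g : E → ℝ≥0∞}

@[simp] lemma cascadeRec_last : cascadeRec x μ f (Fin.last r) = f := by
  simp [cascadeRec]

lemma cascadeRec_castSucc (p : Fin r) (y : E) : cascadeRec x μ f p.castSucc y =
    (∫⁻ z, cascadeRec x μ f p.succ (y + z) ^ x p.castSucc ∂(μ p)) ^ (1 / x p.castSucc) := by
  simp [cascadeRec]

lemma cascadeRec_castSucc_rpow (hx : ∀ p, 0 < x p) (p : Fin r) (y : E) :
    cascadeRec x μ f p.castSucc y ^ x p.castSucc =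
      ∫⁻ z, cascadeRec x μ f p.succ (y + z) ^ x p.castSucc ∂(μ p) := by
  rw [cascadeRec_castSucc, ← ENNReal.rpow_mul, one_div_mul_cancel (hx _).ne', ENNReal.rpow_one]

lemma measurable_cascadeRec [MeasurableAdd₂ E] [∀ p, SFinite (μ p)] (hf : Measurable f)
    (p : Fin (r + 1)) : Measurable (cascadeRec x μ f p) := by
  induction p using Fin.reverseInduction with
  | last => simpa
  | cast p ih =>
    rw [funext (cascadeRec_castSucc p)]
    refine Measurable.pow_const ?_ _
    exact ((ih.comp measurable_add).pow_const _).lintegral_prod_right'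

lemma measurable_cascadeRec_shift [MeasurableAdd₂ E] [∀ p, SFinite (μ p)] (hf : Measurable f)
    (p : Fin (r + 1)) (y : E) (a : ℝ) : Measurable fun z => cascadeRec x μ f p (y + z) ^ a :=
  ((measurable_cascadeRec hf p).comp (measurable_const_add y)).pow_const a

lemma cascadeRec_mono (hx : ∀ p, 0 < x p) (h : ∀ y, f y ≤ g y) (p : Fin (r + 1)) (y : E) :
    cascadeRec x μ f p y ≤ cascadeRec x μ g p y := by
  induction p using Fin.reverseInduction generalizing y with
  | last => simpa using h y
  | cast p ih =>
    rw [cascadeRec_castSucc, cascadeRec_castSucc]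
    have := hx p.castSucc
    gcongr
    exact ih _

lemma cascadeRec_const_mul [MeasurableAdd₂ E] [∀ p, SFinite (μ p)] (hx : ∀ p, 0 < x p)
    (hf : Measurable f) (c : ℝ≥0∞) (p : Fin (r + 1)) (y : E) :
    cascadeRec x μ (fun y => c * f y) p y = c * cascadeRec x μ f p y := by
  induction p using Fin.reverseInduction generalizing y with
  | last => simp
  | cast p ih =>
    have h := hx p.castSucc
    rw [cascadeRec_castSucc, cascadeRec_castSucc]
    simp_rw [ih, ENNReal.mul_rpow_of_nonneg _ _ h.le]
    rw [lintegral_const_mul _ (measurable_cascadeRec_shift hf _ _ _), ENNReal.mul_rpow_of_nonneg _ _ (by positivity),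
      ← ENNReal.rpow_mul, mul_one_div_cancel h.ne', ENNReal.rpow_one]

/-- Serves to split $N+M$ sites into two blocks: the splitting map is additive and carries the
increment law to a product. -/
lemma cascadeRec_comp [MeasurableAdd₂ E'] [∀ p, SFinite (μ' p)] {f : E' → ℝ≥0∞}
    (hf : Measurable f) (T : E → E') (hT : ∀ p, MeasurePreserving T (μ p) (μ' p))
    (hadd : ∀ y z, T (y + z) = T y + T z) (p : Fin (r + 1)) (y : E) :
    cascadeRec x μ (fun y => f (T y)) p y = cascadeRec x μ' f p (T y) := by
  induction p using Fin.reverseInduction generalizing y with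
  | last => simp
  | cast p ih =>
    rw [cascadeRec_castSucc, cascadeRec_castSucc]
    simp_rw [ih, hadd]
    rw [(hT p).lintegral_comp (f := fun z => cascadeRec x μ' f p.succ (T y + z) ^ x p.castSucc)
      (measurable_cascadeRec_shift hf _ _ _)]

/-- Powers are multiplicative and Tonelli factors each integral. This is the source of
superadditivity. -/
lemma cascadeRec_prod [MeasurableAdd₂ E] [MeasurableAdd₂ E'] [∀ p, SFinite (μ p)]
    [∀ p, SFinite (μ' p)] (hx : ∀ p, 0 < x p) (hf : Measurable f) {g : E' → ℝ≥0∞}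
    (hg : Measurable g) (p : Fin (r + 1)) (y : E × E') :
    cascadeRec x (fun p => (μ p).prod (μ' p)) (fun y => f y.1 * g y.2) p y =
      cascadeRec x μ f p y.1 * cascadeRec x μ' g p y.2 := by
  induction p using Fin.reverseInduction generalizing y with
  | last => simp
  | cast p ih =>
    have h := hx p.castSucc
    rw [cascadeRec_castSucc, cascadeRec_castSucc, cascadeRec_castSucc]
    simp_rw [ih, ENNReal.mul_rpow_of_nonneg _ _ h.le, Prod.fst_add, Prod.snd_add]
    rw [lintegral_prod_mul
      (measurable_cascadeRec_shift hf _ _ _).aemeasurable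
      (measurable_cascadeRec_shift hg _ _ _).aemeasurable,
      ENNReal.mul_rpow_of_nonneg _ _ (by positivity)]

lemma cascadeRec_one [∀ p, IsProbabilityMeasure (μ p)] (p : Fin (r + 1)) (y : E) :
    cascadeRec x μ (fun _ => 1) p y = 1 := by
  induction p using Fin.reverseInduction generalizing y with
  | last => simp
  | cast p ih => simp [cascadeRec_castSucc, ih]

lemma rpow_sum_le_sum_rpow {ι : Type*} (s : Finset ι) (f : ι → ℝ≥0∞) {a : ℝ} (h0 : 0 < a)
    (h1 : a ≤ 1) : (∑ i ∈ s, f i) ^ a ≤ ∑ i ∈ s, f i ^ a := by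
  classical
  induction s using Finset.induction_on with
  | empty => simp [h0]
  | insert i s hi ih =>
    rw [Finset.sum_insert hi, Finset.sum_insert hi]
    exact (ENNReal.rpow_add_le_add_rpow _ _ h0.le h1).trans (by gcongr)

/-- At the leaves the exponent is $1$. Descending one level replaces $V^{x_{p+1}}$ by its power
$x_p/x_{p+1}\le1$, which is subadditive, and integration preserves the inequality. A sum of many
terms thus costs no more than their number. -/
lemma cascadeRec_sum_rpow_le [MeasurableAdd₂ E] [∀ p, SFinite (μ p)] (hx : ∀ p, 0 < x p)
    (hmono : Monotone x) (hlast : x (Fin.last r) = 1)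
    {ι : Type*} (s : Finset ι) {f : ι → E → ℝ≥0∞} (hf : ∀ i, Measurable (f i))
    (p : Fin (r + 1)) (y : E) :
    cascadeRec x μ (fun y => ∑ i ∈ s, f i y) p y ^ x p ≤ ∑ i ∈ s, cascadeRec x μ (f i) p y ^ x p := by
  induction p using Fin.reverseInduction generalizing y with
  | last => simp [hlast]
  | cast p ih =>
    have h := hx p.castSucc
    have h' := hx p.succ
    simp_rw [cascadeRec_castSucc_rpow hx]
    rw [← lintegral_finsetSum _ fun i _ => measurable_cascadeRec_shift (hf i) _ _ _]
    refine lintegral_mono fun z => ?_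
    have key : ∀ a : ℝ≥0∞, a ^ x p.castSucc = (a ^ x p.succ) ^ (x p.castSucc / x p.succ) := by
      intro a
      rw [← ENNReal.rpow_mul, mul_div_cancel₀ _ h'.ne']
    have hle : x p.castSucc / x p.succ ≤ 1 :=
      (div_le_one h').2 (hmono (Fin.castSucc_lt_succ).le)
    simp only [key]
    refine le_trans ?_ (rpow_sum_le_sum_rpow s _ (by positivity) hle)
    have h2 := ih (y + z)
    gcongr

/-- The integral of the exponential of a linear function. -/
lemma cascadeRec_exp (hx : ∀ p, 0 < x p) {L : E → ℝ} (hL : ∀ y z, L (y + z) = L y + L z)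
    (hLm : Measurable L) (p : Fin (r + 1)) (y : E) :
    cascadeRec x μ (fun y => ENNReal.ofReal (Real.exp (L y))) p y =
      ENNReal.ofReal (Real.exp (L y)) *
        cascadeRec x μ (fun y => ENNReal.ofReal (Real.exp (L y))) p 0 := by
  have hL0 : L 0 = 0 := by simpa using hL 0 0
  induction p using Fin.reverseInduction generalizing y with
  | last => simp [hL0]
  | cast p ih =>
    have h := hx p.castSucc
    rw [cascadeRec_castSucc, cascadeRec_castSucc]
    simp_rw [fun z => ih (y + z), fun z => ih (0 + z), hL, hL0, zero_add, Real.exp_add,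
      ENNReal.ofReal_mul (Real.exp_pos _).le, mul_assoc, ENNReal.mul_rpow_of_nonneg _ _ h.le]
    have hm : Measurable fun z => ENNReal.ofReal (Real.exp (L z)) ^ x p.castSucc := by fun_prop
    rw [lintegral_const_mul _ (hm.mul_const _), ENNReal.mul_rpow_of_nonneg _ _ (by positivity),
      ← ENNReal.rpow_mul, mul_one_div_cancel h.ne', ENNReal.rpow_one]

lemma cascadeRec_exp_zero_ne_top (hx : ∀ p, 0 < x p) {L : E → ℝ}
    (hL : ∀ y z, L (y + z) = L y + L z) (hLm : Measurable L)
    (hfin : ∀ p, ∫⁻ z, ENNReal.ofReal (Real.exp (L z)) ^ x p.castSucc ∂(μ p) ≠ ∞)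
    (p : Fin (r + 1)) :
    cascadeRec x μ (fun y => ENNReal.ofReal (Real.exp (L y))) p 0 ≠ ∞ := by
  have hL0 : L 0 = 0 := by simpa using hL 0 0
  induction p using Fin.reverseInduction with
  | last => simp
  | cast p ih =>
    have h := hx p.castSucc
    rw [cascadeRec_castSucc]
    simp_rw [fun z => cascadeRec_exp (μ := μ) hx hL hLm p.succ (0 + z), zero_add,
      ENNReal.mul_rpow_of_nonneg _ _ h.le]
    rw [lintegral_mul_const _ (by fun_prop)]
    have := hfin p
    finiteness

lemma one_le_cascadeRec_exp_zero (hx : ∀ p, 0 < x p) {L : E → ℝ}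
    (hL : ∀ y z, L (y + z) = L y + L z) (hLm : Measurable L)
    (hone : ∀ p, 1 ≤ ∫⁻ z, ENNReal.ofReal (Real.exp (L z)) ^ x p.castSucc ∂(μ p))
    (p : Fin (r + 1)) :
    1 ≤ cascadeRec x μ (fun y => ENNReal.ofReal (Real.exp (L y))) p 0 := by
  have hL0 : L 0 = 0 := by simpa using hL 0 0
  induction p using Fin.reverseInduction with
  | last => simp [hL0]
  | cast p ih =>
    have h := hx p.castSucc
    rw [cascadeRec_castSucc]
    simp_rw [fun z => cascadeRec_exp (μ := μ) hx hL hLm p.succ (0 + z), zero_add,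
      ENNReal.mul_rpow_of_nonneg _ _ h.le]
    rw [lintegral_mul_const _ (by fun_prop)]
    refine ENNReal.one_le_rpow ?_ (by positivity)
    exact one_le_mul (hone p) (ENNReal.one_le_rpow ih h)

lemma cascadeRec_ne_zero [∀ p, NeZero (μ p)] [MeasurableAdd₂ E] [∀ p, SFinite (μ p)]
    (hx : ∀ p, 0 < x p) (hf : Measurable f) (hpos : ∀ y, f y ≠ 0) (p : Fin (r + 1)) (y : E) :
    cascadeRec x μ f p y ≠ 0 := by
  induction p using Fin.reverseInduction generalizing y with
  | last => simpa using hpos y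
  | cast p ih =>
    have h := hx p.castSucc
    rw [cascadeRec_castSucc]
    intro h0
    rw [ENNReal.rpow_eq_zero_iff_of_pos (by positivity), lintegral_eq_zero_iff
      (measurable_cascadeRec_shift hf _ _ _)] at h0
    have : ∀ᵐ z ∂(μ p), False := by
      filter_upwards [h0] with z hz
      simp only [Pi.zero_apply, ENNReal.rpow_eq_zero_iff_of_pos h] at hz
      exact ih _ hz
    simp at this
    exact NeZero.ne _ this

end Recursion

/-! ### The function `exp (-a)` on `[0, ∞]` -/

/-- `exp (-a)` for `a ∈ [0, ∞]`. -/
def expNeg (a : ℝ≥0∞) : ℝ≥0∞ := EReal.exp (-(a : EReal))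

@[simp] lemma expNeg_zero : expNeg 0 = 1 := by simp [expNeg]

@[simp] lemma expNeg_top : expNeg ∞ = 0 := by simp [expNeg]

lemma expNeg_le_one (a : ℝ≥0∞) : expNeg a ≤ 1 := by
  simpa [expNeg] using EReal.coe_ennreal_nonneg a

lemma expNeg_ne_top (a : ℝ≥0∞) : expNeg a ≠ ∞ := ((expNeg_le_one a).trans_lt ENNReal.one_lt_top).ne

lemma expNeg_strictAnti : StrictAnti expNeg := fun a b h => by
  simp only [expNeg, EReal.exp_lt_exp_iff, EReal.neg_lt_neg_iff]
  exact_mod_cast h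

lemma continuous_expNeg : Continuous expNeg :=
  ENNReal.continuous_exp.comp (continuous_neg.comp continuous_coe_ennreal_ereal)

@[fun_prop] lemma measurable_expNeg : Measurable expNeg := continuous_expNeg.measurable

lemma expNeg_add (a b : ℝ≥0∞) : expNeg (a + b) = expNeg a * expNeg b := by
  rw [expNeg, expNeg, expNeg, ← EReal.exp_add, EReal.coe_ennreal_add, EReal.neg_add, sub_eq_add_neg]
  · left; simp
  · right; simp

lemma expNeg_sum {ι : Type*} (s : Finset ι) (f : ι → ℝ≥0∞) :
    expNeg (∑ i ∈ s, f i) = ∏ i ∈ s, expNeg (f i) := by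
  classical
  induction s using Finset.induction_on with
  | empty => simp
  | insert i s hi ih => rw [Finset.sum_insert hi, Finset.prod_insert hi, expNeg_add, ih]

lemma expNeg_ofReal {t : ℝ} (ht : 0 ≤ t) :
    expNeg (ENNReal.ofReal t) = ENNReal.ofReal (Real.exp (-t)) := by
  rw [expNeg, EReal.coe_ennreal_ofReal, max_eq_left ht, ← EReal.coe_neg, EReal.exp_coe]

lemma expNeg_eq_ofReal {a : ℝ≥0∞} (ha : a ≠ ∞) :
    expNeg a = ENNReal.ofReal (Real.exp (-a.toReal)) := by
  conv_lhs => rw [← ENNReal.ofReal_toReal ha]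
  exact expNeg_ofReal ENNReal.toReal_nonneg

/-- `-log c` for `c ∈ [0, 1]`. -/
def negLog (c : ℝ≥0∞) : ℝ≥0∞ := (-(ENNReal.log c)).toENNReal

@[fun_prop] lemma measurable_negLog : Measurable negLog := by
  unfold negLog
  exact (measurable_neg.comp ENNReal.measurable_log).ereal_toENNReal

lemma expNeg_negLog {c : ℝ≥0∞} (hc : c ≤ 1) : expNeg (negLog c) = c := by
  have : 0 ≤ -ENNReal.log c := by
    rw [EReal.neg_nonneg, ENNReal.log_le_zero_iff]; exact hc
  rw [expNeg, negLog, EReal.coe_toENNReal this, neg_neg, ENNReal.exp_log]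

lemma tendsto_lintegral_expNeg {Ω ι : Type*} [MeasurableSpace Ω] {P : Measure Ω}
    [IsFiniteMeasure P] {l : Filter ι} [l.IsCountablyGenerated] {X : ι → Ω → ℝ≥0∞}
    {Y : Ω → ℝ≥0∞} (hX : ∀ i, Measurable (X i))
    (h : ∀ᵐ ω ∂P, Tendsto (fun i => X i ω) l (𝓝 (Y ω))) :
    Tendsto (fun i => ∫⁻ ω, expNeg (X i ω) ∂P) l (𝓝 (∫⁻ ω, expNeg (Y ω) ∂P)) := by
  refine tendsto_lintegral_filter_of_dominated_convergence (fun _ => 1) ?_ ?_ (by simp) ?_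
  · exact .of_forall fun i => measurable_expNeg.comp (hX i)
  · exact .of_forall fun i => .of_forall fun ω => expNeg_le_one _
  · filter_upwards [h] with ω hω using (continuous_expNeg.tendsto _).comp hω

/-- The Laplace transform of a sum of countably many independent variables. -/
lemma lintegral_expNeg_tsum {Ω ι : Type*} [MeasurableSpace Ω] {P : Measure Ω} [Countable ι]
    {X : ι → Ω → ℝ≥0∞} {K : ι → ℝ≥0∞} (hind : iIndepFun X P) (hX : ∀ i, Measurable (X i))
    (hK : ∀ i, ∫⁻ ω, expNeg (X i ω) ∂P = expNeg (K i)) :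
    ∫⁻ ω, expNeg (∑' i, X i ω) ∂P = expNeg (∑' i, K i) := by
  have := hind.isProbabilityMeasure
  have h1 : Tendsto (fun s : Finset ι => ∫⁻ ω, expNeg (∑ i ∈ s, X i ω) ∂P) atTop
      (𝓝 (∫⁻ ω, expNeg (∑' i, X i ω) ∂P)) :=
    tendsto_lintegral_expNeg (fun s => Finset.measurable_sum _ fun i _ => hX i)
      (.of_forall fun ω => ENNReal.summable.hasSum)
  have h2 : Tendsto (fun s : Finset ι => expNeg (∑ i ∈ s, K i)) atTop (𝓝 (expNeg (∑' i, K i))) :=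
    (continuous_expNeg.tendsto _).comp ENNReal.summable.hasSum
  refine tendsto_nhds_unique h1 (h2.congr fun s => ?_)
  simp_rw [expNeg_sum]
  rw [lintegral_prod_eq_prod_lintegral_of_indepFun s (fun i ω => expNeg (X i ω))
    (hind.comp (fun _ => expNeg) fun _ => measurable_expNeg) fun i => measurable_expNeg.comp (hX i)]
  simp_rw [hK]

/-! ### The Laplace functional of a Poisson process -/

section Poisson

variable {Ω : Type*} [MeasurableSpace Ω] {P : Measure Ω} {u : ℕ → Ω → ℝ} {ν : Measure ℝ}

lemma lintegral_pow_poissonMeasure (l : ℝ≥0) {q : ℝ≥0∞} (hq : q ≤ 1) :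
    ∫⁻ k, q ^ k ∂(poissonMeasure l) = expNeg (l * (1 - q)) := by
  have hqt : q ≠ ∞ := (hq.trans_lt ENNReal.one_lt_top).ne
  obtain ⟨t, rfl⟩ : ∃ t : ℝ≥0, q = t := ⟨q.toNNReal, (ENNReal.coe_toNNReal hqt).symm⟩
  have ht : t ≤ 1 := by exact_mod_cast hq
  rw [lintegral_countable']
  simp_rw [poissonMeasure_singleton]
  have h1 : ∀ k : ℕ, (t : ℝ≥0∞) ^ k * ENNReal.ofReal (Real.exp (-l) * l ^ k / k.factorial) =
      ENNReal.ofReal (Real.exp (-l) * ((l * t : ℝ) ^ k / k.factorial)) := by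
    intro k
    rw [← ENNReal.ofReal_coe_nnreal, ← ENNReal.ofReal_pow t.coe_nonneg, ← ENNReal.ofReal_mul (by positivity)]
    congr 1; rw [mul_pow]; ring
  have h2 : HasSum (fun k : ℕ => Real.exp (-l) * ((l * t : ℝ) ^ k / k.factorial))
      (Real.exp (-l) * Real.exp (l * t)) := by
    rw [congrFun Real.exp_eq_exp_ℝ (l * t : ℝ)]
    exact (NormedSpace.expSeries_div_hasSum_exp (l * t : ℝ)).mul_left _
  simp_rw [h1]
  rw [← ENNReal.ofReal_tsum_of_nonneg (fun k => by positivity) h2.summable, h2.tsum_eq,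
    expNeg_eq_ofReal (by finiteness), ← Real.exp_add]
  congr 2
  rw [ENNReal.toReal_mul, ENNReal.toReal_sub_of_le (by exact_mod_cast ht) (by simp)]
  simp; ring

/-! ### Point processes as random counting measures -/

lemma count_map_apply {B : Set ℝ} (hB : MeasurableSet B) (ω : Ω) :
    (Measure.count.map fun n => u n ω) B = pointCount u B ω := by
  rw [Measure.map_apply (by fun_prop) hB, Measure.count_apply]
  · rfl
  · trivial

lemma tsum_eq_lintegral_count_map {g : ℝ → ℝ≥0∞} (hg : Measurable g) (ω : Ω) :
    ∑' n, g (u n ω) = ∫⁻ t, g t ∂(Measure.count.map fun n => u n ω) := by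
  rw [lintegral_map hg (by fun_prop), lintegral_count]

lemma measurable_pointCount (hu : ∀ n, Measurable (u n)) {B : Set ℝ} (hB : MeasurableSet B) :
    Measurable (pointCount u B) := by
  refine measurable_to_countable' fun k => ?_
  have h : Measurable fun ω => (pointCount u B ω : ℝ≥0∞) := by
    have : (fun ω => (pointCount u B ω : ℝ≥0∞)) = fun ω => ∑' n, B.indicator 1 (u n ω) := by
      ext ω
      rw [tsum_eq_lintegral_count_map (measurable_one.indicator hB), lintegral_indicator_one hB,
        count_map_apply hB]
    rw [this]
    exact Measurable.tsum fun n => (measurable_one.indicator hB).comp (hu n)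
  have : pointCount u B ⁻¹' {k} = (fun ω => (pointCount u B ω : ℝ≥0∞)) ⁻¹' {(k : ℝ≥0∞)} := by
    ext ω; simp
  rw [this]
  exact h (measurableSet_singleton _)

variable [IsProbabilityMeasure P]

/-- The finite counts have the prescribed masses. Both measures have total mass one, so the masses
of the infinite count agree as well. -/
lemma IsDecreasingPoisson.map_pointCount (hu : IsDecreasingPoisson u ν P) {B : Set ℝ}
    (hB : MeasurableSet B) (hνB : ν B ≠ ∞) :
    P.map (pointCount u B) = (poissonMeasure (ν B).toNNReal).map (Nat.cast : ℕ → ℕ∞) := by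
  have hm := measurable_pointCount hu.measurable hB
  have hcast : Measurable (Nat.cast : ℕ → ℕ∞) := .of_discrete
  have : IsProbabilityMeasure (P.map (pointCount u B)) :=
    Measure.isProbabilityMeasure_map hm.aemeasurable
  have : IsProbabilityMeasure ((poissonMeasure (ν B).toNNReal).map (Nat.cast : ℕ → ℕ∞)) :=
    Measure.isProbabilityMeasure_map hcast.aemeasurable
  have hnat : ∀ k : ℕ, P.map (pointCount u B) {(k : ℕ∞)} =
      (poissonMeasure (ν B).toNNReal).map (Nat.cast : ℕ → ℕ∞) {(k : ℕ∞)} := by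
    intro k
    rw [Measure.map_apply hm (measurableSet_singleton _),
      Measure.map_apply hcast (measurableSet_singleton _)]
    have h := hu.poisson B hB hνB k
    have hpre : (Nat.cast : ℕ → ℕ∞) ⁻¹' {(k : ℕ∞)} = {k} := by
      ext j
      simp
    rw [hpre, ← h]
    rfl
  have hrange : ∀ Q : Measure ℕ∞, Q (Set.range (Nat.cast : ℕ → ℕ∞)) = ∑' k : ℕ, Q {(k : ℕ∞)} := by
    intro Q
    rw [← Set.iUnion_singleton_eq_range, measure_iUnion _ fun _ => measurableSet_singleton _]
    intro i j hij
    simpa using hij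
  have htop : ({⊤} : Set ℕ∞) = (Set.range (Nat.cast : ℕ → ℕ∞))ᶜ := by
    ext k
    induction k using ENat.recTopCoe with
    | top => simp
    | coe k => simp
  refine Measure.ext_of_singleton fun k => ?_
  induction k using ENat.recTopCoe with
  | top =>
    rw [htop, prob_compl_eq_one_sub (by trivial), prob_compl_eq_one_sub (by trivial), hrange,
      hrange]
    simp_rw [hnat]
  | coe k => exact hnat k

lemma IsDecreasingPoisson.lintegral_expNeg_mul_pointCount (hu : IsDecreasingPoisson u ν P)
    {B : Set ℝ} (hB : MeasurableSet B) (hνB : ν B ≠ ∞) (c : ℝ≥0∞) :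
    ∫⁻ ω, expNeg (c * pointCount u B ω) ∂P = expNeg ((1 - expNeg c) * ν B) := by
  have hm := measurable_pointCount hu.measurable hB
  have hcast : Measurable (Nat.cast : ℕ → ℕ∞) := .of_discrete
  have hf : Measurable fun k : ℕ∞ => expNeg (c * k) := .of_discrete
  have h1 : ∀ k : ℕ, expNeg (c * ((k : ℕ∞) : ℝ≥0∞)) = expNeg c ^ k := by
    intro k
    have := expNeg_sum (Finset.range k) fun _ => c
    simpa [mul_comm] using this
  rw [← lintegral_map (f := fun k : ℕ∞ => expNeg (c * k)) hf hm, hu.map_pointCount hB hνB,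
    lintegral_map hf hcast]
  simp_rw [h1]
  rw [lintegral_pow_poissonMeasure _ (expNeg_le_one c), ENNReal.coe_toNNReal hνB, mul_comm]

/-- The series is a combination of the point counts of the level sets, which are disjoint and so
have independent Poisson counts. -/
lemma IsDecreasingPoisson.lintegral_expNeg_tsum_simpleFunc (hu : IsDecreasingPoisson u ν P)
    (g : SimpleFunc ℝ ℝ≥0∞) (hg : ∀ c ≠ 0, ν (g ⁻¹' {c}) ≠ ∞) :
    ∫⁻ ω, expNeg (∑' n, g (u n ω)) ∂P = expNeg (∫⁻ t, (1 - expNeg (g t)) ∂ν) := by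
  classical
  -- The level set of $0$ may have infinite measure, but it contributes nothing to either side.
  set R := g.range.filter (· ≠ 0) with hR
  let e : Fin R.card ≃ R := R.equivFin.symm
  have hB : ∀ j, MeasurableSet (g ⁻¹' {(e j : ℝ≥0∞)}) := fun j => g.measurableSet_preimage _
  have hsum : ∀ (Q : Measure ℝ) (f : ℝ≥0∞ → ℝ≥0∞), f 0 = 0 → ∫⁻ t, f (g t) ∂Q =
      ∑' j, f (e j) * Q (g ⁻¹' {(e j : ℝ≥0∞)}) := by
    intro Q f hf
    have h1 : ∫⁻ t, f (g t) ∂Q = (g.map f).lintegral Q := by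
      rw [← SimpleFunc.lintegral_eq_lintegral]; rfl
    rw [h1, SimpleFunc.map_lintegral, tsum_fintype,
      Equiv.sum_comp e (fun c : R => f c * Q (g ⁻¹' {(c : ℝ≥0∞)})),
      Finset.sum_coe_sort R (fun c => f c * Q (g ⁻¹' {c})), hR, Finset.sum_filter]
    refine Finset.sum_congr rfl fun c _ => ?_
    by_cases hc : c = 0 <;> simp [hc, hf]
  have hdisj : Pairwise (Function.onFun Disjoint fun j => g ⁻¹' {(e j : ℝ≥0∞)}) := by
    intro i j hij
    refine Disjoint.preimage _ ?_
    simpa [Subtype.ext_iff] using fun h => hij (e.injective (Subtype.ext h))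
  have hL : ∀ ω, ∑' n, g (u n ω) =
      ∑' j, (e j : ℝ≥0∞) * pointCount u (g ⁻¹' {(e j : ℝ≥0∞)}) ω := by
    intro ω
    rw [tsum_eq_lintegral_count_map g.measurable]
    refine (hsum _ id rfl).trans ?_
    simp_rw [count_map_apply (hB _), id]
  simp_rw [hL]
  rw [hsum ν (fun c => 1 - expNeg c) (by simp)]
  refine lintegral_expNeg_tsum ?_ ?_ ?_
  · exact (hu.indep _ _ hB hdisj).comp (fun j k => (e j : ℝ≥0∞) * (k : ℕ∞)) fun j => .of_discrete
  · intro j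
    have : Measurable fun k : ℕ∞ => (e j : ℝ≥0∞) * (k : ℝ≥0∞) := .of_discrete
    exact this.comp (measurable_pointCount hu.measurable (hB j))
  · intro j
    exact hu.lintegral_expNeg_mul_pointCount (hB j)
      (hg _ (Finset.mem_filter.1 (e j).2).2) _

/-- The Laplace functional of a Poisson process. -/
lemma IsDecreasingPoisson.lintegral_expNeg_tsum_comp [SigmaFinite ν]
    (hu : IsDecreasingPoisson u ν P) {g : ℝ → ℝ≥0∞} (hg : Measurable g) :
    ∫⁻ ω, expNeg (∑' n, g (u n ω)) ∂P = expNeg (∫⁻ t, (1 - expNeg (g t)) ∂ν) := by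
  -- Cutting off to sets of finite measure makes the nonzero level sets admissible while keeping
  -- monotone convergence to `g`.
  let G : ℕ → SimpleFunc ℝ ℝ≥0∞ := fun n => (SimpleFunc.eapprox g n).restrict (spanningSets ν n)
  have hGval : ∀ n t, G n t = (spanningSets ν n).indicator (SimpleFunc.eapprox g n) t := fun n t =>
    SimpleFunc.restrict_apply _ (measurableSet_spanningSets ν n) t
  have hGmono : ∀ t, Monotone fun n => G n t := by
    intro t i j hij
    simp only [hGval]
    exact (Set.indicator_le_indicator_of_subset (monotone_spanningSets ν hij) (fun _ => zero_le) t).trans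
      (Set.indicator_le_indicator (SimpleFunc.monotone_eapprox g hij t))
  have hGlim : ∀ t, Tendsto (fun n => G n t) atTop (𝓝 (g t)) := by
    intro t
    have h1 : Tendsto (fun n => SimpleFunc.eapprox g n t) atTop (𝓝 (g t)) := by
      rw [← SimpleFunc.iSup_eapprox_apply hg t]
      exact tendsto_atTop_iSup fun i j hij => SimpleFunc.monotone_eapprox g hij t
    refine h1.congr' ?_
    filter_upwards [eventually_ge_atTop (spanningSetsIndex ν t)] with n hn
    rw [hGval, Set.indicator_of_mem]
    exact monotone_spanningSets ν hn (mem_spanningSetsIndex ν t)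
  have hGfin : ∀ n, ∀ c ≠ 0, ν (G n ⁻¹' {c}) ≠ ∞ := by
    intro n c hc
    refine ((measure_mono fun t ht => ?_).trans_lt (measure_spanningSets_lt_top ν n)).ne
    by_contra h
    rw [Set.mem_preimage, hGval, Set.indicator_of_notMem h] at ht
    exact hc ht.symm
  have h1 : Tendsto (fun n => ∫⁻ ω, expNeg (∑' k, G n (u k ω)) ∂P) atTop
      (𝓝 (∫⁻ ω, expNeg (∑' n, g (u n ω)) ∂P)) := by
    refine tendsto_lintegral_expNeg (fun n => Measurable.tsum fun k =>
      (G n).measurable.comp (hu.measurable k)) (.of_forall fun ω => ?_)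
    rw [tsum_eq_lintegral_count_map hg]
    simp_rw [tsum_eq_lintegral_count_map (G _).measurable]
    exact lintegral_tendsto_of_tendsto_of_monotone (fun n => (G n).measurable.aemeasurable)
      (.of_forall hGmono) (.of_forall hGlim)
  have h2 : Tendsto (fun n => ∫⁻ t, (1 - expNeg (G n t)) ∂ν) atTop
      (𝓝 (∫⁻ t, (1 - expNeg (g t)) ∂ν)) := by
    refine lintegral_tendsto_of_tendsto_of_monotone (fun n => ?_) (.of_forall fun t i j hij => ?_)
      (.of_forall fun t => ?_)
    · exact (measurable_const.sub (measurable_expNeg.comp (G n).measurable)).aemeasurable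
    · exact tsub_le_tsub_left (expNeg_strictAnti.antitone (hGmono t hij)) _
    · exact ENNReal.Tendsto.sub tendsto_const_nhds ((continuous_expNeg.tendsto _).comp (hGlim t))
        (.inl ENNReal.one_ne_top)
  refine tendsto_nhds_unique h1 (((continuous_expNeg.tendsto _).comp h2).congr fun n => ?_)
  exact (hu.lintegral_expNeg_tsum_simpleFunc (G n) (hGfin n)).symm

/-- The Laplace functional of a Poisson process with independent marks. -/
lemma IsDecreasingPoisson.lintegral_expNeg_tsum_marked {E : Type*} [MeasurableSpace E]
    [SigmaFinite ν] (hu : IsDecreasingPoisson u ν P) {μ : Measure E} [IsProbabilityMeasure μ]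
    {Y : ℕ → Ω → E} (hY : ∀ n, Measurable (Y n))
    (hlaw : P.map (fun ω n => Y n ω) = Measure.infinitePi fun _ => μ)
    (hind : IndepFun (fun ω n => u n ω) (fun ω n => Y n ω) P)
    {h : ℝ → E → ℝ≥0∞} (hh : Measurable (Function.uncurry h)) :
    ∫⁻ ω, expNeg (∑' n, h (u n ω) (Y n ω)) ∂P =
      expNeg (∫⁻ t, (∫⁻ y, (1 - expNeg (h t y)) ∂μ) ∂ν) := by
  have hum : Measurable fun ω n => u n ω := measurable_pi_lambda _ hu.measurable
  have hYm : Measurable fun ω n => Y n ω := measurable_pi_lambda _ hY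
  have hprod := (indepFun_iff_map_prod_eq_prod_map_map hum.aemeasurable hYm.aemeasurable).1 hind
  have hF : Measurable fun q : (ℕ → ℝ) × (ℕ → E) => expNeg (∑' n, h (q.1 n) (q.2 n)) := by
    refine measurable_expNeg.comp (Measurable.tsum fun n => ?_)
    exact hh.comp (by fun_prop : Measurable fun q : (ℕ → ℝ) × (ℕ → E) => (q.1 n, q.2 n))
  have hle : ∀ t, ∫⁻ y, expNeg (h t y) ∂μ ≤ 1 := fun t =>
    (lintegral_mono fun y => expNeg_le_one _).trans (by simp)
  have hht : ∀ t, Measurable (h t) := fun t => hh.comp measurable_prodMk_left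
  -- Given the points, the marks are independent, so averaging over them replaces `h t` by minus the
  -- logarithm of its Laplace transform. This reduces the claim to the process without marks.
  set g : ℝ → ℝ≥0∞ := fun t => negLog (∫⁻ y, expNeg (h t y) ∂μ) with hgdef
  have hg : Measurable g :=
    measurable_negLog.comp (Measurable.lintegral_prod_right (measurable_expNeg.comp hh))
  have hgexp : ∀ t, expNeg (g t) = ∫⁻ y, expNeg (h t y) ∂μ := fun t => expNeg_negLog (hle t)
  have hinner : ∀ v : ℕ → ℝ, ∫⁻ y, expNeg (∑' n, h (v n) (y n)) ∂(Measure.infinitePi fun _ => μ) =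
      expNeg (∑' n, g (v n)) := by
    intro v
    refine lintegral_expNeg_tsum (X := fun n (y : ℕ → E) => h (v n) (y n)) ?_ ?_ ?_
    · exact iIndepFun_infinitePi (X := fun n => h (v n)) fun n => hht (v n)
    · exact fun n => (hht _).comp (measurable_pi_apply n)
    · intro n
      rw [hgexp]
      exact (measurePreserving_eval_infinitePi (fun _ => μ) n).lintegral_comp
        (f := fun y => expNeg (h (v n) y)) (measurable_expNeg.comp (hht _))
  calc ∫⁻ ω, expNeg (∑' n, h (u n ω) (Y n ω)) ∂P
      = ∫⁻ q, expNeg (∑' n, h (q.1 n) (q.2 n)) ∂(P.map fun ω => (fun n => u n ω, fun n => Y n ω)) := by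
        rw [lintegral_map hF (hum.prodMk hYm)]
    _ = ∫⁻ v, ∫⁻ y, expNeg (∑' n, h (v n) (y n)) ∂(Measure.infinitePi fun _ => μ)
          ∂(P.map fun ω n => u n ω) := by
        have : IsProbabilityMeasure (P.map fun ω n => u n ω) :=
          Measure.isProbabilityMeasure_map hum.aemeasurable
        rw [hprod, hlaw, lintegral_prod _ hF.aemeasurable]
    _ = ∫⁻ ω, expNeg (∑' n, g (u n ω)) ∂P := by
        simp_rw [hinner]
        rw [lintegral_map (by fun_prop) hum]
    _ = expNeg (∫⁻ t, (1 - expNeg (g t)) ∂ν) := hu.lintegral_expNeg_tsum_comp hg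
    _ = _ := by
        congr 1
        refine lintegral_congr fun t => ?_
        rw [lintegral_sub (f := fun _ => 1) (g := fun y => expNeg (h t y)) (measurable_expNeg.comp (hht t))
          ((hle t).trans_lt ENNReal.one_lt_top).ne (.of_forall fun y => expNeg_le_one _), hgexp]
        simp

end Poisson

/-! ### Power law measures on `(0, ∞)` -/

/-- The measure `k t ^ (-1 - η) dt` on `(0, ∞)`. -/
def powerMeasure (k η : ℝ) : Measure ℝ :=
  (volume.restrict (Set.Ioi 0)).withDensity fun t => ENNReal.ofReal (k * t ^ (-1 - η))

lemma powerIntensity_eq (ζ : ℝ) : powerIntensity ζ = powerMeasure ζ ζ := rfl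

instance (k η : ℝ) : SigmaFinite (powerMeasure k η) :=
  SigmaFinite.withDensity_ofReal _

instance (ζ : ℝ) : SigmaFinite (powerIntensity ζ) :=
  SigmaFinite.withDensity_ofReal _

lemma lintegral_powerMeasure (k η : ℝ) {g : ℝ → ℝ≥0∞} (hg : Measurable g) :
    ∫⁻ t, g t ∂(powerMeasure k η) =
      ∫⁻ t in Set.Ioi 0, ENNReal.ofReal (k * t ^ (-1 - η)) * g t := by
  rw [powerMeasure, lintegral_withDensity_eq_lintegral_mul _ (by fun_prop) hg]
  rfl

/-- Substitution: the density is homogeneous of degree $-1-\eta$ and $dt$ supplies one more power of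
$c$. -/
lemma lintegral_powerMeasure_comp_mul (k η : ℝ) {g : ℝ → ℝ≥0∞} (hg : Measurable g) {c : ℝ}
    (hc : 0 < c) : ∫⁻ t, g (c * t) ∂(powerMeasure k η) =
      ENNReal.ofReal (c ^ η) * ∫⁻ t, g t ∂(powerMeasure k η) := by
  have hgc : Measurable fun t => g (c * t) := hg.comp (measurable_const_mul c)
  rw [lintegral_powerMeasure _ _ hg, lintegral_powerMeasure _ _ hgc,
    ← lintegral_indicator measurableSet_Ioi, ← lintegral_indicator measurableSet_Ioi]
  set F : ℝ → ℝ≥0∞ := (Set.Ioi 0).indicator fun t => ENNReal.ofReal (k * t ^ (-1 - η)) * g t with hF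
  have hFm : Measurable F := Measurable.indicator (by fun_prop) measurableSet_Ioi
  have h1 : ∀ t, (Set.Ioi (0 : ℝ)).indicator
      (fun t => ENNReal.ofReal (k * t ^ (-1 - η)) * g (c * t)) t =
        ENNReal.ofReal (c ^ (1 + η)) * F (c * t) := by
    intro t
    by_cases ht : 0 < t
    · have hct : 0 < c * t := mul_pos hc ht
      rw [hF, Set.indicator_of_mem (by exact ht), Set.indicator_of_mem (by exact hct), ← mul_assoc,
        ← ENNReal.ofReal_mul (by positivity), Real.mul_rpow hc.le ht.le]
      congr 2
      rw [show c ^ (1 + η) * (k * (c ^ (-1 - η) * t ^ (-1 - η))) =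
        (c ^ (1 + η) * c ^ (-1 - η)) * (k * t ^ (-1 - η)) by ring, ← Real.rpow_add hc]
      simp
    · have hct : ¬ 0 < c * t := by
        rw [mul_pos_iff_of_pos_left hc]; exact ht
      rw [hF, Set.indicator_of_notMem (by exact ht), Set.indicator_of_notMem (by exact hct), mul_zero]
  simp_rw [h1]
  have hFc : Measurable fun t => F (c * t) := hFm.comp (measurable_const_mul c)
  rw [lintegral_const_mul _ hFc,
    ← lintegral_map (f := F) hFm (measurable_const_mul c), Real.map_volume_mul_left hc.ne',
    lintegral_smul_measure, smul_eq_mul, ← mul_assoc, ← ENNReal.ofReal_mul (by positivity)]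
  congr 2
  rw [abs_of_pos (by positivity), Real.rpow_add hc, Real.rpow_one]
  field_simp

lemma lintegral_powerMeasure_comp_mul_ennreal (k : ℝ) {η : ℝ} (hη : 0 < η) {g : ℝ≥0∞ → ℝ≥0∞}
    (hg : Measurable g) (hg0 : g 0 = 0) {b : ℝ≥0∞} (hb : b ≠ ∞) :
    ∫⁻ t, g (ENNReal.ofReal t * b) ∂(powerMeasure k η) =
      b ^ η * ∫⁻ t, g (ENNReal.ofReal t) ∂(powerMeasure k η) := by
  rcases eq_or_ne b 0 with rfl | hb0
  · simp [hg0, hη]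
  have hpos : 0 < b.toReal := ENNReal.toReal_pos hb0 hb
  have h := lintegral_powerMeasure_comp_mul k η (g := fun t => g (ENNReal.ofReal t))
    (by fun_prop) hpos
  rw [← ENNReal.ofReal_rpow_of_pos hpos, ENNReal.ofReal_toReal hb] at h
  rw [← h]
  refine lintegral_congr fun t => ?_
  rw [ENNReal.ofReal_mul hpos.le, ENNReal.ofReal_toReal hb, mul_comm]

lemma one_sub_expNeg_le (a : ℝ≥0∞) : 1 - expNeg a ≤ a := by
  rcases eq_or_ne a ∞ with rfl | ha
  · simp
  rw [expNeg_eq_ofReal ha, tsub_le_iff_right, ← ENNReal.ofReal_one]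
  have h1 : a = ENNReal.ofReal a.toReal := (ENNReal.ofReal_toReal ha).symm
  refine le_of_le_of_eq ?_ (congrArg (· + _) h1.symm)
  rw [← ENNReal.ofReal_add ENNReal.toReal_nonneg (Real.exp_pos _).le]
  exact ENNReal.ofReal_le_ofReal (by linarith [Real.add_one_le_exp (-a.toReal)])

/-- Near $0$ the integrand is at most a constant times $t^{\eta-\theta-1}$, integrable since
$\theta<\eta$; beyond $1$ it is at most $k t^{-1-\theta}$. -/
lemma lintegral_one_sub_expNeg_ne_top {k θ η : ℝ} (hk : 0 ≤ k) (hθ : 0 < θ) (hη : θ < η)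
    {C : ℝ≥0∞} (hC : C ≠ ∞) :
    ∫⁻ t, (1 - expNeg (C * ENNReal.ofReal t ^ η)) ∂(powerMeasure k θ) ≠ ∞ := by
  rw [lintegral_powerMeasure _ _ (by fun_prop), ← Set.Ioc_union_Ioi_eq_Ioi (zero_le_one' ℝ)]
  refine ((lintegral_union_le _ _ _).trans_lt (ENNReal.add_lt_top.2 ⟨?_, ?_⟩)).ne
  · have hint : IntegrableOn (fun t : ℝ => k * (C.toReal * t ^ (η - θ - 1))) (Set.Ioc 0 1) :=
      (((intervalIntegral.intervalIntegrable_rpow' (a := 0) (b := 1) (by linarith)).1).const_mul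
        _).const_mul _
    refine (setLIntegral_mono_ae (g := fun t => ENNReal.ofReal (k * (C.toReal * t ^ (η - θ - 1))))
      (by fun_prop) (.of_forall fun t ht => ?_)).trans_lt hint.lintegral_lt_top
    have ht0 : 0 < t := ht.1
    calc _ ≤ ENNReal.ofReal (k * t ^ (-1 - θ)) * (C * ENNReal.ofReal t ^ η) := by
          gcongr; exact one_sub_expNeg_le _
      _ = _ := by
        rw [ENNReal.ofReal_rpow_of_pos ht0]
        conv_lhs => rw [← ENNReal.ofReal_toReal hC]
        rw [← ENNReal.ofReal_mul (by positivity), ← ENNReal.ofReal_mul (by positivity)]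
        congr 1
        rw [show η - θ - 1 = (-1 - θ) + η by ring, Real.rpow_add ht0]
        ring
  · have hint : IntegrableOn (fun t : ℝ => k * t ^ (-1 - θ)) (Set.Ioi 1) :=
      (integrableOn_Ioi_rpow_of_lt (by linarith) one_pos).const_mul _
    refine (setLIntegral_mono_ae (g := fun t => ENNReal.ofReal (k * t ^ (-1 - θ)))
      (by fun_prop) (.of_forall fun t ht => ?_)).trans_lt hint.lintegral_lt_top
    exact mul_le_of_le_one_right' tsub_le_self

lemma powerMeasure_Ioi_pos {k : ℝ} (hk : 0 < k) (η : ℝ) {g : ℝ → ℝ≥0∞} (hg : Measurable g)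
    (hpos : ∀ t, 0 < t → g t ≠ 0) : ∫⁻ t, g t ∂(powerMeasure k η) ≠ 0 := by
  rw [lintegral_powerMeasure _ _ hg, Ne, setLIntegral_eq_zero_iff measurableSet_Ioi (by fun_prop)]
  intro h
  have h2 : ∀ᵐ t : ℝ, t ∉ Set.Ioi (0 : ℝ) := by
    filter_upwards [h] with t ht htpos
    have h3 := ht htpos
    have htpos' : (0 : ℝ) < t := htpos
    rw [mul_eq_zero] at h3
    rcases h3 with h3 | h3
    · rw [ENNReal.ofReal_eq_zero] at h3
      have : 0 < k * t ^ (-1 - η) := by positivity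
      linarith
    · exact hpos t htpos' h3
  have h3 : volume (Set.Ioi (0 : ℝ)) = 0 := measure_eq_zero_iff_ae_notMem.2 h2
  simp at h3

lemma one_sub_expNeg_ne_zero {a : ℝ≥0∞} (ha : a ≠ 0) : 1 - expNeg a ≠ 0 := by
  have := expNeg_strictAnti (pos_iff_ne_zero.2 ha)
  rw [expNeg_zero] at this
  exact (tsub_pos_of_lt this).ne'

/-! ### Independence of the levels of a tree of independent variables -/

lemma indepFun_of_measurable_iSup {Ω ι : Type*} {m : MeasurableSpace Ω} {P : Measure Ω}
    {β : ι → Type*} [∀ i, MeasurableSpace (β i)] {W : ∀ i, Ω → β i} (hW : iIndepFun W P)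
    (hWm : ∀ i, Measurable (W i)) {S T : Set ι} (hST : Disjoint S T) {γ δ : Type*}
    [MeasurableSpace γ] [MeasurableSpace δ] {X : Ω → γ} {Y : Ω → δ}
    (hX : Measurable[⨆ i ∈ S, MeasurableSpace.comap (W i) inferInstance] X)
    (hY : Measurable[⨆ i ∈ T, MeasurableSpace.comap (W i) inferInstance] Y) :
    IndepFun X Y P := by
  have h := indep_iSup_of_disjoint (fun i => (hWm i).comap_le) hW hST
  rw [IndepFun_iff_Indep]
  exact indep_of_indep_of_le_left (indep_of_indep_of_le_right h hY.comap_le) hX.comap_le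

lemma measurable_iSup_comap {Ω ι : Type*} {β : ι → Type*} [∀ i, MeasurableSpace (β i)]
    (W : ∀ i, Ω → β i) {S : Set ι} {i : ι} (hi : i ∈ S) :
    Measurable[⨆ i ∈ S, MeasurableSpace.comap (W i) inferInstance] (W i) :=
  (comap_measurable (W i)).mono (le_iSup₂ (f := fun i (_ : i ∈ S) =>
    MeasurableSpace.comap (W i) inferInstance) i hi) le_rfl

/-- Conditioning on `X`, with the independent variable `Y` resampled on the same space. -/
lemma lintegral_comp_of_indepFun {Ω β γ : Type*} [MeasurableSpace Ω] [MeasurableSpace β]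
    [MeasurableSpace γ] {P : Measure Ω} [IsProbabilityMeasure P] {X : Ω → β} {Y : Ω → γ}
    (h : IndepFun X Y P) (hX : Measurable X) (hY : Measurable Y) {F : β × γ → ℝ≥0∞}
    (hF : Measurable F) :
    ∫⁻ ω, F (X ω, Y ω) ∂P = ∫⁻ ω, ∫⁻ ω', F (X ω, Y ω') ∂P ∂P := by
  have : IsProbabilityMeasure (P.map Y) := Measure.isProbabilityMeasure_map hY.aemeasurable
  have : IsProbabilityMeasure (P.map X) := Measure.isProbabilityMeasure_map hX.aemeasurable
  rw [← lintegral_map hF (hX.prodMk hY),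
    (indepFun_iff_map_prod_eq_prod_map_map hX.aemeasurable hY.aemeasurable).1 h,
    lintegral_prod _ hF.aemeasurable, lintegral_map (Measurable.lintegral_prod_right' hF) hX]
  refine lintegral_congr fun ω => ?_
  exact lintegral_map (f := fun y => F (X ω, y)) (hF.comp measurable_prodMk_left) hY

/-! ### Weights and fields along the paths of the tree -/

section Tree

variable {r : ℕ}

/-- The vertex at depth `q < p` on the path from the root to the vertex `a ∈ ℕ ^ p`. -/
def pathVertex {p : ℕ} (hp : p ≤ r) (a : Fin p → ℕ) (q : Fin p) : Vertex r :=
  ⟨⟨q, q.2.trans_le hp⟩, fun j => a (Fin.castLE q.isLt.le j)⟩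

lemma pathVertex_snoc_castSucc {p : ℕ} (hp : p + 1 ≤ r) (a : Fin p → ℕ) (n : ℕ) (q : Fin p) :
    pathVertex hp (Fin.snoc (α := fun _ => ℕ) a n) q.castSucc =
      pathVertex (Nat.le_of_succ_le hp) a q := by
  unfold pathVertex
  congr 1
  ext j
  exact Fin.snoc_castSucc (α := fun _ => ℕ) n a (Fin.castLE q.isLt.le j)

lemma pathVertex_snoc_last {p : ℕ} (hp : p + 1 ≤ r) (a : Fin p → ℕ) (n : ℕ) :
    pathVertex hp (Fin.snoc (α := fun _ => ℕ) a n) (Fin.last p) = ⟨⟨p, hp⟩, a⟩ := by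
  unfold pathVertex
  congr 1
  ext j
  exact Fin.snoc_castSucc (α := fun _ => ℕ) n a j

/-- The product of the points attached to the vertices on the path to `a ∈ ℕ ^ p`. -/
def pathWeight {p : ℕ} (hp : p ≤ r) (U : Vertex r → ℕ → ℝ) (a : Fin p → ℕ) : ℝ≥0∞ :=
  ∏ q : Fin p, ENNReal.ofReal (U (pathVertex hp a q) (a q))

/-- The sum of the increments attached to the vertices on the path to `a ∈ ℕ ^ p`. -/
def pathSum {E : Type*} [AddCommMonoid E] {p : ℕ} (hp : p ≤ r) (Y : Vertex r → ℕ → E)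
    (a : Fin p → ℕ) : E :=
  ∑ q : Fin p, Y (pathVertex hp a q) (a q)

lemma pathWeight_snoc {p : ℕ} (hp : p + 1 ≤ r) (U : Vertex r → ℕ → ℝ) (a : Fin p → ℕ) (n : ℕ) :
    pathWeight hp U (Fin.snoc (α := fun _ => ℕ) a n) =
      pathWeight (Nat.le_of_succ_le hp) U a * ENNReal.ofReal (U ⟨⟨p, hp⟩, a⟩ n) := by
  unfold pathWeight
  rw [Fin.prod_univ_castSucc]
  simp_rw [pathVertex_snoc_castSucc, pathVertex_snoc_last]
  simp

lemma pathSum_snoc {E : Type*} [AddCommMonoid E] {p : ℕ} (hp : p + 1 ≤ r) (Y : Vertex r → ℕ → E)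
    (a : Fin p → ℕ) (n : ℕ) :
    pathSum hp Y (Fin.snoc (α := fun _ => ℕ) a n) =
      pathSum (Nat.le_of_succ_le hp) Y a + Y ⟨⟨p, hp⟩, a⟩ n := by
  unfold pathSum
  rw [Fin.sum_univ_castSucc]
  simp_rw [pathVertex_snoc_castSucc, pathVertex_snoc_last]
  simp

lemma pathWeight_ne_top {p : ℕ} (hp : p ≤ r) (U : Vertex r → ℕ → ℝ) (a : Fin p → ℕ) :
    pathWeight hp U a ≠ ∞ := ENNReal.prod_ne_top fun _ _ => ENNReal.ofReal_ne_top

lemma tsum_snoc {p : ℕ} (F : (Fin (p + 1) → ℕ) → ℝ≥0∞) :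
    ∑' b, F b = ∑' a : Fin p → ℕ, ∑' n : ℕ, F (Fin.snoc (α := fun _ => ℕ) a n) := by
  rw [ENNReal.tsum_comm, ← (Fin.snocEquiv fun _ => ℕ).tsum_eq F, ENNReal.tsum_prod']
  rfl

/-- The constants `C_r = 1`, `C_p = ∫ (1 - exp (-C_{p+1} t ^ x_{p+1})) x_p t ^ (-1 - x_p) dt`. -/
def cascadeConst (x : Fin (r + 1) → ℝ) : Fin (r + 1) → ℝ≥0∞ :=
  Fin.reverseInduction (motive := fun _ => ℝ≥0∞) 1
    (fun p C => ∫⁻ t, (1 - expNeg (C * ENNReal.ofReal t ^ x p.succ))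
      ∂(powerIntensity (x p.castSucc)))

variable {x : Fin (r + 1) → ℝ}

@[simp] lemma cascadeConst_last : cascadeConst x (Fin.last r) = 1 := by simp [cascadeConst]

lemma cascadeConst_castSucc (p : Fin r) : cascadeConst x p.castSucc =
    ∫⁻ t, (1 - expNeg (cascadeConst x p.succ * ENNReal.ofReal t ^ x p.succ))
      ∂(powerIntensity (x p.castSucc)) := by simp [cascadeConst]

/-- Strict growth $x_p<x_{p+1}$ is what makes each integral converge at $0$. -/
lemma cascadeConst_ne_top (hx : ∀ p, 0 < x p) (hmono : StrictMono x) (p : Fin (r + 1)) :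
    cascadeConst x p ≠ ∞ := by
  induction p using Fin.reverseInduction with
  | last => simp
  | cast p ih =>
    rw [cascadeConst_castSucc]
    exact lintegral_one_sub_expNeg_ne_top (hx _).le (hx _) (hmono Fin.castSucc_lt_succ) ih

lemma cascadeConst_ne_zero (hx : ∀ p, 0 < x p) (p : Fin (r + 1)) : cascadeConst x p ≠ 0 := by
  induction p using Fin.reverseInduction with
  | last => simp
  | cast p ih =>
    rw [cascadeConst_castSucc]
    refine powerMeasure_Ioi_pos (hx _) _ (by fun_prop) fun t ht => ?_
    refine one_sub_expNeg_ne_zero (mul_ne_zero ih ?_)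
    rw [ENNReal.ofReal_rpow_of_pos ht, Ne, ENNReal.ofReal_eq_zero, not_le]
    positivity

variable {Ω E : Type*} [MeasurableSpace Ω] [MeasurableSpace E] [AddCommMonoid E]

/-- A tree of independent variables: at each vertex, a Poisson process of points and an
independent sequence of increments. -/
structure IsMarkedCascade (x : Fin (r + 1) → ℝ) (μ : Fin r → Measure E)
    (U : Vertex r → Ω → ℕ → ℝ) (Y : Vertex r → Ω → ℕ → E) (P : Measure Ω) : Prop where
  poisson : ∀ a, IsDecreasingPoisson (fun n ω => U a ω n) (powerIntensity (x a.1.castSucc)) P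
  measurable : ∀ a n, Measurable fun ω => Y a ω n
  law : ∀ a, P.map (Y a) = Measure.infinitePi fun _ => μ a.1
  indep_mark : ∀ a, IndepFun (U a) (Y a) P
  indep : iIndepFun (fun a ω => (U a ω, Y a ω)) P

variable {μ : Fin r → Measure E} {U : Vertex r → Ω → ℕ → ℝ} {Y : Vertex r → Ω → ℕ → E}
  {P : Measure Ω} [IsProbabilityMeasure P] [∀ p, IsProbabilityMeasure (μ p)] [MeasurableAdd₂ E]
  {f : E → ℝ≥0∞}

/-- For fixed $z$, rescaling $t$ by $wV_{p+1}(y+z)$ extracts its power $x_p$ and leaves the constant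
$C_p$. Integrating in $z$ then produces $V_p(y)^{x_p}$ by the recursion. -/
lemma lintegral_vertex (hx : ∀ p, 0 < x p) (hf : Measurable f)
    (hfin : ∀ p y, cascadeRec x μ f p y ≠ ∞) (p : Fin r) {w : ℝ≥0∞} (hw : w ≠ ∞) (y : E) :
    ∫⁻ t, (∫⁻ z, (1 - expNeg (cascadeConst x p.succ *
      (w * ENNReal.ofReal t * cascadeRec x μ f p.succ (y + z)) ^ x p.succ)) ∂(μ p))
        ∂(powerIntensity (x p.castSucc)) =
    cascadeConst x p.castSucc * (w * cascadeRec x μ f p.castSucc y) ^ x p.castSucc := by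
  have hV := measurable_cascadeRec (x := x) (μ := μ) hf p.succ
  have h0 := hx p.castSucc
  rw [lintegral_lintegral_swap]
  · have h1 : ∀ z, ∫⁻ t, (1 - expNeg (cascadeConst x p.succ *
        (w * ENNReal.ofReal t * cascadeRec x μ f p.succ (y + z)) ^ x p.succ))
          ∂(powerIntensity (x p.castSucc)) =
        w ^ x p.castSucc * cascadeConst x p.castSucc *
          cascadeRec x μ f p.succ (y + z) ^ x p.castSucc := by
      intro z
      have h := lintegral_powerMeasure_comp_mul_ennreal (x p.castSucc) h0
        (g := fun b => 1 - expNeg (cascadeConst x p.succ * b ^ x p.succ)) (by fun_prop)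
        (by simp [hx p.succ]) (ENNReal.mul_ne_top hw (hfin p.succ (y + z)))
      rw [powerIntensity_eq]
      convert h using 1
      · refine lintegral_congr fun t => ?_
        congr 4
        ring
      · rw [cascadeConst_castSucc, powerIntensity_eq, ENNReal.mul_rpow_of_nonneg _ _ h0.le]
        ring
    simp_rw [h1]
    rw [lintegral_const_mul _ (measurable_cascadeRec_shift hf _ _ _),
      ENNReal.mul_rpow_of_nonneg _ _ h0.le, ← cascadeRec_castSucc_rpow hx]
    ring
  · refine Measurable.aemeasurable ?_
    have : Measurable fun q : ℝ × E => cascadeRec x μ f p.succ (y + q.2) :=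
      hV.comp (measurable_snd.const_add y)
    unfold Function.uncurry
    fun_prop

lemma IsMarkedCascade.measurable_pair (h : IsMarkedCascade x μ U Y P) (a : Vertex r) :
    Measurable fun ω => (U a ω, Y a ω) :=
  (measurable_pi_lambda _ (h.poisson a).measurable).prodMk (measurable_pi_lambda _ (h.measurable a))

/-- Averaging over the last generation of the tree. -/
lemma IsMarkedCascade.lintegral_level (h : IsMarkedCascade x μ U Y P) (hx : ∀ p, 0 < x p)
    (hf : Measurable f) (hfin : ∀ p y, cascadeRec x μ f p y ≠ ∞) (p : ℕ) (hp : p + 1 ≤ r) :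
    ∫⁻ ω, expNeg (∑' b : Fin (p + 1) → ℕ, cascadeConst x (Fin.succ ⟨p, hp⟩) *
      (pathWeight hp (fun v => U v ω) b * cascadeRec x μ f (Fin.succ ⟨p, hp⟩)
        (pathSum hp (fun v => Y v ω) b)) ^ x (Fin.succ ⟨p, hp⟩)) ∂P =
    ∫⁻ ω, expNeg (∑' a : Fin p → ℕ, cascadeConst x (Fin.castSucc ⟨p, hp⟩) *
      (pathWeight (Nat.le_of_succ_le hp) (fun v => U v ω) a *
        cascadeRec x μ f (Fin.castSucc ⟨p, hp⟩)
          (pathSum (Nat.le_of_succ_le hp) (fun v => Y v ω) a)) ^ x (Fin.castSucc ⟨p, hp⟩)) ∂P := by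
  set P' : Fin r := ⟨p, hp⟩ with hP'
  set C := cascadeConst x P'.succ
  set V := cascadeRec x μ f P'.succ with hVdef
  have hV : Measurable V := measurable_cascadeRec hf _
  have hp' := Nat.le_of_succ_le hp
  -- `X` depends on the vertices of depth below `p` and `L` on those of depth exactly `p`, so the
  -- two are independent. With `X` frozen, the offspring of different vertices of depth `p` are
  -- independent of each other.
  let X : Ω → (Fin p → ℕ) → ℝ≥0∞ × E := fun ω a =>
    (pathWeight hp' (fun v => U v ω) a, pathSum hp' (fun v => Y v ω) a)
  let W : Vertex r → Ω → (ℕ → ℝ) × (ℕ → E) := fun a ω => (U a ω, Y a ω)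
  let L : Ω → (Fin p → ℕ) → (ℕ → ℝ) × (ℕ → E) := fun ω a => W ⟨P', a⟩ ω
  have hWm : ∀ a, Measurable (W a) := h.measurable_pair
  let S : Set (Vertex r) := {v | (v.1 : ℕ) < p}
  let T : Set (Vertex r) := {v | (v.1 : ℕ) = p}
  have hS : ∀ (a : Fin p → ℕ) (q : Fin p), pathVertex hp' a q ∈ S := fun a q => q.2
  have hX : Measurable[⨆ i ∈ S, MeasurableSpace.comap (W i) inferInstance] X := by
    refine @measurable_pi_lambda _ _ _ (⨆ i ∈ S, MeasurableSpace.comap (W i) inferInstance) _ _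
      fun a => Measurable.prodMk ?_ ?_
    · refine Finset.measurable_prod _ fun q _ => ENNReal.measurable_ofReal.comp ?_
      exact ((measurable_pi_apply (a q)).comp measurable_fst).comp
        (measurable_iSup_comap W (hS a q))
    · refine Finset.measurable_sum _ fun q _ => ?_
      exact ((measurable_pi_apply (a q)).comp measurable_snd).comp
        (measurable_iSup_comap W (hS a q))
  have hL : Measurable[⨆ i ∈ T, MeasurableSpace.comap (W i) inferInstance] L :=
    @measurable_pi_lambda _ _ _ (⨆ i ∈ T, MeasurableSpace.comap (W i) inferInstance) _ _
      fun a => measurable_iSup_comap W (by exact rfl)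
  have hST : Disjoint S T := Set.disjoint_left.2 fun v hv hv' => by
    simp only [S, T, Set.mem_ofPred_eq] at hv hv'; omega
  have hind : IndepFun X L P := indepFun_of_measurable_iSup h.indep hWm hST hX hL
  have hle : ∀ S : Set (Vertex r), ⨆ i ∈ S, MeasurableSpace.comap (W i) inferInstance ≤
      (inferInstance : MeasurableSpace Ω) := fun S => iSup₂_le fun i _ => (hWm i).comap_le
  have hXm : Measurable X := hX.mono (hle S) le_rfl
  have hLm : Measurable L := hL.mono (hle T) le_rfl
  let F : ((Fin p → ℕ) → ℝ≥0∞ × E) × ((Fin p → ℕ) → (ℕ → ℝ) × (ℕ → E)) → ℝ≥0∞ := fun q =>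
    expNeg (∑' a, ∑' n, C * ((q.1 a).1 * ENNReal.ofReal ((q.2 a).1 n) *
      V ((q.1 a).2 + (q.2 a).2 n)) ^ x P'.succ)
  have hF : Measurable F := by
    refine measurable_expNeg.comp (Measurable.tsum fun a => Measurable.tsum fun n => ?_)
    have : Measurable fun q : ((Fin p → ℕ) → ℝ≥0∞ × E) × ((Fin p → ℕ) → (ℕ → ℝ) × (ℕ → E)) =>
      V ((q.1 a).2 + (q.2 a).2 n) := hV.comp (by fun_prop)
    fun_prop
  have hinner : ∀ ω, ∫⁻ ω', F (X ω, L ω') ∂P = expNeg (∑' a : Fin p → ℕ,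
      cascadeConst x P'.castSucc * ((X ω a).1 * cascadeRec x μ f P'.castSucc (X ω a).2) ^
        x P'.castSucc) := by
    intro ω
    have hGm : ∀ a, Measurable fun q : (ℕ → ℝ) × (ℕ → E) =>
        ∑' n, C * ((X ω a).1 * ENNReal.ofReal (q.1 n) * V ((X ω a).2 + q.2 n)) ^ x P'.succ := by
      intro a
      refine Measurable.tsum fun n => ?_
      have : Measurable fun q : (ℕ → ℝ) × (ℕ → E) => V ((X ω a).2 + q.2 n) := hV.comp (by fun_prop)
      fun_prop
    refine lintegral_expNeg_tsum (X := fun a ω' => ∑' n, C * ((X ω a).1 *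
      ENNReal.ofReal ((L ω' a).1 n) * V ((X ω a).2 + (L ω' a).2 n)) ^ x P'.succ) ?_ ?_ ?_
    · have hinj : Function.Injective fun a : Fin p → ℕ => (⟨P', a⟩ : Vertex r) :=
        fun a b hab => by simpa using hab
      exact (h.indep.precomp hinj).comp _ hGm
    · exact fun a => (hGm a).comp (hWm ⟨P', a⟩)
    · intro a
      -- The offspring of one vertex form a marked Poisson process, whose Laplace exponent is the
      -- integral in `lintegral_vertex`.
      rw [← lintegral_vertex hx hf hfin P' (pathWeight_ne_top hp' (fun v => U v ω) a)]
      refine (h.poisson ⟨P', a⟩).lintegral_expNeg_tsum_marked (h.measurable ⟨P', a⟩) (h.law ⟨P', a⟩)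
        (h.indep_mark ⟨P', a⟩) (h := fun t z => C * ((X ω a).1 * ENNReal.ofReal t *
          V ((X ω a).2 + z)) ^ x P'.succ) ?_
      have : Measurable fun q : ℝ × E => V ((X ω a).2 + q.2) := hV.comp (by fun_prop)
      unfold Function.uncurry
      fun_prop
  calc _ = ∫⁻ ω, F (X ω, L ω) ∂P := by
        refine lintegral_congr fun ω => ?_
        rw [tsum_snoc]
        simp_rw [pathWeight_snoc, pathSum_snoc]
        rfl
    _ = ∫⁻ ω, ∫⁻ ω', F (X ω, L ω') ∂P ∂P := lintegral_comp_of_indepFun hind hXm hLm hF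
    _ = _ := by simp_rw [hinner]; rfl

/-- The Laplace transform of the total weight of a cascade. -/
theorem IsMarkedCascade.lintegral_expNeg (h : IsMarkedCascade x μ U Y P) (hx : ∀ p, 0 < x p)
    (hlast : x (Fin.last r) = 1) (hf : Measurable f)
    (hfin : ∀ p y, cascadeRec x μ f p y ≠ ∞) :
    ∫⁻ ω, expNeg (∑' α : Fin r → ℕ, pathWeight le_rfl (fun v => U v ω) α *
      f (pathSum le_rfl (fun v => Y v ω) α)) ∂P =
    expNeg (cascadeConst x 0 * cascadeRec x μ f 0 0 ^ x 0) := by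
  -- The expectation does not depend on the depth `p`. Depth $0$ is deterministic, and at depth $r$
  -- the constant and the exponent are both $1$.
  have key : ∀ (p : ℕ) (hp : p ≤ r), ∫⁻ ω, expNeg (∑' a : Fin p → ℕ,
      cascadeConst x ⟨p, Nat.lt_succ_of_le hp⟩ * (pathWeight hp (fun v => U v ω) a *
        cascadeRec x μ f ⟨p, Nat.lt_succ_of_le hp⟩ (pathSum hp (fun v => Y v ω) a)) ^
          x ⟨p, Nat.lt_succ_of_le hp⟩) ∂P =
      expNeg (cascadeConst x 0 * cascadeRec x μ f 0 0 ^ x 0) := by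
    intro p
    induction p with
    | zero =>
      intro hp
      have h2 : ∀ ω a, pathWeight hp (fun v => U v ω) a = 1 := fun ω a => by simp [pathWeight]
      have h3 : ∀ ω a, pathSum hp (fun v => Y v ω) a = 0 := fun ω a => by simp [pathSum]
      simp_rw [tsum_fintype, Fintype.sum_unique, h2, h3]
      simp
    | succ p ih =>
      intro hp
      rw [← ih (Nat.le_of_succ_le hp)]
      exact h.lintegral_level hx hf hfin p hp
  rw [← key r le_rfl]
  have hl : (⟨r, Nat.lt_succ_of_le le_rfl⟩ : Fin (r + 1)) = Fin.last r := rfl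
  simp_rw [hl, hlast]
  simp

end Tree

/-! ### The logarithm of a variable with a stable Laplace transform -/

/-- The variant for moments of negative order: the exponent has no sign restriction and `g 0` is
free, at the price of excluding $b=0$. -/
lemma lintegral_powerMeasure_comp_mul_ennreal' (k η : ℝ) {g : ℝ≥0∞ → ℝ≥0∞}
    (hg : Measurable g) {b : ℝ≥0∞} (hb0 : b ≠ 0) (hb : b ≠ ∞) :
    ∫⁻ t, g (ENNReal.ofReal t * b) ∂(powerMeasure k η) =
      b ^ η * ∫⁻ t, g (ENNReal.ofReal t) ∂(powerMeasure k η) := by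
  have hpos : 0 < b.toReal := ENNReal.toReal_pos hb0 hb
  have h := lintegral_powerMeasure_comp_mul k η (g := fun t => g (ENNReal.ofReal t))
    (by fun_prop) hpos
  rw [← ENNReal.ofReal_rpow_of_pos hpos, ENNReal.ofReal_toReal hb] at h
  rw [← h]
  refine lintegral_congr fun t => ?_
  rw [ENNReal.ofReal_mul hpos.le, ENNReal.ofReal_toReal hb, mul_comm]

/-- A Gamma-type integral: the density is $t^{\theta-1}$ and the exponential controls infinity. -/
lemma lintegral_expNeg_powerMeasure_ne_top {θ ζ : ℝ} (hθ : 0 < θ) (hζ : 0 < ζ) {C : ℝ≥0∞}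
    (hC0 : C ≠ 0) (hC : C ≠ ∞) :
    ∫⁻ t, expNeg (C * ENNReal.ofReal t ^ ζ) ∂(powerMeasure 1 (-θ)) ≠ ∞ := by
  rw [lintegral_powerMeasure _ _ (by fun_prop)]
  have hint := integrableOn_rpow_mul_exp_neg_mul_rpow (s := θ - 1) (by linarith) hζ
    (ENNReal.toReal_pos hC0 hC)
  refine (lt_of_eq_of_lt (setLIntegral_congr_fun measurableSet_Ioi fun t ht => ?_)
    hint.lintegral_lt_top).ne
  have ht' : (0 : ℝ) < t := ht
  rw [ENNReal.ofReal_rpow_of_pos ht', expNeg_eq_ofReal (by finiteness),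
    ← ENNReal.ofReal_mul (by positivity), ENNReal.toReal_mul, ENNReal.toReal_ofReal (by positivity)]
  congr 1
  rw [show -1 - -θ = θ - 1 by ring]
  ring_nf

section Stable

variable {Ω : Type*} [MeasurableSpace Ω] {P : Measure Ω} [IsProbabilityMeasure P]
  {C V : ℝ≥0∞} {ζ : ℝ} {S : Ω → ℝ≥0∞}

/-- The variable `S` has the Laplace transform `exp (-C (c V) ^ ζ)`. -/
structure HasStableLaplace (C : ℝ≥0∞) (ζ : ℝ) (V : ℝ≥0∞) (S : Ω → ℝ≥0∞) (P : Measure Ω) :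
    Prop where
  measurable : Measurable S
  laplace : ∀ c : ℝ≥0∞, c ≠ ∞ → ∫⁻ ω, expNeg (c * S ω) ∂P = expNeg (C * (c * V) ^ ζ)

namespace HasStableLaplace

/-- Only finite values of `S` contribute to the Laplace transform at $1/n$, which tends to $1$. -/
lemma ae_ne_top (h : HasStableLaplace C ζ V S P) (hζ : 0 < ζ) (hC : C ≠ ∞) (hV : V ≠ ∞) :
    ∀ᵐ ω ∂P, S ω ≠ ∞ := by
  have hm : MeasurableSet {ω | S ω ≠ ∞} := h.measurable (measurableSet_singleton _).compl
  have h1 : ∀ n : ℕ, expNeg (C * ((n : ℝ≥0∞)⁻¹ * V) ^ ζ) ≤ P {ω | S ω ≠ ∞} ∨ n = 0 := by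
    intro n
    rcases Nat.eq_zero_or_pos n with hn | hn
    · exact .inr hn
    left
    rw [← h.laplace _ (by simpa using hn.ne'), ← lintegral_indicator_one hm]
    refine lintegral_mono fun ω => ?_
    by_cases hω : S ω = ∞
    · simp [hω]
    · rw [Set.indicator_of_mem (by exact hω)]; exact expNeg_le_one _
  have h2 : Tendsto (fun n : ℕ => expNeg (C * ((n : ℝ≥0∞)⁻¹ * V) ^ ζ)) atTop (𝓝 1) := by
    have h3 : Tendsto (fun n : ℕ => (n : ℝ≥0∞)⁻¹ * V) atTop (𝓝 0) := by
      simpa using ENNReal.Tendsto.mul_const ENNReal.tendsto_inv_nat_nhds_zero (.inr hV)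
    have h4 : Tendsto (fun n : ℕ => ((n : ℝ≥0∞)⁻¹ * V) ^ ζ) atTop (𝓝 0) := by
      simpa [hζ, Function.comp_def] using (ENNReal.continuous_rpow_const (y := ζ)).tendsto 0 |>.comp h3
    have h5 : Tendsto (fun n : ℕ => C * ((n : ℝ≥0∞)⁻¹ * V) ^ ζ) atTop (𝓝 0) := by
      simpa using ENNReal.Tendsto.const_mul h4 (.inr hC)
    simpa [Function.comp_def] using (continuous_expNeg.tendsto 0).comp h5
  have h3 : 1 ≤ P {ω | S ω ≠ ∞} := by
    refine le_of_tendsto h2 ?_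
    filter_upwards [eventually_ge_atTop 1] with n hn
    exact (h1 n).resolve_right (by omega)
  exact (prob_compl_eq_zero_iff hm).2 (le_antisymm prob_le_one h3)

/-- The event $S=0$ contributes its full probability to the Laplace transform at $n$, which tends to
$0$. -/
lemma ae_ne_zero (h : HasStableLaplace C ζ V S P) (hζ : 0 < ζ) (hC : C ≠ 0) (hV : V ≠ 0) :
    ∀ᵐ ω ∂P, S ω ≠ 0 := by
  have hm : MeasurableSet {ω | S ω = 0} := h.measurable (measurableSet_singleton _)
  have h1 : ∀ n : ℕ, P {ω | S ω = 0} ≤ expNeg (C * ((n : ℝ≥0∞) * V) ^ ζ) := by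
    intro n
    rw [← h.laplace _ (by simp), ← lintegral_indicator_one hm]
    refine lintegral_mono fun ω => ?_
    by_cases hω : S ω = 0
    · simp [hω]
    · rw [Set.indicator_of_notMem (by exact hω)]; exact zero_le
  have h2 : Tendsto (fun n : ℕ => expNeg (C * ((n : ℝ≥0∞) * V) ^ ζ)) atTop (𝓝 0) := by
    have h3 : Tendsto (fun n : ℕ => (n : ℝ≥0∞) * V) atTop (𝓝 ∞) := by
      simpa [ENNReal.top_mul hV] using
        ENNReal.Tendsto.mul_const (b := V) ENNReal.tendsto_nat_nhds_top (.inl ENNReal.top_ne_zero)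
    have h4 : Tendsto (fun n : ℕ => ((n : ℝ≥0∞) * V) ^ ζ) atTop (𝓝 ∞) := by
      simpa [hζ, Function.comp_def] using (ENNReal.continuous_rpow_const (y := ζ)).tendsto ∞ |>.comp h3
    have h5 : Tendsto (fun n : ℕ => C * ((n : ℝ≥0∞) * V) ^ ζ) atTop (𝓝 ∞) := by
      simpa [ENNReal.mul_top hC] using
        ENNReal.Tendsto.const_mul (a := C) h4 (.inl ENNReal.top_ne_zero)
    simpa [Function.comp_def] using (continuous_expNeg.tendsto ∞).comp h5
  have h3 : P {ω | S ω = 0} = 0 := le_antisymm (ge_of_tendsto' h2 h1) zero_le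
  exact measure_eq_zero_iff_ae_notMem.1 h3

/-- By scaling, $S^\theta\int(1-e^{-t})t^{-1-\theta}dt=\int(1-e^{-tS})t^{-1-\theta}dt$. Taking
expectations under the integral inserts the Laplace transform, and scaling by `V` extracts
$V^\theta$. -/
lemma lintegral_rpow_of_pos (h : HasStableLaplace C ζ V S P) (hζ : 0 < ζ) (hC : C ≠ ∞)
    (hV : V ≠ ∞) {θ : ℝ} (hθ : 0 < θ) :
    (∫⁻ ω, S ω ^ θ ∂P) * ∫⁻ t, (1 - expNeg (ENNReal.ofReal t)) ∂(powerMeasure 1 θ) =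
      V ^ θ * ∫⁻ t, (1 - expNeg (C * ENNReal.ofReal t ^ ζ)) ∂(powerMeasure 1 θ) := by
  have hSm := h.measurable
  rw [← lintegral_powerMeasure_comp_mul_ennreal 1 hθ
      (g := fun b => 1 - expNeg (C * b ^ ζ)) (by fun_prop) (by simp [hζ]) hV,
    ← lintegral_mul_const _ (by fun_prop)]
  calc _ = ∫⁻ ω, ∫⁻ t, (1 - expNeg (ENNReal.ofReal t * S ω)) ∂(powerMeasure 1 θ) ∂P := by
        refine lintegral_congr_ae ?_
        filter_upwards [h.ae_ne_top hζ hC hV] with ω hω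
        exact (lintegral_powerMeasure_comp_mul_ennreal 1 hθ (g := fun b => 1 - expNeg b)
          (by fun_prop) (by simp) hω).symm
    _ = ∫⁻ t, ∫⁻ ω, (1 - expNeg (ENNReal.ofReal t * S ω)) ∂P ∂(powerMeasure 1 θ) := by
        refine lintegral_lintegral_swap (Measurable.aemeasurable ?_)
        unfold Function.uncurry
        fun_prop
    _ = _ := by
        refine lintegral_congr fun t => ?_
        rw [lintegral_sub (by fun_prop), h.laplace _ ENNReal.ofReal_ne_top]
        · simp
        · rw [h.laplace _ ENNReal.ofReal_ne_top]; exact expNeg_ne_top _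
        · exact .of_forall fun ω => expNeg_le_one _

/-- The same argument with $e^{-t}$ in place of $1-e^{-t}$, which suits negative orders. -/
lemma lintegral_rpow_neg (h : HasStableLaplace C ζ V S P) (hζ : 0 < ζ) (hC0 : C ≠ 0) (hC : C ≠ ∞)
    (hV0 : V ≠ 0) (hV : V ≠ ∞) (θ : ℝ) :
    (∫⁻ ω, S ω ^ (-θ) ∂P) * ∫⁻ t, expNeg (ENNReal.ofReal t) ∂(powerMeasure 1 (-θ)) =
      V ^ (-θ) * ∫⁻ t, expNeg (C * ENNReal.ofReal t ^ ζ) ∂(powerMeasure 1 (-θ)) := by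
  have hSm := h.measurable
  rw [← lintegral_powerMeasure_comp_mul_ennreal' 1 (-θ)
      (g := fun b => expNeg (C * b ^ ζ)) (by fun_prop) hV0 hV,
    ← lintegral_mul_const _ (by fun_prop)]
  calc _ = ∫⁻ ω, ∫⁻ t, expNeg (ENNReal.ofReal t * S ω) ∂(powerMeasure 1 (-θ)) ∂P := by
        refine lintegral_congr_ae ?_
        filter_upwards [h.ae_ne_top hζ hC hV, h.ae_ne_zero hζ hC0 hV0] with ω hω hω0
        exact (lintegral_powerMeasure_comp_mul_ennreal' 1 (-θ) (g := fun b => expNeg b)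
          (by fun_prop) hω0 hω).symm
    _ = ∫⁻ t, ∫⁻ ω, expNeg (ENNReal.ofReal t * S ω) ∂P ∂(powerMeasure 1 (-θ)) := by
        refine lintegral_lintegral_swap (Measurable.aemeasurable ?_)
        unfold Function.uncurry
        fun_prop
    _ = _ := by
        refine lintegral_congr fun t => ?_
        rw [h.laplace _ ENNReal.ofReal_ne_top]

/-- The moments of small order depend on the scale only through its power. -/
lemma exists_moments (P : Measure Ω) [IsProbabilityMeasure P] (hζ : 0 < ζ) (hζ1 : ζ < 1)
    (hC0 : C ≠ 0) (hC : C ≠ ∞) :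
    ∃ M : ℝ → ℝ≥0∞, (∀ θ, |θ| < ζ → M θ ≠ ∞) ∧ ∀ (V : ℝ≥0∞) (S : Ω → ℝ≥0∞), V ≠ 0 → V ≠ ∞ →
      HasStableLaplace C ζ V S P → ∀ θ, |θ| < ζ → ∫⁻ ω, S ω ^ θ ∂P = V ^ θ * M θ := by
  -- `K` and `L` are the integrals multiplying the two sides of the moment identities, for positive
  -- and negative orders; both are set to $1$ at order $0$. The universal moment is `L θ / K θ`.
  set K : ℝ → ℝ≥0∞ := fun θ => if 0 < θ then
    ∫⁻ t, (1 - expNeg (ENNReal.ofReal t)) ∂(powerMeasure 1 θ) else if θ < 0 then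
    ∫⁻ t, expNeg (ENNReal.ofReal t) ∂(powerMeasure 1 θ) else 1 with hK
  set L : ℝ → ℝ≥0∞ := fun θ => if 0 < θ then
    ∫⁻ t, (1 - expNeg (C * ENNReal.ofReal t ^ ζ)) ∂(powerMeasure 1 θ) else if θ < 0 then
    ∫⁻ t, expNeg (C * ENNReal.ofReal t ^ ζ) ∂(powerMeasure 1 θ) else 1 with hL
  have hK0 : ∀ θ, K θ ≠ 0 := by
    intro θ
    simp only [hK]
    split_ifs with h1 h2
    · exact powerMeasure_Ioi_pos one_pos _ (by fun_prop) fun t ht =>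
        one_sub_expNeg_ne_zero (by simpa using ht)
    · refine powerMeasure_Ioi_pos one_pos _ (by fun_prop) fun t ht => ?_
      rw [expNeg_ofReal ht.le]
      simpa using Real.exp_pos _
    · exact one_ne_zero
  have hKtop : ∀ θ, |θ| < ζ → K θ ≠ ∞ := by
    intro θ hθ
    rw [abs_lt] at hθ
    simp only [hK]
    split_ifs with h1 h2
    · simpa using lintegral_one_sub_expNeg_ne_top (k := 1) (η := 1) zero_le_one h1 (by linarith)
        ENNReal.one_ne_top
    · simpa using lintegral_expNeg_powerMeasure_ne_top (θ := -θ) (by linarith) one_pos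
        one_ne_zero ENNReal.one_ne_top
    · exact ENNReal.one_ne_top
  have hLtop : ∀ θ, |θ| < ζ → L θ ≠ ∞ := by
    intro θ hθ
    rw [abs_lt] at hθ
    simp only [hL]
    split_ifs with h1 h2
    · exact lintegral_one_sub_expNeg_ne_top zero_le_one h1 hθ.2 hC
    · simpa using lintegral_expNeg_powerMeasure_ne_top (θ := -θ) (by linarith) hζ hC0 hC
    · exact ENNReal.one_ne_top
  refine ⟨fun θ => L θ / K θ, fun θ hθ => ENNReal.div_ne_top (hLtop θ hθ) (hK0 θ), ?_⟩
  intro V S hV0 hV h θ hθ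
  rw [← mul_div_assoc, ENNReal.eq_div_iff (hK0 θ) (hKtop θ hθ), mul_comm]
  rcases lt_trichotomy θ 0 with h0 | h0 | h0
  · simpa [hK, hL, h0, h0.not_gt] using h.lintegral_rpow_neg hζ hC0 hC hV0 hV (-θ)
  · simp [hK, hL, h0]
  · simpa [hK, hL, h0] using h.lintegral_rpow_of_pos hζ hC hV h0

lemma log_mem_integrableExpSet (h : HasStableLaplace C ζ V S P) (hζ : 0 < ζ) (hζ1 : ζ < 1)
    (hC0 : C ≠ 0) (hC : C ≠ ∞) (hV0 : V ≠ 0) (hV : V ≠ ∞) :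
    0 ∈ interior (integrableExpSet (fun ω => Real.log (S ω).toReal) P) := by
  obtain ⟨M, hM, hMS⟩ := exists_moments P hζ hζ1 hC0 hC
  rw [mem_interior]
  refine ⟨Set.Ioo (-ζ) ζ, fun θ hθ => ?_, isOpen_Ioo, by simpa using hζ⟩
  have hθ' : |θ| < ζ := abs_lt.2 hθ
  have hfin : ∫⁻ ω, S ω ^ θ ∂P ≠ ∞ := by
    rw [hMS V S hV0 hV h θ hθ']
    have := hM θ hθ'
    have : V ^ θ ≠ ∞ := ENNReal.rpow_ne_top_of_ne_zero hV0 hV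
    finiteness
  have hint := integrable_toReal_of_lintegral_ne_top
    (h.measurable.pow_const θ).aemeasurable hfin
  refine hint.congr ?_
  filter_upwards [h.ae_ne_top hζ hC hV, h.ae_ne_zero hζ hC0 hV0] with ω h1 h2
  rw [← ENNReal.toReal_rpow, Real.rpow_def_of_pos (ENNReal.toReal_pos h2 h1), mul_comm]

lemma integrable_log (h : HasStableLaplace C ζ V S P) (hζ : 0 < ζ) (hζ1 : ζ < 1)
    (hC0 : C ≠ 0) (hC : C ≠ ∞) (hV0 : V ≠ 0) (hV : V ≠ ∞) :
    Integrable (fun ω => Real.log (S ω).toReal) P :=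
  integrable_of_mem_interior_integrableExpSet (h.log_mem_integrableExpSet hζ hζ1 hC0 hC hV0 hV)

lemma mgf_log (h : HasStableLaplace C ζ V S P) (hζ : 0 < ζ)
    (hC0 : C ≠ 0) (hC : C ≠ ∞) (hV0 : V ≠ 0) (hV : V ≠ ∞) (θ : ℝ) :
    mgf (fun ω => Real.log (S ω).toReal) P θ = (∫⁻ ω, S ω ^ θ ∂P).toReal := by
  rw [mgf, ← integral_toReal (h.measurable.pow_const θ).aemeasurable]
  · refine integral_congr_ae ?_
    filter_upwards [h.ae_ne_top hζ hC hV, h.ae_ne_zero hζ hC0 hV0] with ω h1 h2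
    rw [← ENNReal.toReal_rpow, Real.rpow_def_of_pos (ENNReal.toReal_pos h2 h1), mul_comm]
  · filter_upwards [h.ae_ne_top hζ hC hV, h.ae_ne_zero hζ hC0 hV0] with ω h1 h2
    exact (ENNReal.rpow_ne_top_of_ne_zero h2 h1).lt_top

/-- Near $0$ the moment generating functions of $\log S$ and $\log T$ differ by the factor
$V^\theta$. Their derivatives at $0$ are the means, so the means differ by $\log V$. -/
theorem integral_log_sub {T : Ω → ℝ≥0∞} (hS : HasStableLaplace C ζ V S P)
    (hT : HasStableLaplace C ζ 1 T P) (hζ : 0 < ζ) (hζ1 : ζ < 1)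
    (hC0 : C ≠ 0) (hC : C ≠ ∞) (hV0 : V ≠ 0) (hV : V ≠ ∞) :
    ∫ ω, Real.log (S ω).toReal ∂P - ∫ ω, Real.log (T ω).toReal ∂P = Real.log V.toReal := by
  obtain ⟨M, hM, hMS⟩ := exists_moments P hζ hζ1 hC0 hC
  set X := fun ω => Real.log (S ω).toReal
  set Y := fun ω => Real.log (T ω).toReal
  have hX0 : 0 ∈ interior (integrableExpSet X P) :=
    hS.log_mem_integrableExpSet hζ hζ1 hC0 hC hV0 hV
  have hY0 : 0 ∈ interior (integrableExpSet Y P) :=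
    hT.log_mem_integrableExpSet hζ hζ1 hC0 hC one_ne_zero ENNReal.one_ne_top
  have hVpos : 0 < V.toReal := ENNReal.toReal_pos hV0 hV
  have hmgf : mgf X P =ᶠ[𝓝 0] fun θ => Real.exp (Real.log V.toReal * θ) * mgf Y P θ := by
    have : Set.Ioo (-ζ) ζ ∈ 𝓝 (0 : ℝ) := Ioo_mem_nhds (by linarith) hζ
    filter_upwards [this] with θ hθ
    have hθ' : |θ| < ζ := abs_lt.2 hθ
    rw [hS.mgf_log hζ hC0 hC hV0 hV, hT.mgf_log hζ hC0 hC one_ne_zero ENNReal.one_ne_top,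
      hMS V S hV0 hV hS θ hθ', hMS 1 T one_ne_zero ENNReal.one_ne_top hT θ hθ', ENNReal.toReal_mul,
      ← ENNReal.toReal_rpow, Real.rpow_def_of_pos hVpos]
    simp
  have hdY : HasDerivAt (mgf Y P) (∫ ω, Y ω ∂P) 0 := by
    rw [← deriv_mgf_zero hY0]
    exact (differentiableAt_mgf hY0).hasDerivAt
  have hexp : HasDerivAt (fun θ => Real.exp (Real.log V.toReal * θ)) (Real.log V.toReal) 0 := by
    simpa using ((hasDerivAt_id (0 : ℝ)).const_mul (Real.log V.toReal)).exp
  have h1 := (hexp.mul hdY).congr_of_eventuallyEq hmgf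
  have h2 : deriv (mgf X P) 0 = _ := h1.deriv
  rw [deriv_mgf_zero hX0] at h2
  change ∫ ω, X ω ∂P - ∫ ω, Y ω ∂P = _
  rw [h2]
  simp

end HasStableLaplace

end Stable

/-! ### Laws of Gaussian processes -/

section GaussianLaws

lemma measure_eq_of_isGaussian {ι : Type*} [Fintype ι] {μ ν : Measure (ι → ℝ)} [IsGaussian μ]
    [IsGaussian ν] (hm : ∀ i, ∫ y, y i ∂μ = ∫ y, y i ∂ν)
    (hc : ∀ i j, cov[fun y => y i, fun y => y j; μ] = cov[fun y => y i, fun y => y j; ν]) :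
    μ = ν := by
  classical
  have hLp : ∀ (ρ : Measure (ι → ℝ)) [IsGaussian ρ] (i : ι), MemLp (fun y : ι → ℝ => y i) 2 ρ :=
    fun ρ _ i => (IsGaussian.memLp_dual ρ (ContinuousLinearMap.proj i) 2 (by simp))
  refine Measure.ext_of_charFunDual ?_
  ext L
  obtain ⟨c, hL⟩ : ∃ c : ι → ℝ, ∀ y, L y = ∑ i, c i * y i := by
    refine ⟨fun i => L (Pi.single i 1), fun y => ?_⟩
    have hy : y = ∑ i, y i • (Pi.single i (1 : ℝ) : ι → ℝ) := by
      ext j; simp [Finset.sum_apply, Pi.single_apply]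
    conv_lhs => rw [hy]
    rw [map_sum]
    simp [mul_comm]
  have hL' : (L : (ι → ℝ) → ℝ) = fun y => ∑ i, c i * y i := funext hL
  have hmean : ∀ (ρ : Measure (ι → ℝ)) [IsGaussian ρ],
      ∫ y, L y ∂ρ = ∑ i, c i * ∫ y, y i ∂ρ := by
    intro ρ _
    rw [hL', integral_finsetSum]
    · simp_rw [integral_const_mul]
    · exact fun i _ => ((hLp ρ i).integrable (by norm_num)).const_mul _
  have hvar : ∀ (ρ : Measure (ι → ℝ)) [IsGaussian ρ], Var[L; ρ] = ∑ i, ∑ j,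
      c i * (c j * cov[fun y => y i, fun y => y j; ρ]) := by
    intro ρ _
    rw [← covariance_self L.continuous.aemeasurable, hL', covariance_fun_sum_fun_sum
      (fun i => (hLp ρ i).const_mul _) (fun i => (hLp ρ i).const_mul _)]
    simp_rw [covariance_const_mul_left, covariance_const_mul_right]
  rw [IsGaussian.charFunDual_eq, IsGaussian.charFunDual_eq, integral_complex_ofReal,
    integral_complex_ofReal, hmean, hmean, hvar, hvar]
  simp_rw [hm, hc]

/-- The law of a centred Gaussian process is determined by its covariance. -/
lemma map_eq_of_isGaussianProcess {T Ω Ω' : Type*} [MeasurableSpace Ω] [MeasurableSpace Ω']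
    {P : Measure Ω} {P' : Measure Ω'} {X : T → Ω → ℝ} {X' : T → Ω' → ℝ}
    (hX : IsGaussianProcess X P) (hX' : IsGaussianProcess X' P') (hXm : ∀ t, Measurable (X t))
    (hXm' : ∀ t, Measurable (X' t)) (h0 : ∀ t, ∫ ω, X t ω ∂P = 0)
    (h0' : ∀ t, ∫ ω, X' t ω ∂P' = 0) (hc : ∀ s t, cov[X s, X t; P] = cov[X' s, X' t; P']) :
    P.map (fun ω t => X t ω) = P'.map (fun ω t => X' t ω) := by
  have := hX.isProbabilityMeasure
  have := hX'.isProbabilityMeasure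
  have hm : Measurable fun ω t => X t ω := measurable_pi_lambda _ hXm
  have hm' : Measurable fun ω t => X' t ω := measurable_pi_lambda _ hXm'
  have : ∀ I : Finset T, IsProbabilityMeasure ((P'.map fun ω t => X' t ω).map I.restrict) := by
    intro I
    have : IsProbabilityMeasure (P'.map fun ω t => X' t ω) :=
      Measure.isProbabilityMeasure_map hm'.aemeasurable
    exact Measure.isProbabilityMeasure_map (by fun_prop)
  refine IsProjectiveLimit.unique (P := fun I => (P'.map fun ω t => X' t ω).map I.restrict)
    (fun I => ?_) (fun I => rfl)
  beta_reduce
  rw [Measure.map_map (by fun_prop) hm, Measure.map_map (by fun_prop) hm']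
  have hI : Measurable (I.restrict ∘ fun ω t => X t ω) := (by fun_prop : Measurable I.restrict).comp hm
  have hI' : Measurable (I.restrict ∘ fun ω t => X' t ω) :=
    (by fun_prop : Measurable I.restrict).comp hm'
  have : IsGaussian (P.map (I.restrict ∘ fun ω t => X t ω)) := (hX.hasGaussianLaw I).isGaussian_map
  have : IsGaussian (P'.map (I.restrict ∘ fun ω t => X' t ω)) :=
    (hX'.hasGaussianLaw I).isGaussian_map
  have hev : ∀ (ρ : Measure (I → ℝ)) (i : I), AEStronglyMeasurable (fun y : I → ℝ => y i) ρ :=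
    fun ρ i => (measurable_pi_apply i).aestronglyMeasurable
  refine measure_eq_of_isGaussian (fun i => ?_) fun i j => ?_
  · rw [integral_map hI.aemeasurable (hev _ i), integral_map hI'.aemeasurable (hev _ i)]
    exact (h0 i).trans (h0' i).symm
  · rw [covariance_map (hev _ i) (hev _ j) hI.aemeasurable,
      covariance_map (hev _ i) (hev _ j) hI'.aemeasurable]
    exact hc i j

lemma isGaussianProcess_of_iIndepFun {T Ω E : Type*} [MeasurableSpace Ω] [NormedAddCommGroup E]
    [NormedSpace ℝ E] [MeasurableSpace E] [BorelSpace E] [SecondCountableTopology E]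
    [CompleteSpace E] {P : Measure Ω} {X : T → Ω → E} (hX : ∀ t, HasGaussianLaw (X t) P)
    (hind : iIndepFun X P) : IsGaussianProcess X P where
  hasGaussianLaw I := (hind.precomp (g := ((↑) : I → T)) Subtype.val_injective).hasGaussianLaw
    fun t => hX t

lemma iIndepFun_comp_measurePreserving {ι Ω Ω' : Type*} [MeasurableSpace Ω] [MeasurableSpace Ω']
    {β : ι → Type*} [∀ i, MeasurableSpace (β i)] {P : Measure Ω} {P' : Measure Ω'}
    [IsProbabilityMeasure P] [IsProbabilityMeasure P'] {φ : Ω' → Ω}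
    (hφ : MeasurePreserving φ P' P) {X : ∀ i, Ω → β i} (hXm : ∀ i, Measurable (X i))
    (hX : iIndepFun X P) : iIndepFun (fun i ω => X i (φ ω)) P' := by
  rw [iIndepFun_iff_map_fun_eq_infinitePi_map (X := fun i ω => X i (φ ω))
    fun i => (hXm i).comp hφ.measurable]
  rw [iIndepFun_iff_map_fun_eq_infinitePi_map hXm] at hX
  have hm : Measurable fun ω i => X i ω := measurable_pi_lambda _ hXm
  have h1 : P'.map (fun ω i => X i (φ ω)) = P.map fun ω i => X i ω := by
    rw [← hφ.map_eq, Measure.map_map hm hφ.measurable]; rfl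
  have h2 : ∀ i, P'.map (fun ω => X i (φ ω)) = P.map (X i) := fun i => by
    rw [← hφ.map_eq, Measure.map_map (hXm i) hφ.measurable]; rfl
  rw [h1, hX]
  congr 1
  funext i
  exact (h2 i).symm

lemma IsDecreasingPoisson.comp_measurePreserving {Ω Ω' : Type*} [MeasurableSpace Ω]
    [MeasurableSpace Ω'] {P : Measure Ω} {P' : Measure Ω'} [IsProbabilityMeasure P]
    [IsProbabilityMeasure P'] {φ : Ω' → Ω} (hφ : MeasurePreserving φ P' P) {u : ℕ → Ω → ℝ}
    {ν : Measure ℝ} (hu : IsDecreasingPoisson u ν P) :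
    IsDecreasingPoisson (fun n ω => u n (φ ω)) ν P' where
  measurable n := (hu.measurable n).comp hφ.measurable
  pos := hφ.quasiMeasurePreserving.ae hu.pos
  strictAnti := hφ.quasiMeasurePreserving.ae hu.strictAnti
  poisson B hB hν k := by
    rw [← hu.poisson B hB hν k]
    exact hφ.measure_preimage
      (measurable_pointCount hu.measurable hB (measurableSet_singleton (k : ℕ∞))).nullMeasurableSet
  indep l B hB hd := iIndepFun_comp_measurePreserving hφ
    (fun j => measurable_pointCount hu.measurable (hB j)) (hu.indep l B hB hd)

/-- Independent pairs of coordinates of independent families. -/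
lemma iIndepFun_prodMk_prod {ι Ω Ω' : Type*} [MeasurableSpace Ω] [MeasurableSpace Ω']
    {β γ : ι → Type*} [∀ i, MeasurableSpace (β i)] [∀ i, MeasurableSpace (γ i)] {P : Measure Ω}
    {Q : Measure Ω'} [IsProbabilityMeasure P] [IsProbabilityMeasure Q] {X : ∀ i, Ω → β i}
    {Y : ∀ i, Ω' → γ i} (hXm : ∀ i, Measurable (X i)) (hYm : ∀ i, Measurable (Y i))
    (hX : iIndepFun X P) (hY : iIndepFun Y Q) :
    iIndepFun (fun i (ω : Ω × Ω') => (X i ω.1, Y i ω.2)) (P.prod Q) := by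
  -- The rectangles form a generating π-system on which the product measure factors.
  let π : ι → Set (Set (Ω × Ω')) := fun i => {A | ∃ B C, MeasurableSet B ∧ MeasurableSet C ∧
    A = (X i ⁻¹' B) ×ˢ (Y i ⁻¹' C)}
  rw [iIndepFun_iff_iIndep]
  refine iIndepSets.iIndep (m := fun i => MeasurableSpace.comap
    (fun ω : Ω × Ω' => (X i ω.1, Y i ω.2)) inferInstance) (fun i => ?_) π (fun i => ?_) (fun i => ?_) ?_
  · exact (((hXm i).comp measurable_fst).prodMk ((hYm i).comp measurable_snd)).comap_le
  · rintro _ ⟨B, C, hB, hC, rfl⟩ _ ⟨B', C', hB', hC', rfl⟩ -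
    refine ⟨B ∩ B', C ∩ C', hB.inter hB', hC.inter hC', ?_⟩
    rw [Set.prod_inter_prod, Set.preimage_inter, Set.preimage_inter]
  · rw [← generateFrom_prod, MeasurableSpace.comap_generateFrom]
    congr 1
    ext A
    constructor
    · rintro ⟨_, ⟨B, hB, C, hC, rfl⟩, rfl⟩
      exact ⟨B, C, hB, hC, rfl⟩
    · rintro ⟨B, C, hB, hC, rfl⟩
      exact ⟨_, ⟨B, hB, C, hC, rfl⟩, rfl⟩
  · rw [iIndepSets_iff]
    intro s A hA
    choose! B C hB hC hAeq using hA
    have h1 : ⋂ i ∈ s, A i = (⋂ i ∈ s, X i ⁻¹' B i) ×ˢ (⋂ i ∈ s, Y i ⁻¹' C i) := by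
      ext ω
      simp only [Set.mem_iInter, Set.mem_prod]
      constructor
      · intro h
        exact ⟨fun i hi => by have := h i hi; rw [hAeq i hi] at this; exact this.1,
          fun i hi => by have := h i hi; rw [hAeq i hi] at this; exact this.2⟩
      · intro h i hi
        rw [hAeq i hi]
        exact ⟨h.1 i hi, h.2 i hi⟩
    rw [h1, Measure.prod_prod, hX.measure_inter_preimage_eq_mul s hB,
      hY.measure_inter_preimage_eq_mul s hC, ← Finset.prod_mul_distrib]
    refine Finset.prod_congr rfl fun i hi => ?_
    rw [hAeq i hi, Measure.prod_prod]

end GaussianLaws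

/-! ### The Gaussian field of the cascade as a sum of increments along the paths -/

section Field

variable {r m : ℕ}

/-- The law of the increment `z_{p+1}`. -/
def stepMeasure (γ : Fin (r + 1) → Matrix (Fin (m + 1)) (Fin (m + 1)) ℝ) (p : Fin r) :
    Measure (EuclideanSpace ℝ (Fin (m + 1))) :=
  multivariateGaussian 0 ((2 : ℝ) • (γ p.succ - γ p.castSucc))

/-- The law of `N` independent copies of the increment `z_{p+1}`. -/
def blockMeasure (N : ℕ) (γ : Fin (r + 1) → Matrix (Fin (m + 1)) (Fin (m + 1)) ℝ) (p : Fin r) :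
    Measure (Fin N → EuclideanSpace ℝ (Fin (m + 1))) :=
  Measure.pi fun _ => stepMeasure γ p

/-- The law of independent increments attached to the edges of the tree. -/
def treeMeasure (N : ℕ) (γ : Fin (r + 1) → Matrix (Fin (m + 1)) (Fin (m + 1)) ℝ) :
    Measure (Vertex r → ℕ → Fin N → EuclideanSpace ℝ (Fin (m + 1))) :=
  Measure.infinitePi fun a => Measure.infinitePi fun _ => blockMeasure N γ a.1

variable {N : ℕ} {γ : Fin (r + 1) → Matrix (Fin (m + 1)) (Fin (m + 1)) ℝ}

instance (p : Fin r) : IsGaussian (stepMeasure γ p) := by unfold stepMeasure; infer_instance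

instance (p : Fin r) : IsProbabilityMeasure (blockMeasure N γ p) := by
  unfold blockMeasure; infer_instance

instance : IsProbabilityMeasure (treeMeasure N γ) := by unfold treeMeasure; infer_instance

lemma measurePreserving_tree_coord (a : Vertex r) (n : ℕ) :
    MeasurePreserving (fun y : Vertex r → ℕ → Fin N → EuclideanSpace ℝ (Fin (m + 1)) => y a n)
      (treeMeasure N γ) (blockMeasure N γ a.1) :=
  (measurePreserving_eval_infinitePi (fun _ => blockMeasure N γ a.1) n).comp
    (measurePreserving_eval_infinitePi
      (fun a : Vertex r => Measure.infinitePi fun _ : ℕ => blockMeasure N γ a.1) a)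

lemma measurePreserving_tree_coord_coord (a : Vertex r) (n : ℕ) (i : Fin N) :
    MeasurePreserving (fun y : Vertex r → ℕ → Fin N → EuclideanSpace ℝ (Fin (m + 1)) => y a n i)
      (treeMeasure N γ) (stepMeasure γ a.1) :=
  (measurePreserving_eval (fun _ : Fin N => stepMeasure γ a.1) i).comp
    (measurePreserving_tree_coord a n)

lemma iIndepFun_tree_coord_coord :
    iIndepFun (fun (t : (Vertex r × ℕ) × Fin N)
      (y : Vertex r → ℕ → Fin N → EuclideanSpace ℝ (Fin (m + 1))) => y t.1.1 t.1.2 t.2)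
      (treeMeasure N γ) := by
  refine iIndepFun_uncurry' (X := fun (s : Vertex r × ℕ) (i : Fin N)
    (y : Vertex r → ℕ → Fin N → EuclideanSpace ℝ (Fin (m + 1))) => y s.1 s.2 i)
    (fun s i => by fun_prop) ?_ fun s => ?_
  · exact iIndepFun_uncurry_infinitePi' (X := fun _ _ y => y)
      (fun (a : Vertex r) (_ : ℕ) => blockMeasure N γ a.1) fun _ _ => measurable_id
  · exact iIndepFun_comp_measurePreserving (measurePreserving_tree_coord s.1 s.2)
      (X := fun i y => y i) (fun i => measurable_pi_apply i)
      (iIndepFun_pi (X := fun _ y => y) fun _ => measurable_id.aemeasurable)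

/-- The field at the leaf `α`, site `i` and state `k`, from the increments on the edges. -/
def treeField (y : Vertex r → ℕ → Fin N → EuclideanSpace ℝ (Fin (m + 1)))
    (t : Fin N × (Fin r → ℕ) × Fin (m + 1)) : ℝ :=
  ∑ p : Fin r, y (ancestor t.2.1 p) (t.2.1 p) t.1 t.2.2

lemma isGaussianProcess_tree_coord_coord :
    IsGaussianProcess (fun (t : (Vertex r × ℕ) × Fin N)
      (y : Vertex r → ℕ → Fin N → EuclideanSpace ℝ (Fin (m + 1))) => y t.1.1 t.1.2 t.2)
      (treeMeasure N γ) := by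
  refine isGaussianProcess_of_iIndepFun (fun t => ⟨?_⟩) iIndepFun_tree_coord_coord
  rw [(measurePreserving_tree_coord_coord t.1.1 t.1.2 t.2).map_eq]
  infer_instance

lemma isGaussianProcess_treeField :
    IsGaussianProcess (fun (t : Fin N × (Fin r → ℕ) × Fin (m + 1)) y => treeField y t)
      (treeMeasure N γ) := by
  classical
  refine isGaussianProcess_tree_coord_coord.of_isGaussianProcess fun t => ?_
  let e : Fin r → (Vertex r × ℕ) × Fin N := fun p => ((ancestor t.2.1 p, t.2.1 p), t.1)
  refine ⟨Finset.univ.image e, ∑ p : Fin r, (EuclideanSpace.proj t.2.2).comp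
    (ContinuousLinearMap.proj (⟨e p, by simp⟩ : Finset.univ.image e)), fun y => ?_⟩
  simp [treeField, e]

lemma measurable_treeField (t : Fin N × (Fin r → ℕ) × Fin (m + 1)) :
    Measurable fun y : Vertex r → ℕ → Fin N → EuclideanSpace ℝ (Fin (m + 1)) => treeField y t := by
  unfold treeField
  fun_prop

lemma memLp_tree_coord (a : Vertex r) (n : ℕ) (i : Fin N) (k : Fin (m + 1)) :
    MemLp (fun y : Vertex r → ℕ → Fin N → EuclideanSpace ℝ (Fin (m + 1)) => y a n i k) 2
      (treeMeasure N γ) :=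
  (IsGaussian.memLp_dual (stepMeasure γ a.1) (EuclideanSpace.proj k) 2
    (by simp)).comp_measurePreserving (measurePreserving_tree_coord_coord a n i)

lemma integral_tree_coord (a : Vertex r) (n : ℕ) (i : Fin N) (k : Fin (m + 1)) :
    ∫ y, y a n i k ∂(treeMeasure N γ) = 0 := by
  have h := (measurePreserving_tree_coord_coord (γ := γ) a n i)
  have h1 : ∫ y, y a n i k ∂(treeMeasure N γ) = ∫ z, z k ∂(stepMeasure γ a.1) := by
    rw [← h.map_eq, integral_map h.measurable.aemeasurable (by fun_prop)]
  rw [h1]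
  have h2 := (EuclideanSpace.proj (𝕜 := ℝ) k).integral_comp_id_comm
    (IsGaussian.integrable_id (μ := stepMeasure γ a.1))
  simpa [stepMeasure] using h2

lemma integral_treeField (t : Fin N × (Fin r → ℕ) × Fin (m + 1)) :
    ∫ y, treeField y t ∂(treeMeasure N γ) = 0 := by
  unfold treeField
  rw [integral_finsetSum]
  · simp [integral_tree_coord]
  · exact fun p _ => (memLp_tree_coord _ _ _ _).integrable (by norm_num)

/-! ### Edges shared by two leaves and the covariance of the tree field -/

lemma commonDepth_lt_iff (α α' : Fin r → ℕ) (p : Fin r) :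
    (p : ℕ) < commonDepth α α' ↔ ∀ j : Fin r, j ≤ p → α j = α' j := by
  unfold commonDepth
  constructor
  · intro h j hj
    have hspec := Nat.findGreatest_spec (P := fun p => ∀ j : Fin r, (j : ℕ) < p → α j = α' j)
      (m := 0) (n := r) (Nat.zero_le r) (fun j hj => absurd hj (Nat.not_lt_zero _))
    exact hspec j (lt_of_le_of_lt hj h)
  · intro h
    refine Nat.lt_of_succ_le (Nat.le_findGreatest p.2 fun j hj => h j ?_)
    exact Nat.lt_succ_iff.1 hj

lemma ancestor_eq_iff (α α' : Fin r → ℕ) (p q : Fin r) :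
    (ancestor α p, α p) = (ancestor α' q, α' q) ↔ p = q ∧ (p : ℕ) < commonDepth α α' := by
  rw [commonDepth_lt_iff, Prod.mk.injEq]
  constructor
  · rintro ⟨h1, h2⟩
    have hpq : p = q := congrArg Sigma.fst h1
    subst hpq
    refine ⟨rfl, fun j hj => ?_⟩
    rcases hj.lt_or_eq with hj | rfl
    · have h3 : (fun j : Fin p => α (Fin.castLE p.isLt.le j)) =
          fun j : Fin p => α' (Fin.castLE p.isLt.le j) := eq_of_heq (Sigma.mk.inj h1).2
      exact congrFun h3 ⟨j, hj⟩
    · exact h2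
  · rintro ⟨rfl, h⟩
    refine ⟨?_, h p le_rfl⟩
    unfold ancestor
    congr 1
    ext j
    exact h _ (Fin.le_def.2 j.isLt.le)

/-- Telescoping over the edges shared by two leaves. -/
lemma sum_increments_lt {A : Type*} [AddCommGroup A] (g : Fin (r + 1) → A) (c : Fin (r + 1)) :
    ∑ p : Fin r, (if (p : ℕ) < c then g p.succ - g p.castSucc else 0) = g c - g 0 := by
  have hc := c.2
  have h1 : ∀ n (hn : n ≤ r), ∑ p : Fin r, (if (p : ℕ) < n then g p.succ - g p.castSucc else 0) =
      g ⟨n, Nat.lt_succ_of_le hn⟩ - g 0 := by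
    intro n
    induction n with
    | zero => intro hn; simp
    | succ n ih =>
      intro hn
      have hsplit : ∀ p : Fin r, (if (p : ℕ) < n + 1 then g p.succ - g p.castSucc else 0) =
          (if (p : ℕ) < n then g p.succ - g p.castSucc else 0) +
            if p = ⟨n, hn⟩ then g p.succ - g p.castSucc else 0 := by
        intro p
        have : p = ⟨n, hn⟩ ↔ (p : ℕ) = n := Fin.ext_iff
        by_cases h1 : (p : ℕ) < n
        · simp [h1, h1.ne, Nat.lt_succ_of_lt h1, this]
        · by_cases h2 : (p : ℕ) = n
          · simp [h2, this]
          · have : ¬ (p : ℕ) < n + 1 := by omega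
            simp [h1, h2, this, Fin.ext_iff]
      rw [Finset.sum_congr rfl fun p _ => hsplit p, Finset.sum_add_distrib, ih (by omega),
        Finset.sum_ite_eq' Finset.univ (⟨n, hn⟩ : Fin r)]
      simp only [Finset.mem_univ, if_true]
      have e1 : (⟨n, hn⟩ : Fin r).succ = ⟨n + 1, Nat.lt_succ_of_le hn⟩ := rfl
      have e2 : (⟨n, hn⟩ : Fin r).castSucc = ⟨n, Nat.lt_succ_of_le (by omega)⟩ := rfl
      rw [e1, e2]
      abel
  exact h1 c (Nat.le_of_lt_succ hc)

lemma covariance_tree_coord (hγ : ∀ p : Fin r, (γ p.succ - γ p.castSucc).PosSemidef)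
    (s t : (Vertex r × ℕ) × Fin N) (k l : Fin (m + 1)) :
    cov[fun y => y s.1.1 s.1.2 s.2 k, fun y => y t.1.1 t.1.2 t.2 l; treeMeasure N γ] =
      if s = t then 2 * (γ s.1.1.1.succ k l - γ s.1.1.1.castSucc k l) else 0 := by
  split_ifs with h
  · subst h
    have h := measurePreserving_tree_coord_coord (γ := γ) s.1.1 s.1.2 s.2
    have h1 := covariance_map (μ := treeMeasure N γ)
      (Z := fun y => y s.1.1 s.1.2 s.2) (X := fun z => z k) (Y := fun z => z l)
      (by fun_prop) (by fun_prop) h.measurable.aemeasurable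
    rw [h.map_eq] at h1
    refine h1.symm.trans ?_
    rw [stepMeasure, covariance_eval_multivariateGaussian ((hγ _).smul (by norm_num))]
    simp
  · refine IndepFun.covariance_eq_zero ?_ (memLp_tree_coord _ _ _ _) (memLp_tree_coord _ _ _ _)
    exact (iIndepFun_tree_coord_coord.indepFun h).comp (φ := fun z => z k) (ψ := fun z => z l)
      (by fun_prop) (by fun_prop)

/-- Increments on distinct edges or sites are uncorrelated, so only the first $\alpha\wedge\alpha'$
edges at a common site count. Their covariances telescope from $\gamma_0=0$. -/
lemma covariance_treeField (hγ0 : γ 0 = 0)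
    (hγ : ∀ p : Fin r, (γ p.succ - γ p.castSucc).PosSemidef)
    (s t : Fin N × (Fin r → ℕ) × Fin (m + 1)) :
    cov[fun y => treeField y s, fun y => treeField y t; treeMeasure N γ] =
      if s.1 = t.1 then 2 * γ (commonDepth s.2.1 t.2.1) s.2.2 t.2.2 else 0 := by
  unfold treeField
  rw [covariance_fun_sum_fun_sum (fun p => memLp_tree_coord _ _ _ _)
    fun p => memLp_tree_coord _ _ _ _]
  have h1 : ∀ p q : Fin r, cov[fun y => y (ancestor s.2.1 p) (s.2.1 p) s.1 s.2.2,
      fun y => y (ancestor t.2.1 q) (t.2.1 q) t.1 t.2.2; treeMeasure N γ] =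
      if p = q then (if s.1 = t.1 then (if (p : ℕ) < commonDepth s.2.1 t.2.1 then
        2 * γ p.succ s.2.2 t.2.2 - 2 * γ p.castSucc s.2.2 t.2.2 else 0) else 0) else 0 := by
    intro p q
    have h := covariance_tree_coord hγ ((ancestor s.2.1 p, s.2.1 p), s.1)
      ((ancestor t.2.1 q, t.2.1 q), t.1) s.2.2 t.2.2
    have hiff : (((ancestor s.2.1 p, s.2.1 p), s.1) = ((ancestor t.2.1 q, t.2.1 q), t.1)) ↔
        p = q ∧ s.1 = t.1 ∧ (p : ℕ) < commonDepth s.2.1 t.2.1 := by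
      rw [Prod.mk.injEq, ancestor_eq_iff]; tauto
    refine h.trans ?_
    simp only [hiff, ← ite_and]
    congr 1
    simp only [ancestor]
    ring
  simp_rw [h1, Finset.sum_ite_eq, Finset.mem_univ, if_true]
  split_ifs with h
  · rw [sum_increments_lt fun p => 2 * γ p s.2.2 t.2.2]
    simp [hγ0]
  · simp

/-! ### Comparison of the given field with the tree field -/

variable {Ω : Type*} [MeasurableSpace Ω] {P : Measure Ω} [IsProbabilityMeasure P]
  {Z : ℕ → (Fin r → ℕ) → Fin (m + 1) → Ω → ℝ}

/-- The hypothesis is Gaussian at each site separately; independence of the sites makes the family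
jointly Gaussian. -/
lemma IsCascadeField.isGaussianProcess (hZ : IsCascadeField γ Z P) :
    IsGaussianProcess (fun t : Fin N × (Fin r → ℕ) × Fin (m + 1) => Z t.1 t.2.1 t.2.2) P where
  hasGaussianLaw I := by
    classical
    let J : Finset ((Fin r → ℕ) × Fin (m + 1)) := I.image fun t => t.2
    have h1 : HasGaussianLaw (fun ω (i : Fin N) (q : J) => Z i q.1.1 q.1.2 ω) P := by
      refine iIndepFun.hasGaussianLaw (X := fun (i : Fin N) ω (q : J) => Z i q.1.1 q.1.2 ω)
        (fun i => (hZ.gaussian i).hasGaussianLaw J) ?_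
      exact (hZ.indep.precomp (g := ((↑) : Fin N → ℕ)) Fin.val_injective).comp
        (fun _ z (q : J) => z q.1.1 q.1.2) fun _ => by fun_prop
    let L : (Fin N → J → ℝ) →L[ℝ] (I → ℝ) := ContinuousLinearMap.pi fun t : I =>
      (ContinuousLinearMap.proj (R := ℝ) (φ := fun _ : J => ℝ)
        ⟨t.1.2, Finset.mem_image_of_mem _ t.2⟩).comp
        (ContinuousLinearMap.proj (R := ℝ) (φ := fun _ : Fin N => J → ℝ) t.1.1)
    exact h1.map L

/-- The law of the field is the law of the sums of independent increments along the paths. -/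
lemma IsCascadeField.map_eq (hZ : IsCascadeField γ Z P) (hγ0 : γ 0 = 0)
    (hγ : ∀ p : Fin r, (γ p.succ - γ p.castSucc).PosSemidef) :
    P.map (fun ω (t : Fin N × (Fin r → ℕ) × Fin (m + 1)) => Z t.1 t.2.1 t.2.2 ω) =
      (treeMeasure N γ).map fun y t => treeField y t := by
  refine map_eq_of_isGaussianProcess
    (X := fun t : Fin N × (Fin r → ℕ) × Fin (m + 1) => Z t.1 t.2.1 t.2.2)
    (X' := fun t y => treeField y t) hZ.isGaussianProcess
    isGaussianProcess_treeField (fun t => hZ.measurable _ _ _) measurable_treeField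
    (fun t => hZ.mean _ _ _) integral_treeField fun s t => ?_
  rw [covariance_treeField hγ0 hγ]
  split_ifs with h
  · rw [h]; exact hZ.cov _ _ _ _ _
  · have hne : (s.1 : ℕ) ≠ t.1 := fun h' => h (Fin.ext h')
    have hLp : ∀ i α k, MemLp (Z i α k) 2 P := fun i α k =>
      ((hZ.gaussian i).hasGaussianLaw_eval (α, k)).memLp_two
    refine IndepFun.covariance_eq_zero ?_ (hLp _ _ _) (hLp _ _ _)
    exact (hZ.indep.indepFun hne).comp (φ := fun z => z s.2.1 s.2.2) (ψ := fun z => z t.2.1 t.2.2)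
      (by fun_prop) (by fun_prop)

variable {x : Fin (r + 1) → ℝ} {u : Vertex r → ℕ → Ω → ℝ}

/-- The original space need not carry increments on the edges, so they are adjoined as a second
factor. -/
lemma IsRuelleCascade.isMarkedCascade (hu : IsRuelleCascade x u P) :
    IsMarkedCascade x (blockMeasure N γ) (fun a ω n => u a n ω.1)
      (fun a (ω : Ω × (Vertex r → ℕ → Fin N → EuclideanSpace ℝ (Fin (m + 1)))) => ω.2 a)
      (P.prod (treeMeasure N γ)) where
  poisson a := (hu.poisson a).comp_measurePreserving measurePreserving_fst
  measurable a n := by fun_prop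
  law a := ((measurePreserving_eval_infinitePi
    (fun a : Vertex r => Measure.infinitePi fun _ : ℕ => blockMeasure N γ a.1) a).comp
      measurePreserving_snd).map_eq
  indep_mark a := indepFun_prod (X := fun ω n => u a n ω) 
    (Y := fun y : Vertex r → ℕ → Fin N → EuclideanSpace ℝ (Fin (m + 1)) => y a)
    (measurable_pi_lambda _ (hu.poisson a).measurable) (measurable_pi_apply a)
  indep := iIndepFun_prodMk_prod (X := fun a ω n => u a n ω)
    (Y := fun a (y : Vertex r → ℕ → Fin N → EuclideanSpace ℝ (Fin (m + 1))) => y a)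
    (fun a => measurable_pi_lambda _ (hu.poisson a).measurable) (fun a => measurable_pi_apply a)
    hu.indep (iIndepFun_infinitePi (X := fun _ y => y) fun _ => measurable_id)

/-- The field of the first `N` sites at the leaf `α`. -/
def leafField (N : ℕ) (Z : ℕ → (Fin r → ℕ) → Fin (m + 1) → Ω → ℝ) (α : Fin r → ℕ) (ω : Ω) :
    Fin N → EuclideanSpace ℝ (Fin (m + 1)) :=
  fun i => WithLp.toLp 2 fun k => Z i α k ω

/-- The sum `∑_α w_α f(Z^α)`. -/
def cascadeSum (u : Vertex r → ℕ → Ω → ℝ) (Z : ℕ → (Fin r → ℕ) → Fin (m + 1) → Ω → ℝ) (N : ℕ)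
    (f : (Fin N → EuclideanSpace ℝ (Fin (m + 1))) → ℝ≥0∞) (ω : Ω) : ℝ≥0∞ :=
  ∑' α : Fin r → ℕ, pathWeight le_rfl (fun a n => u a n ω) α * f (leafField N Z α ω)

/-- The Laplace transform depends only on the joint law of points and field, so the field may be
replaced by the tree field on the product space. The factor `c` is absorbed into `f` by homogeneity
of the recursion. -/
theorem hasStableLaplace_cascadeSum (hx : ∀ p, 0 < x p) (hlast : x (Fin.last r) = 1)
    (hγ0 : γ 0 = 0) (hγ : ∀ p : Fin r, (γ p.succ - γ p.castSucc).PosSemidef)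
    (hu : IsRuelleCascade x u P) (hZ : IsCascadeField γ Z P)
    (huZ : IndepFun (fun (ω : Ω) (a : Vertex r) (n : ℕ) => u a n ω)
      (fun (ω : Ω) (i : ℕ) (α : Fin r → ℕ) (k : Fin (m + 1)) => Z i α k ω) P)
    {f : (Fin N → EuclideanSpace ℝ (Fin (m + 1))) → ℝ≥0∞} (hf : Measurable f)
    (hfin : ∀ p y, cascadeRec x (blockMeasure N γ) f p y ≠ ∞) :
    HasStableLaplace (cascadeConst x 0) (x 0) (cascadeRec x (blockMeasure N γ) f 0 0)
      (cascadeSum u Z N f) P := by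
  let Q := treeMeasure N γ
  let T := Fin N × (Fin r → ℕ) × Fin (m + 1)
  let A : Ω → Vertex r → ℕ → ℝ := fun ω a n => u a n ω
  let B : Ω → T → ℝ := fun ω t => Z t.1 t.2.1 t.2.2 ω
  let B' : (Vertex r → ℕ → Fin N → EuclideanSpace ℝ (Fin (m + 1))) → T → ℝ :=
    fun y t => treeField y t
  have hA : Measurable A :=
    measurable_pi_lambda _ fun a => measurable_pi_lambda _ (hu.poisson a).measurable
  have hB : Measurable B := measurable_pi_lambda _ fun t => hZ.measurable _ _ _
  have hB' : Measurable B' := measurable_pi_lambda _ measurable_treeField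
  have hAB : IndepFun A B P := huZ.comp (φ := id)
    (ψ := fun (z : ℕ → (Fin r → ℕ) → Fin (m + 1) → ℝ) (t : T) => z t.1 t.2.1 t.2.2) measurable_id
    (by fun_prop)
  have hlaw : P.map (fun ω => (A ω, B ω)) =
      (P.prod Q).map fun ω => (A ω.1, B' ω.2) := by
    rw [(indepFun_iff_map_prod_eq_prod_map_map hA.aemeasurable hB.aemeasurable).1 hAB,
      hZ.map_eq hγ0 hγ]
    exact Measure.map_prod_map _ _ hA hB'
  let G : (Vertex r → ℕ → ℝ) × (T → ℝ) → ℝ≥0∞ := fun q => ∑' α : Fin r → ℕ,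
    pathWeight le_rfl q.1 α * f fun i => WithLp.toLp 2 fun k => q.2 (i, α, k)
  have hG : Measurable G := by
    refine Measurable.tsum fun α => Measurable.mul ?_ (hf.comp ?_)
    · unfold pathWeight
      fun_prop
    · refine measurable_pi_lambda _ fun i => ?_
      exact (WithLp.measurable_toLp 2 _).comp (by fun_prop)
  refine ⟨hG.comp (hA.prodMk hB), fun c hc => ?_⟩
  calc ∫⁻ ω, expNeg (c * cascadeSum u Z N f ω) ∂P
      = ∫⁻ q, expNeg (c * G q) ∂(P.map fun ω => (A ω, B ω)) := by
        rw [lintegral_map (by fun_prop) (hA.prodMk hB)]; rfl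
    _ = ∫⁻ ω, expNeg (c * G (A ω.1, B' ω.2)) ∂(P.prod Q) := by
        have hAB' : Measurable fun ω : Ω × (Vertex r → ℕ → Fin N →
            EuclideanSpace ℝ (Fin (m + 1))) => (A ω.1, B' ω.2) :=
          (hA.comp measurable_fst).prodMk (hB'.comp measurable_snd)
        rw [hlaw, lintegral_map (by fun_prop) hAB']
    _ = ∫⁻ ω, expNeg (∑' α : Fin r → ℕ, pathWeight le_rfl (fun v n => u v n ω.1) α *
          (c * f (pathSum le_rfl (fun v => ω.2 v) α))) ∂(P.prod Q) := by
        refine lintegral_congr fun ω => ?_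
        rw [← ENNReal.tsum_mul_left]
        congr 2
        ext α
        have : (fun i => WithLp.toLp 2 fun k => B' ω.2 (i, α, k)) =
            pathSum le_rfl (fun v => ω.2 v) α := by
          ext i k
          simp only [B', treeField, pathSum, Finset.sum_apply, WithLp.ofLp_sum]
          rfl
        rw [this]
        ring
    _ = expNeg (cascadeConst x 0 * (cascadeRec x (blockMeasure N γ) (fun y => c * f y) 0 0) ^ x 0) :=
        hu.isMarkedCascade.lintegral_expNeg hx hlast (hf.const_mul c) fun p y => by
          rw [cascadeRec_const_mul hx hf]
          exact ENNReal.mul_ne_top hc (hfin p y)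
    _ = _ := by rw [cascadeRec_const_mul hx hf]

end Field

/-! ### Legendre duality for superadditive functions on `ℕ ^ ι` -/

section Duality

variable {ι : Type*} {a : (ι → ℕ) → ℝ}

lemma superadditive_nsmul (ha : ∀ n, 0 ≤ a n) (hsup : ∀ n n', a n + a n' ≤ a (n + n'))
    (j : ℕ) (n : ι → ℕ) : j * a n ≤ a (j • n) := by
  induction j with
  | zero => simpa using ha _
  | succ j ih =>
    rw [succ_nsmul]
    push_cast
    linarith [hsup (j • n) n]

/-- The open cone below the graph of the concave homogeneous envelope of `a` on the face `S`. -/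
def subgraphCone (a : (ι → ℕ) → ℝ) (S : Finset ι) : Set ((ι → ℝ) × ℝ) :=
  {v | ∃ (q : ℕ) (n : ι → ℕ), 0 < q ∧ (∀ k ∉ S, n k = 0) ∧ (∀ k ∈ S, (n k : ℝ) < q * v.1 k) ∧
    q * v.2 < a n}

lemma isOpen_subgraphCone (S : Finset ι) : IsOpen (subgraphCone a S) := by
  have : subgraphCone a S = ⋃ (q : ℕ) (n : ι → ℕ) (_ : 0 < q) (_ : ∀ k ∉ S, n k = 0),
      (⋂ k ∈ S, {v : (ι → ℝ) × ℝ | (n k : ℝ) < q * v.1 k}) ∩ {v | q * v.2 < a n} := by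
    ext v
    simp only [subgraphCone, Set.mem_ofPred_eq, Set.mem_iUnion, Set.mem_inter_iff, Set.mem_iInter,
      exists_prop]
  rw [this]
  refine isOpen_iUnion fun q => isOpen_iUnion fun n => isOpen_iUnion fun _ => isOpen_iUnion fun _ =>
    IsOpen.inter ?_ ?_
  · exact isOpen_biInter_finset fun k _ => isOpen_lt (by fun_prop) (by fun_prop)
  · exact isOpen_lt (by fun_prop) (by fun_prop)

lemma add_mem_subgraphCone (ha : ∀ n, 0 ≤ a n) (hsup : ∀ n n', a n + a n' ≤ a (n + n'))
    {S : Finset ι} {v w : (ι → ℝ) × ℝ} (hv : v ∈ subgraphCone a S) (hw : w ∈ subgraphCone a S) :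
    v + w ∈ subgraphCone a S := by
  obtain ⟨q, n, hq, hnS, hn, ht⟩ := hv
  obtain ⟨q', n', hq', hnS', hn', ht'⟩ := hw
  have hq0 : (0 : ℝ) < q := by exact_mod_cast hq
  have hq0' : (0 : ℝ) < q' := by exact_mod_cast hq'
  -- The fractions $n/q$ and $n'/q'$ are added over a common denominator.
  refine ⟨q * q', q' • n + q • n', Nat.mul_pos hq hq', fun k hk => by simp [hnS k hk, hnS' k hk],
    fun k hk => ?_, ?_⟩
  · have h1 := mul_lt_mul_of_pos_left (hn k hk) hq0'
    have h2 := mul_lt_mul_of_pos_left (hn' k hk) hq0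
    simp only [Pi.add_apply, Pi.smul_apply, smul_eq_mul, Prod.fst_add]
    push_cast
    nlinarith
  · have h1 := mul_lt_mul_of_pos_left ht hq0'
    have h2 := mul_lt_mul_of_pos_left ht' hq0
    have h3 := superadditive_nsmul ha hsup q' n
    have h4 := superadditive_nsmul ha hsup q n'
    have h5 := hsup (q' • n) (q • n')
    simp only [Prod.snd_add]
    push_cast
    nlinarith

lemma smul_mem_subgraphCone (ha : ∀ n, 0 ≤ a n) (hsup : ∀ n n', a n + a n' ≤ a (n + n'))
    {S : Finset ι} {v : (ι → ℝ) × ℝ} (hv : v ∈ subgraphCone a S) {τ : ℝ} (hτ : 0 < τ) :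
    τ • v ∈ subgraphCone a S := by
  obtain ⟨q, n, hq, hnS, hn, ht⟩ := hv
  have hq0 : (0 : ℝ) < q := by exact_mod_cast hq
  -- Rounding $\tau Q$ down loses at most one copy of $n$; this `Q` makes the strict slack in the
  -- last coordinate exceed that loss of `a n`.
  obtain ⟨Q, hQ⟩ := exists_nat_gt (max (a n / (τ * (a n - q * v.2))) 0)
  have hQ0 : (0 : ℝ) < Q := (le_max_right _ _).trans_lt hQ
  have hgap : 0 < a n - q * v.2 := by linarith
  have hQ1 : a n < Q * (τ * (a n - q * v.2)) :=
    (div_lt_iff₀ (by positivity)).1 ((le_max_left _ _).trans_lt hQ)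
  have hfl : ((⌊τ * Q⌋₊ : ℕ) : ℝ) ≤ τ * Q := Nat.floor_le (by positivity)
  have hfl' : τ * Q < (⌊τ * Q⌋₊ : ℕ) + 1 := Nat.lt_floor_add_one _
  refine ⟨q * Q, ⌊τ * Q⌋₊ • n, Nat.mul_pos hq (by exact_mod_cast hQ0), fun k hk => by simp [hnS k hk],
    fun k hk => ?_, ?_⟩
  · have h1 : (⌊τ * Q⌋₊ : ℝ) * n k ≤ τ * Q * n k := by gcongr
    have h2 : τ * Q * n k < τ * Q * (q * v.1 k) := mul_lt_mul_of_pos_left (hn k hk) (by positivity)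
    simp only [Pi.smul_apply, smul_eq_mul, Prod.smul_fst]
    push_cast
    linarith
  · have h1 := superadditive_nsmul ha hsup ⌊τ * Q⌋₊ n
    have h2 : (τ * Q - 1) * a n ≤ (⌊τ * Q⌋₊ : ℝ) * a n :=
      mul_le_mul_of_nonneg_right (by linarith) (ha n)
    simp only [Prod.smul_snd, smul_eq_mul]
    push_cast
    linarith

lemma convex_subgraphCone (ha : ∀ n, 0 ≤ a n) (hsup : ∀ n n', a n + a n' ≤ a (n + n'))
    (S : Finset ι) : Convex ℝ (subgraphCone a S) := by
  rw [convex_iff_forall_pos]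
  intro v hv w hw s t hs ht _
  exact add_mem_subgraphCone ha hsup (smul_mem_subgraphCone ha hsup hv hs)
    (smul_mem_subgraphCone ha hsup hw ht)

variable [Fintype ι]

/-- A point above the cone is separated from it by a supporting linear function. -/
lemma exists_multiplier_of_notMem (ha : ∀ n, 0 ≤ a n) (hsup : ∀ n n', a n + a n' ≤ a (n + n'))
    {S : Finset ι} {d : ι → ℝ} (hdS : ∀ k ∈ S, 0 < d k) {b : ℝ}
    (h : (d, b) ∉ subgraphCone a S) :
    ∃ lam : ι → ℝ, (∀ k ∉ S, lam k = 0) ∧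
      (∀ n : ι → ℕ, (∀ k ∉ S, n k = 0) → ∑ k, lam k * n k + a n ≤ 0) ∧
      0 ≤ ∑ k, lam k * d k + b := by
  classical
  obtain ⟨f, hf⟩ := geometric_hahn_banach_open_point (convex_subgraphCone ha hsup S)
    (isOpen_subgraphCone S) h
  -- The direction $(1,\dots,1,-1)$ points into the open cone, so weak inequalities are reached by
  -- letting $\varepsilon\to0$.
  have hmem : ∀ (v : ι → ℝ) (t : ℝ) (n : ι → ℕ), (∀ k ∉ S, n k = 0) → (∀ k ∈ S, (n k : ℝ) ≤ v k) →
      t ≤ a n → ∀ ε : ℝ, 0 < ε → ((v, t) + ε • ((fun _ => 1 : ι → ℝ), (-1 : ℝ))) ∈ subgraphCone a S := by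
    intro v t n hnS hn ht ε hε
    refine ⟨1, n, one_pos, hnS, fun k hk => ?_, ?_⟩
    · have := hn k hk
      simp only [Prod.fst_add, Prod.smul_fst, Pi.add_apply, Pi.smul_apply, smul_eq_mul]
      push_cast
      linarith
    · simp only [Prod.snd_add, Prod.smul_snd, smul_eq_mul]
      push_cast
      linarith
  -- A positive value could be scaled up beyond the bound `f (d, b)`.
  have hle : ∀ w ∈ subgraphCone a S, f w ≤ 0 := by
    intro w hw
    by_contra hpos
    push Not at hpos
    have h1 := hf _ (smul_mem_subgraphCone ha hsup hw
      (show 0 < (|f (d, b)| + 1) / f w by positivity))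
    rw [map_smul, smul_eq_mul, div_mul_cancel₀ _ hpos.ne'] at h1
    linarith [le_abs_self (f (d, b))]
  have hmem0 := hmem 0 (-1) 0 (by simp) (by simp) (by linarith [ha 0]) 1 one_pos
  -- Scaling a point of the cone towards the origin brings `f` arbitrarily close to $0$ from below.
  have hx0 : 0 ≤ f (d, b) := by
    by_contra hneg
    push Not at hneg
    set w := ((0, -1) + (1 : ℝ) • ((fun _ => 1 : ι → ℝ), (-1 : ℝ)) : (ι → ℝ) × ℝ)
    have hw := hle _ hmem0
    have hτ : 0 < -f (d, b) / (1 - f w) := div_pos (by linarith) (by linarith)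
    have h1 := hf _ (smul_mem_subgraphCone ha hsup hmem0 hτ)
    rw [map_smul, smul_eq_mul] at h1
    have h2 : -f (d, b) / (1 - f w) * f w ≥ f (d, b) := by
      rw [ge_iff_le, div_mul_eq_mul_div, le_div_iff₀ (by linarith)]
      nlinarith
    linarith
  have hclos : ∀ (v : ι → ℝ) (t : ℝ) (n : ι → ℕ), (∀ k ∉ S, n k = 0) → (∀ k ∈ S, (n k : ℝ) ≤ v k) →
      t ≤ a n → f (v, t) ≤ 0 := by
    intro v t n hnS hn ht
    have h1 : ∀ ε : ℝ, 0 < ε → f (v, t) + ε * f ((fun _ => 1 : ι → ℝ), (-1 : ℝ)) ≤ 0 := by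
      intro ε hε
      have := hle _ (hmem v t n hnS hn ht ε hε)
      rwa [map_add, map_smul, smul_eq_mul] at this
    have h2 : Tendsto (fun ε : ℝ => f (v, t) + ε * f ((fun _ => 1 : ι → ℝ), (-1 : ℝ))) (𝓝[>] 0)
        (𝓝 (f (v, t) + 0 * f ((fun _ => 1 : ι → ℝ), (-1 : ℝ)))) :=
      (Continuous.tendsto (by fun_prop) 0).mono_left nhdsWithin_le_nhds
    rw [zero_mul, add_zero] at h2
    exact le_of_tendsto h2 (eventually_nhdsWithin_of_forall h1)
  set c : ι → ℝ := fun k => f (Pi.single k 1, 0) with hc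
  set s : ℝ := f (0, 1) with hs
  have hfe : ∀ v t, f (v, t) = ∑ k, c k * v k + s * t := by
    intro v t
    have hvt : (v, t) = ∑ k, v k • ((Pi.single k 1 : ι → ℝ), (0 : ℝ)) + t • ((0 : ι → ℝ), (1 : ℝ)) := by
      ext j
      · simp [Prod.fst_sum, Finset.sum_apply, Pi.single_apply]
      · simp [Prod.snd_sum]
    rw [hvt, map_add, map_sum, map_smul, smul_eq_mul, mul_comm t]
    simp_rw [map_smul, smul_eq_mul, mul_comm (v _)]
    rfl
  have hs0 : 0 ≤ s := by
    have := hclos 0 (-1) 0 (by simp) (by simp) (by linarith [ha 0])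
    rw [hfe] at this
    simp at this
    linarith
  have hcS : ∀ k, c k ≤ 0 := fun k => by
    refine hclos (Pi.single k 1) 0 0 (by simp) (fun j _ => ?_) (ha 0)
    by_cases hjk : j = k
    · subst hjk; simp
    · simp [hjk]
  -- The cone does not constrain the coordinates outside `S`, so both signs of the basis vector are
  -- allowed.
  have hcS' : ∀ k ∉ S, c k = 0 := fun k hk => by
    refine le_antisymm (hcS k) ?_
    have h1 := hclos (-Pi.single k 1) 0 0 (by simp) (fun j hj => ?_) (ha 0)
    · have h2 : ((-Pi.single k 1 : ι → ℝ), (0 : ℝ)) = -(Pi.single k 1, 0) := by simp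
      rw [h2, map_neg] at h1
      linarith
    · have : j ≠ k := fun h => hk (h ▸ hj)
      simp [this]
  -- The separating hyperplane is not vertical: if $s=0$, nonnegativity at $(d,b)$ and $d_k>0$ on
  -- `S` force `f` to vanish, against strict separation.
  have hspos : 0 < s := by
    refine lt_of_le_of_ne hs0 fun hs' => ?_
    have h1 := hx0
    rw [hfe, ← hs', zero_mul, add_zero] at h1
    have hterm : ∀ k ∈ Finset.univ, c k * d k ≤ 0 := fun k _ => by
      by_cases hk : k ∈ S
      · exact mul_nonpos_of_nonpos_of_nonneg (hcS k) (hdS k hk).le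
      · simp [hcS' k hk]
    have hzero := (Finset.sum_eq_zero_iff_of_nonpos hterm).1
      (le_antisymm (Finset.sum_nonpos hterm) h1)
    have hc0 : ∀ k, c k = 0 := fun k => by
      by_cases hk : k ∈ S
      · exact (mul_eq_zero.1 (hzero k (Finset.mem_univ k))).resolve_right (hdS k hk).ne'
      · exact hcS' k hk
    have hf0 : ∀ v t, f (v, t) = 0 := fun v t => by simp [hfe, hc0, ← hs']
    have := hf _ hmem0
    rw [← Prod.mk.eta (p := (0, -1) + (1 : ℝ) • ((fun _ => 1 : ι → ℝ), (-1 : ℝ))), hf0, hf0] at this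
    exact lt_irrefl _ this
  have hdiv : ∀ v : ι → ℝ, ∑ k, c k / s * v k = (∑ k, c k * v k) / s := fun v => by
    rw [Finset.sum_div]
    exact Finset.sum_congr rfl fun k _ => by ring
  refine ⟨fun k => c k / s, fun k hk => by simp [hcS' k hk], fun n hn => ?_, ?_⟩
  · have h1 := hclos (fun k => n k) (a n) n hn (fun _ _ => le_rfl) le_rfl
    rw [hfe] at h1
    rw [hdiv fun k => (n k : ℝ)]
    have h2 : (∑ k, c k * (n k : ℝ)) / s + a n = (∑ k, c k * (n k : ℝ) + s * a n) / s := by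
      field_simp
    rw [h2]
    exact div_nonpos_of_nonpos_of_nonneg h1 hs0
  · rw [hfe] at hx0
    rw [hdiv d]
    have h2 : (∑ k, c k * d k) / s + b = (∑ k, c k * d k + s * b) / s := by field_simp
    rw [h2]
    exact div_nonneg hx0 hs0

/-- The limit of a superadditive function along an approximate ray is a Legendre transform. -/
theorem tendsto_superadditive_div (ha : ∀ n, 0 ≤ a n)
    (hsup : ∀ n n', a n + a n' ≤ a (n + n')) {Φ : (ι → ℝ) → ℝ}
    (hup : ∀ (lam : ι → ℝ) (n : ι → ℕ), ∑ k, lam k * n k + a n ≤ (∑ k, n k : ℕ) * Φ lam)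
    (hface : ∀ (S : Finset ι) (lam : ι → ℝ),
      (∀ n : ι → ℕ, (∀ k ∉ S, n k = 0) → ∑ k, lam k * n k + a n ≤ 0) →
      ∀ ε > 0, ∃ lam' : ι → ℝ, (∀ k ∈ S, lam' k = lam k) ∧ Φ lam' ≤ ε)
    {n : ℕ → ι → ℕ} (hn : ∀ N, 1 ≤ N → ∑ k, n N k = N) {d : ι → ℝ}
    (hd : ∀ k, Tendsto (fun N : ℕ => (n N k : ℝ) / N) atTop (𝓝 (d k))) :
    (∀ lam : ι → ℝ, 0 ≤ -∑ k, lam k * d k + Φ lam) ∧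
      Tendsto (fun N : ℕ => a (n N) / N) atTop (𝓝 (⨅ lam : ι → ℝ, (-∑ k, lam k * d k + Φ lam))) := by
  have hupper : ∀ lam : ι → ℝ, ∀ N : ℕ, 1 ≤ N →
      a (n N) / N ≤ -∑ k, lam k * ((n N k : ℝ) / N) + Φ lam := by
    intro lam N hN
    have hN0 : (0 : ℝ) < N := by exact_mod_cast hN
    have h1 := hup lam (n N)
    rw [hn N hN] at h1
    have h2 : ∑ k, lam k * ((n N k : ℝ) / N) = (∑ k, lam k * (n N k : ℝ)) / N := by
      rw [Finset.sum_div]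
      exact Finset.sum_congr rfl fun k _ => by ring
    rw [h2, div_le_iff₀ hN0]
    field_simp
    linarith
  have hlim : ∀ lam : ι → ℝ, Tendsto (fun N : ℕ => -∑ k, lam k * ((n N k : ℝ) / N) + Φ lam) atTop
      (𝓝 (-∑ k, lam k * d k + Φ lam)) := fun lam =>
    ((tendsto_finsetSum _ fun k _ => (hd k).const_mul _).neg).add_const _
  have hnonneg : ∀ lam : ι → ℝ, 0 ≤ -∑ k, lam k * d k + Φ lam := by
    intro lam
    refine ge_of_tendsto (hlim lam) ?_
    filter_upwards [eventually_ge_atTop 1] with N hN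
    exact le_trans (div_nonneg (ha _) (Nat.cast_nonneg N)) (hupper lam N hN)
  have hbdd : BddBelow (Set.range fun lam : ι → ℝ => -∑ k, lam k * d k + Φ lam) :=
    ⟨0, by rintro _ ⟨lam, rfl⟩; exact hnonneg lam⟩
  have hd0 : ∀ k, 0 ≤ d k := fun k =>
    ge_of_tendsto' (hd k) fun N => by positivity
  refine ⟨hnonneg, ?_⟩
  rw [tendsto_order]
  refine ⟨fun b hb => ?_, fun b hb => ?_⟩
  -- Where $d_k=0$ the counts `n N k` may vanish, so only vectors supported in `S` can be packed
  -- below them.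
  · set S : Finset ι := Finset.univ.filter fun k => 0 < d k with hS
    have hdS : ∀ k ∈ S, 0 < d k := fun k hk => (Finset.mem_filter.1 hk).2
    have hdS' : ∀ k ∉ S, d k = 0 := fun k hk => by
      refine le_antisymm (not_lt.1 fun h => hk ?_) (hd0 k)
      simp [hS, h]
    have hmem : (d, b) ∈ subgraphCone a S := by
      by_contra hnot
      obtain ⟨lam, -, hlam, hlamd⟩ := exists_multiplier_of_notMem ha hsup hdS hnot
      set I := ⨅ lam : ι → ℝ, (-∑ k, lam k * d k + Φ lam)
      obtain ⟨lam', hlam', hΦ⟩ := hface S lam hlam ((I - b) / 2) (by linarith)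
      have h1 : I ≤ -∑ k, lam' k * d k + Φ lam' := ciInf_le hbdd lam'
      have h2 : ∑ k, lam' k * d k = ∑ k, lam k * d k := by
        refine Finset.sum_congr rfl fun k _ => ?_
        by_cases hk : k ∈ S
        · rw [hlam' k hk]
        · rw [hdS' k hk]; simp
      rw [h2] at h1
      linarith
    obtain ⟨q, l, hq, hlS, hl, hb'⟩ := hmem
    have hq0 : (0 : ℝ) < q := by exact_mod_cast hq
    have hev : ∀ᶠ N : ℕ in atTop, ∀ k ∈ S, (l k : ℝ) / q < (n N k : ℝ) / N := by
      rw [Filter.eventually_all_finset]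
      intro k hk
      refine (tendsto_order.1 (hd k)).1 _ ?_
      rw [div_lt_iff₀ hq0, mul_comm]
      exact hl k hk
    have hgap : 0 < a l / q - b := by
      rw [sub_pos, lt_div_iff₀ hq0, mul_comm]; exact hb'
    -- Beyond this `N0` the gain $N(a(l)/q-b)$ exceeds `a l`, the largest loss from rounding $N/q$
    -- down.
    obtain ⟨N0, hN0⟩ := exists_nat_gt (a l / (a l / q - b))
    filter_upwards [hev, eventually_ge_atTop 1, eventually_ge_atTop N0] with N hN hN1 hNN0
    have hNpos : (0 : ℝ) < N := by exact_mod_cast hN1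
    have hdivle : ((N / q : ℕ) : ℝ) ≤ N / q := Nat.cast_div_le
    have hle : (N / q) • l ≤ n N := by
      intro k
      by_cases hk : k ∈ S
      · have h1 := hN k hk
        rw [lt_div_iff₀ hNpos] at h1
        have h2 : ((N / q : ℕ) : ℝ) * l k ≤ n N k := by
          calc ((N / q : ℕ) : ℝ) * l k ≤ N / q * l k := by gcongr
            _ = l k / q * N := by ring
            _ ≤ n N k := h1.le
        simp only [Pi.smul_apply, smul_eq_mul]
        exact_mod_cast h2
      · simp [hlS k hk]
    have h1 : a ((N / q) • l) ≤ a (n N) := by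
      have := hsup ((N / q) • l) (n N - (N / q) • l)
      rw [add_tsub_cancel_of_le hle] at this
      linarith [ha (n N - (N / q) • l)]
    have h2 := superadditive_nsmul ha hsup (N / q) l
    have h3 : (N : ℝ) / q - 1 ≤ ((N / q : ℕ) : ℝ) := by
      rw [sub_le_iff_le_add, div_le_iff₀ hq0]
      have := Nat.lt_mul_div_succ N hq
      have h' : N ≤ (N / q + 1) * q := by rw [mul_comm]; exact this.le
      exact_mod_cast h'
    have h4 : ((N : ℝ) / q - 1) * a l ≤ ((N / q : ℕ) : ℝ) * a l :=
      mul_le_mul_of_nonneg_right h3 (ha l)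
    rw [lt_div_iff₀ hNpos]
    have h5 : a l < N * (a l / q - b) := by
      rw [div_lt_iff₀ hgap] at hN0
      refine hN0.trans_le (mul_le_mul_of_nonneg_right (by exact_mod_cast hNN0) hgap.le)
    have h6 : ((N : ℝ) / q - 1) * a l = N * (a l / q) - a l := by ring
    linarith
  · obtain ⟨lam, hlam⟩ := exists_lt_of_ciInf_lt hb
    filter_upwards [(tendsto_order.1 (hlim lam)).2 b hlam, eventually_ge_atTop 1] with N h1 h2
    exact (hupper lam N h2).trans_lt h1

end Duality

/-! ### Exponential functionals of the spins -/

section Spin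

variable {r m N M : ℕ} {γ : Fin (r + 1) → Matrix (Fin (m + 1)) (Fin (m + 1)) ℝ}
  {x : Fin (r + 1) → ℝ} {β : ℝ}

lemma measurePreserving_block_append (p : Fin r) :
    MeasurePreserving (fun y : Fin (N + M) → EuclideanSpace ℝ (Fin (m + 1)) =>
      ((fun i => y (Fin.castAdd M i), fun j => y (Fin.natAdd N j)) :
        (Fin N → EuclideanSpace ℝ (Fin (m + 1))) × (Fin M → EuclideanSpace ℝ (Fin (m + 1)))))
      (blockMeasure (N + M) γ p) ((blockMeasure N γ p).prod (blockMeasure M γ p)) := by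
  have hT : Measurable fun y : Fin (N + M) → EuclideanSpace ℝ (Fin (m + 1)) =>
      ((fun i => y (Fin.castAdd M i), fun j => y (Fin.natAdd N j)) :
        (Fin N → EuclideanSpace ℝ (Fin (m + 1))) × (Fin M → EuclideanSpace ℝ (Fin (m + 1)))) := by
    fun_prop
  have hA : Measurable fun q : (Fin N → EuclideanSpace ℝ (Fin (m + 1))) ×
      (Fin M → EuclideanSpace ℝ (Fin (m + 1))) => Fin.append q.1 q.2 := by
    refine measurable_pi_lambda _ fun i => ?_
    refine Fin.addCases (fun i => ?_) (fun i => ?_) i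
    · simp only [Fin.append_left]; fun_prop
    · simp only [Fin.append_right]; fun_prop
  have h : blockMeasure (N + M) γ p =
      ((blockMeasure N γ p).prod (blockMeasure M γ p)).map fun q => Fin.append q.1 q.2 := by
    refine Measure.pi_eq fun s hs => ?_
    rw [Measure.map_apply hA (MeasurableSet.univ_pi hs)]
    have : (fun q : (Fin N → EuclideanSpace ℝ (Fin (m + 1))) ×
        (Fin M → EuclideanSpace ℝ (Fin (m + 1))) => Fin.append q.1 q.2) ⁻¹' Set.univ.pi s =
        (Set.univ.pi fun i => s (Fin.castAdd M i)) ×ˢ Set.univ.pi fun j => s (Fin.natAdd N j) := by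
      ext q
      simp only [Set.mem_preimage, Set.mem_pi, Set.mem_univ, true_imp_iff, Set.mem_prod]
      constructor
      · exact fun h => ⟨fun i => by simpa using h (Fin.castAdd M i),
          fun j => by simpa using h (Fin.natAdd N j)⟩
      · rintro ⟨h1, h2⟩ i
        refine Fin.addCases (fun i => ?_) (fun i => ?_) i
        · simpa using h1 i
        · simpa using h2 i
    rw [this, Measure.prod_prod, blockMeasure, blockMeasure, Measure.pi_pi, Measure.pi_pi,
      Fin.prod_univ_add]
  refine ⟨hT, ?_⟩
  rw [h, Measure.map_map hT hA]
  convert Measure.map_id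
  ext q <;> simp

lemma cascadeRec_block_prod (hx : ∀ p, 0 < x p)
    {g : Fin N → EuclideanSpace ℝ (Fin (m + 1)) → ℝ≥0∞} (hg : ∀ i, Measurable (g i))
    (p : Fin (r + 1)) (y : Fin N → EuclideanSpace ℝ (Fin (m + 1))) :
    cascadeRec x (blockMeasure N γ) (fun y => ∏ i, g i (y i)) p y =
      ∏ i, cascadeRec x (stepMeasure γ) (g i) p (y i) := by
  induction p using Fin.reverseInduction generalizing y with
  | last => simp
  | cast p ih =>
    have h := hx p.castSucc
    have hm : ∀ i, Measurable fun z : EuclideanSpace ℝ (Fin (m + 1)) =>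
        cascadeRec x (stepMeasure γ) (g i) p.succ (y i + z) ^ x p.castSucc := fun i =>
      measurable_cascadeRec_shift (hg i) _ _ _
    simp_rw [cascadeRec_castSucc, ih, Pi.add_apply]
    have hind : iIndepFun (fun i (z : Fin N → EuclideanSpace ℝ (Fin (m + 1))) =>
        cascadeRec x (stepMeasure γ) (g i) p.succ (y i + z i) ^ x p.castSucc)
        (blockMeasure N γ p) :=
      iIndepFun_pi (μ := fun _ : Fin N => stepMeasure γ p) (X := fun i z =>
        cascadeRec x (stepMeasure γ) (g i) p.succ (y i + z) ^ x p.castSucc)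
        fun i => (hm i).aemeasurable
    rw [ENNReal.prod_rpow_of_nonneg (by positivity)]
    congr 1
    rw [lintegral_congr fun z => (ENNReal.prod_rpow_of_nonneg h.le).symm,
      lintegral_prod_eq_prod_lintegral_of_indepFun Finset.univ _ hind fun i =>
        (hm i).comp (measurable_pi_apply i)]
    exact Finset.prod_congr rfl fun i _ =>
      (measurePreserving_eval (fun _ : Fin N => stepMeasure γ p) i).lintegral_comp (hm i)

/-- The Boltzmann factor of a spin in the state `k`. -/
def stateFun (β : ℝ) (k : Fin (m + 1)) (y : EuclideanSpace ℝ (Fin (m + 1))) : ℝ≥0∞ :=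
  ENNReal.ofReal (Real.exp (β * y k))

lemma measurable_stateFun (k : Fin (m + 1)) : Measurable (stateFun (m := m) β k) := by
  unfold stateFun; fun_prop

lemma stateFun_rpow (k : Fin (m + 1)) (y : EuclideanSpace ℝ (Fin (m + 1))) (a : ℝ) :
    stateFun β k y ^ a = ENNReal.ofReal (Real.exp (a * β * y k)) := by
  rw [stateFun, ENNReal.ofReal_rpow_of_pos (Real.exp_pos _), ← Real.exp_mul]
  congr 2
  ring

lemma integrable_exp_coord (c : ℝ) (k : Fin (m + 1)) (p : Fin r) :
    Integrable (fun z => Real.exp (c * z k)) (stepMeasure γ p) := by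
  have h := IsGaussian.map_eq_gaussianReal (μ := stepMeasure γ p)
    (EuclideanSpace.proj (𝕜 := ℝ) k)
  have h1 := integrable_exp_mul_gaussianReal (μ := ∫ z, EuclideanSpace.proj (𝕜 := ℝ) k z
    ∂(stepMeasure γ p)) (v := (Var[EuclideanSpace.proj (𝕜 := ℝ) k; stepMeasure γ p]).toNNReal) c
  rw [← h] at h1
  exact h1.comp_measurable (by fun_prop)

lemma integral_coord (k : Fin (m + 1)) (p : Fin r) : ∫ z, z k ∂(stepMeasure γ p) = 0 := by
  have h := (EuclideanSpace.proj (𝕜 := ℝ) k).integral_comp_id_comm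
    (IsGaussian.integrable_id (μ := stepMeasure γ p))
  simpa [stepMeasure] using h

lemma integrable_coord (k : Fin (m + 1)) (p : Fin r) :
    Integrable (fun z => z k) (stepMeasure γ p) :=
  (IsGaussian.memLp_dual (stepMeasure γ p) (EuclideanSpace.proj k) 1 (by simp)).integrable le_rfl

lemma lintegral_stateFun_rpow_ne_top (k : Fin (m + 1)) (p : Fin r) (a : ℝ) :
    ∫⁻ z, stateFun β k z ^ a ∂(stepMeasure γ p) ≠ ∞ := by
  simp_rw [stateFun_rpow]
  exact (integrable_exp_coord _ k p).lintegral_lt_top.ne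

/-- Jensen's inequality for a centred variable, in the form $e^t\ge1+t$. -/
lemma one_le_lintegral_stateFun_rpow (k : Fin (m + 1)) (p : Fin r) (a : ℝ) :
    1 ≤ ∫⁻ z, stateFun β k z ^ a ∂(stepMeasure γ p) := by
  simp_rw [stateFun_rpow]
  rw [← ofReal_integral_eq_lintegral_ofReal (integrable_exp_coord _ k p)
    (Eventually.of_forall fun _ => (Real.exp_pos _).le), ENNReal.one_le_ofReal]
  have h1 : ∫ z, (a * β * z k + 1) ∂(stepMeasure γ p) = 1 := by
    rw [integral_add ((integrable_coord k p).const_mul _) (integrable_const _),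
      integral_const_mul, integral_coord]
    simp
  rw [← h1]
  exact integral_mono (((integrable_coord k p).const_mul _).add (integrable_const _))
    (integrable_exp_coord _ k p) fun z => Real.add_one_le_exp _

lemma cascadeRec_stateFun_ne_top (hx : ∀ p, 0 < x p) (k : Fin (m + 1)) (p : Fin (r + 1))
    (y : EuclideanSpace ℝ (Fin (m + 1))) :
    cascadeRec x (stepMeasure γ) (stateFun β k) p y ≠ ∞ := by
  have h := cascadeRec_exp (μ := stepMeasure γ) hx
    (L := fun y : EuclideanSpace ℝ (Fin (m + 1)) => β * y k)
    (fun y z => by simp [mul_add]) (by fun_prop) p y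
  refine (h.trans_ne ?_)
  exact ENNReal.mul_ne_top ENNReal.ofReal_ne_top
    (cascadeRec_exp_zero_ne_top hx (fun y z => by simp [mul_add]) (by fun_prop)
      (fun p => lintegral_stateFun_rpow_ne_top k p _) p)

lemma one_le_cascadeRec_stateFun (hx : ∀ p, 0 < x p) (k : Fin (m + 1)) (p : Fin (r + 1)) :
    1 ≤ cascadeRec x (stepMeasure γ) (stateFun β k) p 0 :=
  one_le_cascadeRec_exp_zero (L := fun y : EuclideanSpace ℝ (Fin (m + 1)) => β * y k) hx
    (fun y z => by simp [mul_add]) (by fun_prop)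
    (fun p => one_le_lintegral_stateFun_rpow k p _) p

lemma cascadeRec_sum_ne_top {E ι : Type*} [MeasurableSpace E] [AddZeroClass E] [MeasurableAdd₂ E]
    {μ : Fin r → Measure E} [∀ p, SFinite (μ p)]
    (hx : ∀ p, 0 < x p) (hmono : Monotone x) (hlast : x (Fin.last r) = 1) (s : Finset ι)
    {f : ι → E → ℝ≥0∞} (hf : ∀ i, Measurable (f i)) (p : Fin (r + 1)) (y : E)
    (hfin : ∀ i ∈ s, cascadeRec x μ (f i) p y ≠ ∞) :
    cascadeRec x μ (fun y => ∑ i ∈ s, f i y) p y ≠ ∞ := by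
  intro h
  have h1 := cascadeRec_sum_rpow_le (μ := μ) hx hmono hlast s hf p y
  rw [h, ENNReal.top_rpow_of_pos (hx p), top_le_iff] at h1
  exact ENNReal.sum_ne_top.2 (fun i hi => ENNReal.rpow_ne_top_of_nonneg (hx p).le (hfin i hi)) h1

/-- The partition function of the spins over the configurations in `s`. -/
def configFun (β : ℝ) (s : Finset (Fin N → Fin (m + 1)))
    (y : Fin N → EuclideanSpace ℝ (Fin (m + 1))) : ℝ≥0∞ :=
  ∑ σ ∈ s, ∏ i, stateFun β (σ i) (y i)

lemma measurable_prod_stateFun (σ : Fin N → Fin (m + 1)) :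
    Measurable fun y : Fin N → EuclideanSpace ℝ (Fin (m + 1)) => ∏ i, stateFun β (σ i) (y i) :=
  Finset.measurable_prod _ fun i _ => (measurable_stateFun (σ i)).comp (measurable_pi_apply i)

lemma measurable_configFun (s : Finset (Fin N → Fin (m + 1))) :
    Measurable (configFun (m := m) β s) :=
  Finset.measurable_sum _ fun σ _ => measurable_prod_stateFun σ

lemma cascadeRec_configFun_ne_top (hx : ∀ p, 0 < x p) (hmono : Monotone x)
    (hlast : x (Fin.last r) = 1) (s : Finset (Fin N → Fin (m + 1))) (p : Fin (r + 1))
    (y : Fin N → EuclideanSpace ℝ (Fin (m + 1))) :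
    cascadeRec x (blockMeasure N γ) (configFun β s) p y ≠ ∞ := by
  refine cascadeRec_sum_ne_top hx hmono hlast s measurable_prod_stateFun p y fun σ _ => ?_
  rw [cascadeRec_block_prod hx fun i => measurable_stateFun (σ i)]
  exact ENNReal.prod_ne_top fun i _ => cascadeRec_stateFun_ne_top hx _ _ _

/-- A single configuration is kept; its value is a product over the sites of factors at least $1$.
-/
lemma one_le_cascadeRec_configFun (hx : ∀ p, 0 < x p) {s : Finset (Fin N → Fin (m + 1))}
    (hs : s.Nonempty) (p : Fin (r + 1)) :
    1 ≤ cascadeRec x (blockMeasure N γ) (configFun β s) p 0 := by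
  obtain ⟨σ, hσ⟩ := hs
  refine le_trans ?_ (cascadeRec_mono hx (f := fun y => ∏ i, stateFun β (σ i) (y i))
    (fun y => Finset.single_le_sum (f := fun σ : Fin N → Fin (m + 1) =>
      ∏ i, stateFun β (σ i) (y i)) (fun _ _ => zero_le) hσ) p 0)
  rw [cascadeRec_block_prod hx fun i => measurable_stateFun (σ i)]
  exact Finset.one_le_prod' fun i _ => one_le_cascadeRec_stateFun hx _ _

/-- The number of spins in the state `k`. -/
def stateCount (σ : Fin N → Fin (m + 1)) (k : Fin (m + 1)) : ℕ :=
  (Finset.univ.filter fun i => σ i = k).card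

/-- The configurations with `n k` spins in the state `k` for every `k`. -/
def countConfigs (N : ℕ) (n : Fin (m + 1) → ℕ) : Finset (Fin N → Fin (m + 1)) :=
  Finset.univ.filter fun σ => stateCount σ = n

lemma mem_countConfigs {n : Fin (m + 1) → ℕ} {σ : Fin N → Fin (m + 1)} :
    σ ∈ countConfigs N n ↔ stateCount σ = n := by simp [countConfigs]

lemma sum_stateCount (σ : Fin N → Fin (m + 1)) : ∑ k, stateCount σ k = N := by
  simpa [stateCount] using (Finset.card_eq_sum_card_fiberwise (f := σ) (s := Finset.univ) (t := Finset.univ)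
    (fun _ _ => Finset.mem_coe.2 (Finset.mem_univ _))).symm

lemma sum_comp_eq_sum_stateCount (σ : Fin N → Fin (m + 1)) (lam : Fin (m + 1) → ℝ) :
    ∑ i, lam (σ i) = ∑ k, lam k * stateCount σ k := by
  rw [← Finset.sum_fiberwise_of_maps_to (s := Finset.univ) (t := Finset.univ) (g := σ)
    (fun _ _ => Finset.mem_univ _)]
  refine Finset.sum_congr rfl fun k _ => ?_
  rw [Finset.sum_congr rfl fun i hi => by rw [(Finset.mem_filter.1 hi).2], Finset.sum_const,
    nsmul_eq_mul, mul_comm]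
  rfl

lemma stateCount_append (σ : Fin N → Fin (m + 1)) (τ : Fin M → Fin (m + 1)) :
    stateCount (Fin.append σ τ) = stateCount σ + stateCount τ := by
  ext k
  simp only [stateCount, Finset.card_filter, Fin.sum_univ_add, Fin.append_left, Fin.append_right,
    Pi.add_apply]

lemma countConfigs_nonempty (n : Fin (m + 1) → ℕ) : (countConfigs (∑ k, n k) n).Nonempty := by
  -- The sites are cut into consecutive blocks of lengths `n k`, with state `k` on the block of
  -- index `k`.
  refine ⟨fun i => (finSigmaFinEquiv.symm i).1, mem_countConfigs.2 (funext fun k => ?_)⟩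
  rw [stateCount, Finset.card_filter, ← finSigmaFinEquiv.sum_comp]
  simp only [Equiv.symm_apply_apply]
  rw [Fintype.sum_sigma]
  rw [Finset.sum_eq_single k (fun l _ hl => by simp [hl]) (by simp)]
  simp

/-- Concatenation of configurations is injective and adds the counts, so the product is a partial
sum of the right-hand side. -/
lemma configFun_mul_le (n n' : Fin (m + 1) → ℕ)
    (y : Fin (N + M) → EuclideanSpace ℝ (Fin (m + 1))) :
    configFun β (countConfigs N n) (fun i => y (Fin.castAdd M i)) *
        configFun β (countConfigs M n') (fun j => y (Fin.natAdd N j)) ≤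
      configFun β (countConfigs (N + M) (n + n')) y := by
  classical
  rw [configFun, configFun, Finset.sum_mul_sum, ← Finset.sum_product']
  have hinj : Function.Injective fun q : (Fin N → Fin (m + 1)) × (Fin M → Fin (m + 1)) =>
      Fin.append q.1 q.2 := by
    intro q q' h
    refine Prod.ext (funext fun i => ?_) (funext fun j => ?_)
    · simpa using congrFun h (Fin.castAdd M i)
    · simpa using congrFun h (Fin.natAdd N j)
  calc _ = ∑ q ∈ countConfigs N n ×ˢ countConfigs M n',
        ∏ i, stateFun β (Fin.append q.1 q.2 i) (y i) := by
        refine Finset.sum_congr rfl fun q _ => ?_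
        simp [Fin.prod_univ_add]
    _ = ∑ σ ∈ (countConfigs N n ×ˢ countConfigs M n').image fun q => Fin.append q.1 q.2,
        ∏ i, stateFun β (σ i) (y i) := by
        rw [Finset.sum_image hinj.injOn]
    _ ≤ _ := by
        refine Finset.sum_le_sum_of_subset (Finset.image_subset_iff.2 fun q hq => ?_)
        rw [Finset.mem_product, mem_countConfigs, mem_countConfigs] at hq
        rw [mem_countConfigs, stateCount_append, hq.1, hq.2]

/-- The value at the root of the recursion for the partition function with fixed counts. -/
def countValue (x : Fin (r + 1) → ℝ) (γ : Fin (r + 1) → Matrix (Fin (m + 1)) (Fin (m + 1)) ℝ)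
    (β : ℝ) (N : ℕ) (n : Fin (m + 1) → ℕ) : ℝ≥0∞ :=
  cascadeRec x (blockMeasure N γ) (configFun β (countConfigs N n)) 0 0

lemma countValue_mul_le (hx : ∀ p, 0 < x p) (n n' : Fin (m + 1) → ℕ) :
    countValue x γ β N n * countValue x γ β M n' ≤ countValue x γ β (N + M) (n + n') := by
  have h1 := cascadeRec_prod (μ := blockMeasure N γ) (μ' := blockMeasure M γ) hx
    (measurable_configFun (β := β) (countConfigs N n))
    (measurable_configFun (β := β) (countConfigs M n')) 0 0
  refine h1.symm.trans_le ?_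
  have h2 := cascadeRec_comp (x := x)
    (((measurable_configFun (β := β) (countConfigs N n)).comp measurable_fst).mul
      ((measurable_configFun (β := β) (countConfigs M n')).comp measurable_snd)) _
    (fun p => measurePreserving_block_append (γ := γ) p) (fun y z => rfl) 0 0
  refine h2.symm.trans_le ?_
  exact cascadeRec_mono hx (configFun_mul_le n n') 0 0

/-- The free energy with fixed counts. -/
def countEnergy (x : Fin (r + 1) → ℝ) (γ : Fin (r + 1) → Matrix (Fin (m + 1)) (Fin (m + 1)) ℝ)
    (β : ℝ) (n : Fin (m + 1) → ℕ) : ℝ :=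
  Real.log (countValue x γ β (∑ k, n k) n).toReal

lemma one_le_countValue (hx : ∀ p, 0 < x p) (n : Fin (m + 1) → ℕ) :
    1 ≤ countValue x γ β (∑ k, n k) n :=
  one_le_cascadeRec_configFun hx (countConfigs_nonempty n) 0

lemma countValue_ne_top (hx : ∀ p, 0 < x p) (hmono : Monotone x) (hlast : x (Fin.last r) = 1)
    (N : ℕ) (n : Fin (m + 1) → ℕ) : countValue x γ β N n ≠ ∞ :=
  cascadeRec_configFun_ne_top hx hmono hlast _ 0 0

lemma one_le_toReal_countValue (hx : ∀ p, 0 < x p) (hmono : Monotone x)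
    (hlast : x (Fin.last r) = 1) (n : Fin (m + 1) → ℕ) :
    1 ≤ (countValue x γ β (∑ k, n k) n).toReal := by
  simpa using ENNReal.toReal_mono (countValue_ne_top hx hmono hlast _ n) (one_le_countValue hx n)

lemma countEnergy_nonneg (hx : ∀ p, 0 < x p) (hmono : Monotone x) (hlast : x (Fin.last r) = 1)
    (n : Fin (m + 1) → ℕ) : 0 ≤ countEnergy x γ β n :=
  Real.log_nonneg (one_le_toReal_countValue hx hmono hlast n)

lemma ofReal_exp_countEnergy (hx : ∀ p, 0 < x p) (hmono : Monotone x)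
    (hlast : x (Fin.last r) = 1) (n : Fin (m + 1) → ℕ) :
    ENNReal.ofReal (Real.exp (countEnergy x γ β n)) = countValue x γ β (∑ k, n k) n := by
  rw [countEnergy, Real.exp_log (by linarith [one_le_toReal_countValue (γ := γ) (β := β) hx hmono hlast n]),
    ENNReal.ofReal_toReal (countValue_ne_top hx hmono hlast _ n)]

lemma countEnergy_add_le (hx : ∀ p, 0 < x p) (hmono : Monotone x) (hlast : x (Fin.last r) = 1)
    (n n' : Fin (m + 1) → ℕ) :
    countEnergy x γ β n + countEnergy x γ β n' ≤ countEnergy x γ β (n + n') := by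
  have h := countValue_mul_le (N := ∑ k, n k) (M := ∑ k, n' k) (γ := γ) (β := β) hx n n'
  rw [← Finset.sum_add_distrib, ← ofReal_exp_countEnergy hx hmono hlast,
    ← ofReal_exp_countEnergy hx hmono hlast, ← ENNReal.ofReal_mul (Real.exp_pos _).le,
    ← Real.exp_add] at h
  have h2 := ofReal_exp_countEnergy (γ := γ) (β := β) hx hmono hlast (n + n')
  simp only [Pi.add_apply] at h2
  rw [← h2, ENNReal.ofReal_le_ofReal_iff (Real.exp_pos _).le, Real.exp_le_exp] at h
  exact h

end Spin

/-! ### Lagrange multipliers -/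

section Multiplier

variable {r m N : ℕ} {γ : Fin (r + 1) → Matrix (Fin (m + 1)) (Fin (m + 1)) ℝ}
  {x : Fin (r + 1) → ℝ} {β : ℝ}

/-- The partition function of one spin with states in `S` and multipliers `lam`. -/
def stateSum (β : ℝ) (S : Finset (Fin (m + 1))) (lam : Fin (m + 1) → ℝ)
    (y : EuclideanSpace ℝ (Fin (m + 1))) : ℝ≥0∞ :=
  ∑ k ∈ S, ENNReal.ofReal (Real.exp (lam k)) * stateFun β k y

lemma measurable_stateSum (S : Finset (Fin (m + 1))) (lam : Fin (m + 1) → ℝ) :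
    Measurable (stateSum β S lam) :=
  Finset.measurable_sum _ fun k _ => (measurable_stateFun k).const_mul _

lemma prod_stateSum (S : Finset (Fin (m + 1))) (lam : Fin (m + 1) → ℝ)
    (y : Fin N → EuclideanSpace ℝ (Fin (m + 1))) :
    ∏ i, stateSum β S lam (y i) = ∑ σ ∈ Fintype.piFinset fun _ => S,
      ENNReal.ofReal (Real.exp (∑ k, lam k * stateCount σ k)) *
        ∏ i, stateFun β (σ i) (y i) := by
  simp only [stateSum]
  rw [Finset.prod_univ_sum]
  refine Finset.sum_congr rfl fun σ _ => ?_
  rw [Finset.prod_mul_distrib, ← sum_comp_eq_sum_stateCount, Real.exp_sum,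
    ENNReal.ofReal_prod_of_nonneg fun i _ => (Real.exp_pos _).le]

lemma mul_configFun_le_prod_stateSum (lam : Fin (m + 1) → ℝ) (n : Fin (m + 1) → ℕ)
    (y : Fin N → EuclideanSpace ℝ (Fin (m + 1))) :
    ENNReal.ofReal (Real.exp (∑ k, lam k * n k)) * configFun β (countConfigs N n) y ≤
      ∏ i, stateSum β Finset.univ lam (y i) := by
  rw [prod_stateSum, configFun, Finset.mul_sum]
  calc _ = ∑ σ ∈ countConfigs N n, ENNReal.ofReal (Real.exp (∑ k, lam k * stateCount σ k)) *
        ∏ i, stateFun β (σ i) (y i) :=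
        Finset.sum_congr rfl fun σ hσ => by rw [mem_countConfigs.1 hσ]
    _ ≤ _ := Finset.sum_le_sum_of_subset fun σ _ => by simp

/-- Configurations are grouped by counts, on which the multiplier weight depends alone; each group
is then enlarged to all configurations with those counts. -/
lemma prod_stateSum_le (S : Finset (Fin (m + 1))) (lam : Fin (m + 1) → ℝ)
    (y : Fin N → EuclideanSpace ℝ (Fin (m + 1))) :
    ∏ i, stateSum β S lam (y i) ≤
      ∑ n ∈ (Fintype.piFinset fun _ : Fin N => S).image stateCount,
        ENNReal.ofReal (Real.exp (∑ k, lam k * n k)) * configFun β (countConfigs N n) y := by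
  rw [prod_stateSum, ← Finset.sum_fiberwise_of_maps_to (g := stateCount)
    (t := (Fintype.piFinset fun _ : Fin N => S).image stateCount)
    fun σ hσ => Finset.mem_image_of_mem _ hσ]
  refine Finset.sum_le_sum fun n _ => ?_
  rw [configFun, Finset.mul_sum]
  calc _ = ∑ σ ∈ (Fintype.piFinset fun _ : Fin N => S) with stateCount σ = n,
        ENNReal.ofReal (Real.exp (∑ k, lam k * n k)) * ∏ i, stateFun β (σ i) (y i) :=
        Finset.sum_congr rfl fun σ hσ => by rw [(Finset.mem_filter.1 hσ).2]
    _ ≤ _ := Finset.sum_le_sum_of_subset fun σ hσ =>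
        mem_countConfigs.2 (Finset.mem_filter.1 hσ).2

/-- The value at the root of the recursion for one spin with multipliers. -/
def multiplierValue (x : Fin (r + 1) → ℝ)
    (γ : Fin (r + 1) → Matrix (Fin (m + 1)) (Fin (m + 1)) ℝ) (β : ℝ) (S : Finset (Fin (m + 1)))
    (lam : Fin (m + 1) → ℝ) : ℝ≥0∞ :=
  cascadeRec x (stepMeasure γ) (stateSum β S lam) 0 0

lemma cascadeRec_stateSum_ne_top (hx : ∀ p, 0 < x p) (hmono : Monotone x)
    (hlast : x (Fin.last r) = 1) (S : Finset (Fin (m + 1))) (lam : Fin (m + 1) → ℝ)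
    (p : Fin (r + 1)) (y : EuclideanSpace ℝ (Fin (m + 1))) :
    cascadeRec x (stepMeasure γ) (stateSum β S lam) p y ≠ ∞ := by
  refine cascadeRec_sum_ne_top hx hmono hlast S
    (fun k => (measurable_stateFun k).const_mul _) p y fun k _ => ?_
  rw [cascadeRec_const_mul hx (measurable_stateFun k)]
  exact ENNReal.mul_ne_top ENNReal.ofReal_ne_top (cascadeRec_stateFun_ne_top hx _ _ _)

lemma multiplierValue_pow (hx : ∀ p, 0 < x p) (S : Finset (Fin (m + 1)))
    (lam : Fin (m + 1) → ℝ) (N : ℕ) : multiplierValue x γ β S lam ^ N =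
      cascadeRec x (blockMeasure N γ) (fun y => ∏ i, stateSum β S lam (y i)) 0 0 := by
  rw [cascadeRec_block_prod hx fun _ => measurable_stateSum S lam]
  simp [multiplierValue]

lemma mul_countValue_le (hx : ∀ p, 0 < x p) (lam : Fin (m + 1) → ℝ) (n : Fin (m + 1) → ℕ) :
    ENNReal.ofReal (Real.exp (∑ k, lam k * n k)) * countValue x γ β N n ≤
      multiplierValue x γ β Finset.univ lam ^ N := by
  rw [multiplierValue_pow hx, countValue, ← cascadeRec_const_mul hx (measurable_configFun _)]
  exact cascadeRec_mono hx (mul_configFun_le_prod_stateSum lam n) 0 0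

lemma multiplierValue_ne_zero (hx : ∀ p, 0 < x p) (lam : Fin (m + 1) → ℝ) :
    multiplierValue x γ β Finset.univ lam ≠ 0 := by
  intro h
  have h1 := mul_countValue_le (γ := γ) (β := β) (N := ∑ k : Fin (m + 1), 1) hx lam fun _ => 1
  rw [h, zero_pow (by simp)] at h1
  have h2 := one_le_countValue (γ := γ) (β := β) hx fun _ : Fin (m + 1) => 1
  rw [nonpos_iff_eq_zero, mul_eq_zero] at h1
  rcases h1 with h1 | h1
  · exact absurd (ENNReal.ofReal_eq_zero.1 h1) (Real.exp_pos _).not_ge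
  · rw [h1] at h2
    simp at h2

lemma sum_mul_add_countEnergy_le (hx : ∀ p, 0 < x p) (hmono : Monotone x)
    (hlast : x (Fin.last r) = 1) (lam : Fin (m + 1) → ℝ) (n : Fin (m + 1) → ℕ) :
    ∑ k, lam k * n k + countEnergy x γ β n ≤
      (∑ k, n k : ℕ) * Real.log (multiplierValue x γ β Finset.univ lam).toReal := by
  have h := mul_countValue_le (γ := γ) (β := β) (N := ∑ k, n k) hx lam n
  have hW := cascadeRec_stateSum_ne_top (γ := γ) (β := β) hx hmono hlast Finset.univ lam 0 0
  have hW0 : 0 < (multiplierValue x γ β Finset.univ lam).toReal :=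
    ENNReal.toReal_pos (multiplierValue_ne_zero hx lam) hW
  rw [← ofReal_exp_countEnergy hx hmono hlast, ← ENNReal.ofReal_mul (Real.exp_pos _).le,
    ← Real.exp_add] at h
  have h2 := ENNReal.toReal_mono (ENNReal.pow_ne_top hW) h
  rw [ENNReal.toReal_ofReal (Real.exp_pos _).le, ENNReal.toReal_pow] at h2
  rw [← Real.log_pow, Real.le_log_iff_exp_le (pow_pos hW0 _)]
  exact h2

lemma stateCount_le (σ : Fin N → Fin (m + 1)) (k : Fin (m + 1)) : stateCount σ k ≤ N := by
  simpa [stateCount] using Finset.card_filter_le (Finset.univ : Finset (Fin N)) fun i => σ i = k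

lemma card_image_stateCount_le (S : Finset (Fin (m + 1))) :
    ((Fintype.piFinset fun _ : Fin N => S).image stateCount).card ≤ (N + 1) ^ (m + 1) := by
  have h : (Fintype.piFinset fun _ : Fin N => S).image stateCount ⊆
      Fintype.piFinset fun _ : Fin (m + 1) => Finset.range (N + 1) := by
    refine Finset.image_subset_iff.2 fun σ _ => ?_
    simpa [Nat.lt_succ_iff] using stateCount_le σ
  simpa using Finset.card_le_card h

/-- The multiplier bound on a face is attained up to polynomial factors. -/
lemma multiplierValue_le_one (hx : ∀ p, 0 < x p) (hmono : Monotone x)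
    (hlast : x (Fin.last r) = 1) {S : Finset (Fin (m + 1))} {lam : Fin (m + 1) → ℝ}
    (h : ∀ n : Fin (m + 1) → ℕ, (∀ k ∉ S, n k = 0) →
      ∑ k, lam k * n k + countEnergy x γ β n ≤ 0) :
    multiplierValue x γ β S lam ≤ 1 := by
  have hx0 := hx 0
  have hW := cascadeRec_stateSum_ne_top (γ := γ) (β := β) hx hmono hlast S lam 0 0
  -- Subadditivity of the power $x_0$ bounds the left side by one term per count vector, and the
  -- hypothesis makes each term at most $1$. Polynomial growth of powers then forces the base to be
  -- at most $1$.
  have hpow : ∀ N : ℕ, (multiplierValue x γ β S lam ^ x 0) ^ N ≤ ((N + 1) ^ (m + 1) : ℕ) := by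
    intro N
    rw [← ENNReal.rpow_natCast, ← ENNReal.rpow_mul, mul_comm, ENNReal.rpow_mul,
      ENNReal.rpow_natCast, multiplierValue_pow hx]
    set I := (Fintype.piFinset fun _ : Fin N => S).image stateCount
    calc _ ≤ (cascadeRec x (blockMeasure N γ) (fun y => ∑ n ∈ I,
          ENNReal.ofReal (Real.exp (∑ k, lam k * n k)) *
            configFun β (countConfigs N n) y) 0 0) ^ x 0 := by
          gcongr
          exact cascadeRec_mono hx (prod_stateSum_le S lam) 0 0
      _ ≤ ∑ n ∈ I, cascadeRec x (blockMeasure N γ) (fun y =>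
          ENNReal.ofReal (Real.exp (∑ k, lam k * n k)) *
            configFun β (countConfigs N n) y) 0 0 ^ x 0 :=
          cascadeRec_sum_rpow_le hx hmono hlast I
            (fun n => (measurable_configFun _).const_mul _) 0 0
      _ ≤ ∑ n ∈ I, 1 := by
          refine Finset.sum_le_sum fun n hn => ENNReal.rpow_le_one ?_ hx0.le
          obtain ⟨σ, hσ, rfl⟩ := Finset.mem_image.1 hn
          rw [cascadeRec_const_mul hx (measurable_configFun _)]
          change _ * countValue x γ β N (stateCount σ) ≤ 1
          have h1 := ofReal_exp_countEnergy (γ := γ) (β := β) hx hmono hlast (stateCount σ)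
          rw [sum_stateCount] at h1
          rw [← h1, ← ENNReal.ofReal_mul (Real.exp_pos _).le, ← Real.exp_add,
            ENNReal.ofReal_le_one, Real.exp_le_one_iff]
          refine h _ fun k hk => ?_
          rw [stateCount, Finset.card_eq_zero, Finset.filter_eq_empty_iff]
          exact fun i _ hi => hk (hi ▸ Fintype.mem_piFinset.1 hσ i)
      _ ≤ _ := by
          rw [Finset.sum_const, nsmul_eq_mul, mul_one]
          exact_mod_cast card_image_stateCount_le S
  by_contra hlt
  push Not at hlt
  set w := (multiplierValue x γ β S lam ^ x 0).toReal
  have hwfin : multiplierValue x γ β S lam ^ x 0 ≠ ∞ := ENNReal.rpow_ne_top_of_nonneg hx0.le hW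
  have hw : 1 < w := by
    have := (ENNReal.toReal_lt_toReal ENNReal.one_ne_top hwfin).2 (ENNReal.one_lt_rpow hlt hx0)
    simpa using this
  have hpow' : ∀ N : ℕ, w ^ N ≤ ((N + 1 : ℕ) : ℝ) ^ (m + 1) := by
    intro N
    have := ENNReal.toReal_mono (ENNReal.natCast_ne_top _) (hpow N)
    rw [ENNReal.toReal_pow, ENNReal.toReal_natCast] at this
    exact_mod_cast this
  have hlim := (tendsto_pow_const_div_const_pow_of_one_lt (m + 1) hw).comp (tendsto_add_atTop_nat 1)
  obtain ⟨N, hN⟩ := ((tendsto_order.1 hlim).2 w⁻¹ (by positivity)).exists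
  have hw0 : 0 < w := by linarith
  simp only [Function.comp_apply] at hN
  rw [div_lt_iff₀ (by positivity), pow_succ w, mul_comm (w ^ N), ← mul_assoc,
    inv_mul_cancel₀ hw0.ne', one_mul] at hN
  exact absurd hN (hpow' N).not_gt

/-- Subadditivity applied to the sum over `S` taken as one term (index `none`) and each remaining
state as another. -/
lemma multiplierValue_univ_rpow_le (hx : ∀ p, 0 < x p) (hmono : Monotone x)
    (hlast : x (Fin.last r) = 1) (S : Finset (Fin (m + 1))) (lam : Fin (m + 1) → ℝ) :
    multiplierValue x γ β Finset.univ lam ^ x 0 ≤ multiplierValue x γ β S lam ^ x 0 +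
      ∑ k ∈ Sᶜ, (ENNReal.ofReal (Real.exp (lam k)) *
        cascadeRec x (stepMeasure γ) (stateFun β k) 0 0) ^ x 0 := by
  let F : Option (Fin (m + 1)) → EuclideanSpace ℝ (Fin (m + 1)) → ℝ≥0∞ := fun o =>
    o.elim (stateSum β S lam) fun k y => ENNReal.ofReal (Real.exp (lam k)) * stateFun β k y
  have hF : ∀ o, Measurable (F o) := by
    rintro (_ | k)
    · exact measurable_stateSum S lam
    · exact (measurable_stateFun k).const_mul _
  have h := cascadeRec_sum_rpow_le (μ := stepMeasure γ) hx hmono hlast (Finset.insertNone Sᶜ) hF 0 0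
  have hsum : (fun y => ∑ o ∈ Finset.insertNone Sᶜ, F o y) = stateSum β Finset.univ lam := by
    funext y
    rw [Finset.sum_insertNone]
    exact Finset.sum_add_sum_compl S _
  rw [hsum, Finset.sum_insertNone] at h
  refine h.trans_eq ?_
  congr 1
  exact Finset.sum_congr rfl fun k _ =>
    congrArg (· ^ x 0) (cascadeRec_const_mul hx (measurable_stateFun k) _ 0 0)

lemma multiplierValue_congr {S : Finset (Fin (m + 1))} {lam lam' : Fin (m + 1) → ℝ}
    (h : ∀ k ∈ S, lam k = lam' k) :
    multiplierValue x γ β S lam = multiplierValue x γ β S lam' := by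
  have : stateSum β S lam = stateSum β S lam' := by
    funext y
    exact Finset.sum_congr rfl fun k hk => by rw [h k hk]
  rw [multiplierValue, multiplierValue, this]

/-- The multipliers off `S` are set to a common value $-t$; as $t\to\infty$ the states off `S`
contribute nothing and the bound $1$ on the face remains. -/
lemma exists_log_multiplierValue_le (hx : ∀ p, 0 < x p) (hmono : Monotone x)
    (hlast : x (Fin.last r) = 1) (S : Finset (Fin (m + 1))) (lam : Fin (m + 1) → ℝ)
    (h : ∀ n : Fin (m + 1) → ℕ, (∀ k ∉ S, n k = 0) →
      ∑ k, lam k * n k + countEnergy x γ β n ≤ 0) {ε : ℝ} (hε : 0 < ε) :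
    ∃ lam' : Fin (m + 1) → ℝ, (∀ k ∈ S, lam' k = lam k) ∧
      Real.log (multiplierValue x γ β Finset.univ lam').toReal ≤ ε := by
  have hx0 := hx 0
  set K := ∑ k ∈ Sᶜ, cascadeRec x (stepMeasure γ) (stateFun β k) 0 0 ^ x 0
  have hK : K ≠ ∞ := ENNReal.sum_ne_top.2 fun k _ =>
    ENNReal.rpow_ne_top_of_nonneg hx0.le (cascadeRec_stateFun_ne_top hx k 0 0)
  have hlim : Tendsto (fun t : ℝ => 1 + ENNReal.ofReal (Real.exp (-t)) ^ x 0 * K) atTop (𝓝 1) := by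
    have h1 : Tendsto (fun t : ℝ => ENNReal.ofReal (Real.exp (-t)) ^ x 0) atTop (𝓝 (0 ^ x 0)) := by
      refine (ENNReal.continuous_rpow_const.tendsto _).comp ?_
      have := ENNReal.tendsto_ofReal Real.tendsto_exp_neg_atTop_nhds_zero
      rwa [ENNReal.ofReal_zero] at this
    rw [ENNReal.zero_rpow_of_pos hx0] at h1
    simpa using (ENNReal.Tendsto.mul_const h1 (Or.inr hK)).const_add 1
  have hgt : (1 : ℝ≥0∞) < ENNReal.ofReal (Real.exp ε) ^ x 0 :=
    ENNReal.one_lt_rpow (ENNReal.one_lt_ofReal.2 (Real.one_lt_exp_iff.2 hε)) hx0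
  obtain ⟨t, ht⟩ := ((tendsto_order.1 hlim).2 _ hgt).exists
  refine ⟨fun k => if k ∈ S then lam k else -t, fun k hk => if_pos hk, ?_⟩
  set lam' : Fin (m + 1) → ℝ := fun k => if k ∈ S then lam k else -t
  have h1 : multiplierValue x γ β Finset.univ lam' ^ x 0 ≤ ENNReal.ofReal (Real.exp ε) ^ x 0 := by
    refine (multiplierValue_univ_rpow_le hx hmono hlast S lam').trans (le_trans ?_ ht.le)
    refine add_le_add ?_ ?_
    · rw [multiplierValue_congr (lam' := lam) fun k hk => if_pos hk]
      exact ENNReal.rpow_le_one (multiplierValue_le_one hx hmono hlast h) hx0.le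
    · rw [Finset.mul_sum]
      refine (Finset.sum_congr rfl fun k hk => ?_).le
      rw [ENNReal.mul_rpow_of_nonneg _ _ hx0.le]
      simp [lam', Finset.mem_compl.1 hk]
  have h2 : multiplierValue x γ β Finset.univ lam' ≤ ENNReal.ofReal (Real.exp ε) :=
    (ENNReal.rpow_le_rpow_iff hx0).1 h1
  have h3 := ENNReal.toReal_mono ENNReal.ofReal_ne_top h2
  rw [ENNReal.toReal_ofReal (Real.exp_pos _).le] at h3
  have hpos : 0 < (multiplierValue x γ β Finset.univ lam').toReal :=
    ENNReal.toReal_pos (multiplierValue_ne_zero hx lam')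
      (cascadeRec_stateSum_ne_top hx hmono hlast Finset.univ lam' 0 0)
  exact (Real.log_le_iff_le_exp hpos).2 h3

/-! ### Normalization of the multipliers and the recursion for $X_p$ -/

lemma log_multiplierValue_add_const (hx : ∀ p, 0 < x p) (hmono : Monotone x)
    (hlast : x (Fin.last r) = 1) (lam : Fin (m + 1) → ℝ) (c : ℝ) :
    Real.log (multiplierValue x γ β Finset.univ fun k => lam k + c).toReal =
      c + Real.log (multiplierValue x γ β Finset.univ lam).toReal := by
  have h : (stateSum β Finset.univ fun k => lam k + c) = fun y =>
      ENNReal.ofReal (Real.exp c) * stateSum β Finset.univ lam y := by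
    funext y
    rw [stateSum, stateSum, Finset.mul_sum]
    refine Finset.sum_congr rfl fun k _ => ?_
    rw [add_comm, Real.exp_add, ENNReal.ofReal_mul (Real.exp_pos _).le, mul_assoc]
  have hpos : 0 < (multiplierValue x γ β Finset.univ lam).toReal :=
    ENNReal.toReal_pos (multiplierValue_ne_zero hx lam)
      (cascadeRec_stateSum_ne_top hx hmono hlast Finset.univ lam 0 0)
  have h2 : (multiplierValue x γ β Finset.univ fun k => lam k + c) =
      ENNReal.ofReal (Real.exp c) * multiplierValue x γ β Finset.univ lam := by
    rw [multiplierValue, h, cascadeRec_const_mul hx (measurable_stateSum _ _)]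
    rfl
  rw [h2, ENNReal.toReal_mul, ENNReal.toReal_ofReal (Real.exp_pos _).le,
    Real.log_mul (Real.exp_pos _).ne' hpos.ne', Real.log_exp]

lemma cascadeRec_stateSum_ne_zero (hx : ∀ p, 0 < x p) (lam : Fin (m + 1) → ℝ)
    (p : Fin (r + 1)) (y : EuclideanSpace ℝ (Fin (m + 1))) :
    cascadeRec x (stepMeasure γ) (stateSum β Finset.univ lam) p y ≠ 0 := by
  refine cascadeRec_ne_zero hx (measurable_stateSum _ _) (fun y h => ?_) p y
  have := Finset.sum_eq_zero_iff.1 h 0 (Finset.mem_univ _)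
  rw [stateFun, ← ENNReal.ofReal_mul (Real.exp_pos _).le, ← Real.exp_add,
    ENNReal.ofReal_eq_zero] at this
  exact (Real.exp_pos _).not_ge this

/-- With $X_p=\log V_p$ the two recursions coincide. Since every $x_p$ is positive, the zero branch
of `parisiX` is never taken. -/
lemma parisiX_eq (hx : ∀ p, 0 < x p) (hmono : Monotone x) (hlast : x (Fin.last r) = 1)
    (lam : Fin m → ℝ) (p : Fin (r + 1)) (y : EuclideanSpace ℝ (Fin (m + 1))) :
    parisiX β lam x γ p y = Real.log (cascadeRec x (stepMeasure γ)
      (stateSum β Finset.univ (Fin.snoc (α := fun _ => ℝ) lam 0)) p y).toReal := by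
  induction p using Fin.reverseInduction generalizing y with
  | last =>
    rw [cascadeRec_last, parisiX, Fin.reverseInduction_last]
    congr 1
    rw [stateSum, ENNReal.toReal_sum]
    swap
    · exact fun k _ => ENNReal.mul_ne_top ENNReal.ofReal_ne_top ENNReal.ofReal_ne_top
    refine Finset.sum_congr rfl fun k _ => ?_
    rw [stateFun, ← ENNReal.ofReal_mul (Real.exp_pos _).le, ← Real.exp_add,
      ENNReal.toReal_ofReal (Real.exp_pos _).le, add_comm]
  | cast p ih =>
    set lam' : Fin (m + 1) → ℝ := Fin.snoc (α := fun _ => ℝ) lam 0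
    have hxp := hx p.castSucc
    have hstep : parisiX β lam x γ p.castSucc y = (1 / x p.castSucc) *
        Real.log (∫ z, Real.exp (x p.castSucc * parisiX β lam x γ p.succ (y + z))
          ∂(stepMeasure γ p)) := by
      rw [parisiX, Fin.reverseInduction_castSucc, if_neg hxp.ne']
      rfl
    have hfin := cascadeRec_stateSum_ne_top (γ := γ) (β := β) hx hmono hlast Finset.univ lam'
    have hpos := cascadeRec_stateSum_ne_zero (γ := γ) (β := β) hx lam'
    have hint : ∫ z, Real.exp (x p.castSucc * parisiX β lam x γ p.succ (y + z))
        ∂(stepMeasure γ p) = (∫⁻ z, cascadeRec x (stepMeasure γ) (stateSum β Finset.univ lam')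
          p.succ (y + z) ^ x p.castSucc ∂(stepMeasure γ p)).toReal := by
      rw [← integral_toReal]
      · refine integral_congr_ae (Eventually.of_forall fun z => ?_)
        have h0 := ENNReal.toReal_pos (hpos p.succ (y + z)) (hfin p.succ (y + z))
        simp only [ih]
        rw [← ENNReal.toReal_rpow, Real.rpow_def_of_pos h0, mul_comm]
      · exact (measurable_cascadeRec_shift (measurable_stateSum _ _) _ _ _).aemeasurable
      · exact Eventually.of_forall fun z =>
          (ENNReal.rpow_ne_top_of_nonneg hxp.le (hfin _ _)).lt_top
    rw [hstep, hint, ← cascadeRec_castSucc_rpow hx, ← ENNReal.toReal_rpow,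
      Real.log_rpow (ENNReal.toReal_pos (hpos _ _) (hfin _ _)), ← mul_assoc,
      one_div_mul_cancel hxp.ne', one_mul]

/-- Adding a constant to all multipliers shifts both terms by the same amount because $\sum_k
d_k=1$, so the last multiplier can be subtracted from all of them. -/
lemma range_decoupledBound (hx : ∀ p, 0 < x p) (hmono : Monotone x) (hlast : x (Fin.last r) = 1)
    {d : Fin (m + 1) → ℝ} (hd : ∑ k, d k = 1) :
    Set.range (decoupledBound β x γ d) = Set.range fun lam : Fin (m + 1) → ℝ =>
      -∑ k, lam k * d k + Real.log (multiplierValue x γ β Finset.univ lam).toReal := by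
  have h1 : ∀ lam : Fin m → ℝ, decoupledBound β x γ d lam =
      -∑ k, Fin.snoc (α := fun _ => ℝ) lam 0 k * d k + Real.log (multiplierValue x γ β Finset.univ
        (Fin.snoc (α := fun _ => ℝ) lam 0)).toReal := by
    intro lam
    rw [decoupledBound, parisiPhi, parisiX_eq hx hmono hlast, Fin.sum_univ_castSucc]
    simp [multiplierValue]
  refine Set.Subset.antisymm ?_ ?_
  · rintro _ ⟨lam, rfl⟩
    exact ⟨_, (h1 lam).symm⟩
  · rintro _ ⟨lam, rfl⟩
    refine ⟨fun k => lam k.castSucc - lam (Fin.last m), ?_⟩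
    rw [h1]
    have h2 : (Fin.snoc (α := fun _ => ℝ) (fun k => lam k.castSucc - lam (Fin.last m)) 0 :
        Fin (m + 1) → ℝ) = fun k => lam k + -lam (Fin.last m) := by
      funext k
      refine Fin.lastCases ?_ (fun k => ?_) k
      · simp
      · simp [sub_eq_add_neg]
    rw [h2, log_multiplierValue_add_const hx hmono hlast]
    simp only [add_mul, Finset.sum_add_distrib, ← Finset.mul_sum, hd]
    ring

end Multiplier

/-! ### The constrained functional and the recursion -/

section Constrained

variable {r m N : ℕ} {γ : Fin (r + 1) → Matrix (Fin (m + 1)) (Fin (m + 1)) ℝ}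
  {x : Fin (r + 1) → ℝ} {β : ℝ} {Ω : Type*} {u : Vertex r → ℕ → Ω → ℝ}
  {Z : ℕ → (Fin r → ℕ) → Fin (m + 1) → Ω → ℝ}

lemma exists_countConfigs_eq {d : Fin (m + 1) → ℝ} (h : d ∈ admissibleSizes (m + 1) N) :
    ∃ n : Fin (m + 1) → ℕ, (∀ k, (n k : ℝ) = N * d k) ∧ ∑ k, n k = N ∧
      constrainedConfigs N d = countConfigs N n := by
  have hmem : ∀ σ : Fin N → Fin (m + 1), σ ∈ constrainedConfigs N d ↔
      ∀ k, (stateCount σ k : ℝ) = N * d k := by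
    intro σ
    simp [constrainedConfigs, stateCount]
  obtain ⟨-, σ, hσ⟩ := h
  rw [hmem] at hσ
  refine ⟨stateCount σ, hσ, sum_stateCount σ, ?_⟩
  ext τ
  rw [hmem, mem_countConfigs]
  exact ⟨fun h => funext fun k => Nat.cast_injective ((h k).trans (hσ k).symm),
    fun h k => h ▸ hσ k⟩

lemma configFun_leafField (s : Finset (Fin N → Fin (m + 1))) (α : Fin r → ℕ) (ω : Ω) :
    configFun β s (leafField N Z α ω) =
      ENNReal.ofReal (∑ σ ∈ s, Real.exp (β * ∑ i : Fin N, Z i α (σ i) ω)) := by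
  rw [configFun, ENNReal.ofReal_sum_of_nonneg fun _ _ => (Real.exp_pos _).le]
  refine Finset.sum_congr rfl fun σ _ => ?_
  rw [Finset.mul_sum, Real.exp_sum, ENNReal.ofReal_prod_of_nonneg fun _ _ => (Real.exp_pos _).le]
  rfl

lemma pathWeight_eq_ofReal_leafWeight {ω : Ω} (hpos : ∀ a n, 0 < u a n ω) (α : Fin r → ℕ) :
    pathWeight le_rfl (fun a n => u a n ω) α = ENNReal.ofReal (leafWeight u α ω) := by
  rw [leafWeight, ENNReal.ofReal_prod_of_nonneg fun _ _ => (hpos _ _).le]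
  rfl

lemma leafWeight_nonneg {ω : Ω} (hpos : ∀ a n, 0 < u a n ω) (α : Fin r → ℕ) :
    0 ≤ leafWeight u α ω :=
  Finset.prod_nonneg fun _ _ => (hpos _ _).le

/-- A finite sum over the leaves with values in `ℝ≥0∞` is a convergent series of reals. -/
lemma hasSum_leafWeight_mul {ω : Ω} (hpos : ∀ a n, 0 < u a n ω)
    {f : (Fin N → EuclideanSpace ℝ (Fin (m + 1))) → ℝ≥0∞} {g : (Fin r → ℕ) → ℝ}
    (hg : ∀ α, 0 ≤ g α) (hfg : ∀ α, f (leafField N Z α ω) = ENNReal.ofReal (g α))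
    (hfin : cascadeSum u Z N f ω ≠ ∞) :
    HasSum (fun α => leafWeight u α ω * g α) (cascadeSum u Z N f ω).toReal := by
  have h : cascadeSum u Z N f ω = ∑' α, ENNReal.ofReal (leafWeight u α ω * g α) := by
    refine tsum_congr fun α => ?_
    rw [pathWeight_eq_ofReal_leafWeight hpos, hfg,
      ENNReal.ofReal_mul (leafWeight_nonneg hpos α)]
  rw [h] at hfin ⊢
  have h1 := (ENNReal.summable_toReal hfin).hasSum
  rw [← ENNReal.tsum_toReal_eq fun α => ENNReal.ofReal_ne_top] at h1
  simpa [ENNReal.toReal_ofReal, mul_nonneg, leafWeight_nonneg hpos, hg] using h1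

variable [MeasurableSpace Ω] {P : Measure Ω}

lemma IsRuelleCascade.ae_pos (hu : IsRuelleCascade x u P) : ∀ᵐ ω ∂P, ∀ a n, 0 < u a n ω :=
  ae_all_iff.2 fun a => (hu.poisson a).pos

variable [IsProbabilityMeasure P]

lemma hasStableLaplace_totalWeight (hx : ∀ p, 0 < x p)
    (hlast : x (Fin.last r) = 1) (hγ0 : γ 0 = 0)
    (hγ : ∀ p : Fin r, (γ p.succ - γ p.castSucc).PosSemidef)
    (hu : IsRuelleCascade x u P) (hZ : IsCascadeField γ Z P)
    (huZ : IndepFun (fun (ω : Ω) (a : Vertex r) (n : ℕ) => u a n ω)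
      (fun (ω : Ω) (i : ℕ) (α : Fin r → ℕ) (k : Fin (m + 1)) => Z i α k ω) P) (N : ℕ) :
    HasStableLaplace (cascadeConst x 0) (x 0) 1 (cascadeSum u Z N fun _ => 1) P := by
  have h := hasStableLaplace_cascadeSum (N := N) hx hlast hγ0 hγ hu hZ huZ
    (f := fun _ => 1) measurable_const fun p y => by simp [cascadeRec_one]
  rwa [cascadeRec_one] at h

theorem ae_summable_leafWeight (hx0 : 0 < x 0) (hx : StrictMono x)
    (hlast : x (Fin.last r) = 1) (hγ0 : γ 0 = 0)
    (hγ : ∀ p : Fin r, (γ p.succ - γ p.castSucc).PosSemidef)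
    (hu : IsRuelleCascade x u P) (hZ : IsCascadeField γ Z P)
    (huZ : IndepFun (fun (ω : Ω) (a : Vertex r) (n : ℕ) => u a n ω)
      (fun (ω : Ω) (i : ℕ) (α : Fin r → ℕ) (k : Fin (m + 1)) => Z i α k ω) P) :
    ∀ᵐ ω ∂P, Summable fun α : Fin r → ℕ => leafWeight u α ω := by
  have hpos : ∀ p, 0 < x p := fun p => hx0.trans_le (hx.monotone (Fin.zero_le p))
  have hT := hasStableLaplace_totalWeight hpos hlast hγ0 hγ hu hZ huZ 0
  filter_upwards [hT.ae_ne_top hx0 (cascadeConst_ne_top hpos hx 0) ENNReal.one_ne_top,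
    hu.ae_pos] with ω h1 h2
  simpa using (hasSum_leafWeight_mul h2 (g := fun _ => 1) (fun _ => zero_le_one)
    (fun _ => by simp) h1).summable

/-- Almost surely the normalized series is the quotient of two cascade sums, with `configFun` and
with $1$. Both have stable Laplace transforms with the same constants, so the unknown mean of the
logarithm cancels. -/
theorem logPartition_spec (hr : 1 ≤ r) (hx0 : 0 < x 0) (hx : StrictMono x)
    (hlast : x (Fin.last r) = 1) (hγ0 : γ 0 = 0)
    (hγ : ∀ p : Fin r, (γ p.succ - γ p.castSucc).PosSemidef)
    (hu : IsRuelleCascade x u P) (hZ : IsCascadeField γ Z P)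
    (huZ : IndepFun (fun (ω : Ω) (a : Vertex r) (n : ℕ) => u a n ω)
      (fun (ω : Ω) (i : ℕ) (α : Fin r → ℕ) (k : Fin (m + 1)) => Z i α k ω) P)
    {d : Fin (m + 1) → ℝ} {n : Fin (m + 1) → ℕ} (hn : ∑ k, n k = N)
    (hd : constrainedConfigs N d = countConfigs N n) :
    (∀ᵐ ω ∂P, Summable fun α : Fin r → ℕ => constrainedTerm β u Z N d α ω) ∧
      Integrable (logPartition β u Z N d) P ∧
      ∫ ω, logPartition β u Z N d ω ∂P = countEnergy x γ β n := by
  have hpos : ∀ p, 0 < x p := fun p => hx0.trans_le (hx.monotone (Fin.zero_le p))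
  -- Having at least one level gives $x_0<x_r=1$, which the moment computation needs.
  have hx1 : x 0 < 1 := hlast ▸ hx (Fin.lt_def.2 (by simpa using Nat.lt_of_succ_le hr))
  have hC := cascadeConst_ne_top hpos hx 0
  have hC0 := cascadeConst_ne_zero hpos 0
  have hT := hasStableLaplace_totalWeight hpos hlast hγ0 hγ hu hZ huZ N
  have hS := hasStableLaplace_cascadeSum hpos hlast hγ0 hγ hu hZ huZ
    (measurable_configFun (β := β) (countConfigs N n))
    (cascadeRec_configFun_ne_top hpos hx.monotone hlast (countConfigs N n))
  have hVtop : cascadeRec x (blockMeasure N γ) (configFun β (countConfigs N n)) 0 0 ≠ ∞ :=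
    cascadeRec_configFun_ne_top hpos hx.monotone hlast (countConfigs N n) 0 0
  have hV0 : cascadeRec x (blockMeasure N γ) (configFun β (countConfigs N n)) 0 0 ≠ 0 := by
    subst hn
    exact (zero_lt_one.trans_le (one_le_countValue hpos n)).ne'
  set S := cascadeSum u Z N (configFun β (countConfigs N n))
  set T := cascadeSum u Z N fun _ => 1
  have hae : ∀ᵐ ω ∂P, HasSum (fun α => constrainedTerm β u Z N d α ω)
      ((S ω).toReal / (T ω).toReal) ∧
      logPartition β u Z N d ω = Real.log (S ω).toReal - Real.log (T ω).toReal := by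
    filter_upwards [hu.ae_pos, hT.ae_ne_top hx0 hC ENNReal.one_ne_top,
      hT.ae_ne_zero hx0 hC0 one_ne_zero, hS.ae_ne_top hx0 hC hVtop, hS.ae_ne_zero hx0 hC0 hV0]
      with ω h1 h2 h3 h4 h5
    have hsT : HasSum (fun α => leafWeight u α ω) (T ω).toReal := by
      simpa using hasSum_leafWeight_mul h1 (g := fun _ => 1) (fun _ => zero_le_one)
        (fun _ => by simp) h2
    have hsS := hasSum_leafWeight_mul h1
      (fun α => Finset.sum_nonneg fun σ _ => (Real.exp_pos _).le)
      (fun α => configFun_leafField (β := β) (countConfigs N n) α ω) h4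
    have hsum : HasSum (fun α => constrainedTerm β u Z N d α ω)
        ((S ω).toReal / (T ω).toReal) := by
      have heq : (fun α => constrainedTerm β u Z N d α ω) = fun α => leafWeight u α ω *
          (∑ σ ∈ countConfigs N n, Real.exp (β * ∑ i : Fin N, Z i α (σ i) ω)) / (T ω).toReal := by
        funext α
        rw [constrainedTerm, cascadeWeight, hsT.tsum_eq, hd]
        ring
      rw [heq]
      exact hsS.div_const (T ω).toReal
    refine ⟨hsum, ?_⟩
    rw [logPartition, hsum.tsum_eq, Real.log_div (ENNReal.toReal_ne_zero.2 ⟨h5, h4⟩)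
      (ENNReal.toReal_ne_zero.2 ⟨h3, h2⟩)]
  have hiS := hS.integrable_log hx0 hx1 hC0 hC hV0 hVtop
  have hiT := hT.integrable_log hx0 hx1 hC0 hC one_ne_zero ENNReal.one_ne_top
  refine ⟨hae.mono fun ω h => h.1.summable, ?_, ?_⟩
  · exact (hiS.sub hiT).congr (hae.mono fun ω h => h.2.symm)
  · rw [integral_congr_ae (hae.mono fun ω h => h.2), integral_sub hiS hiT,
      hS.integral_log_sub hT hx0 hx1 hC0 hC hV0 hVtop, countEnergy, hn]
    rfl

end Constrained

end

end PottsCascade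

/-! ### The limit theorem -/

open PottsCascade

/-- Asymptotic exactness of the Lagrange multiplier bound for the Ruelle cascade functional with
constrained state sizes. The states are numbered by `Fin (m + 1)`, that is `κ = m + 1`. -/
theorem lemma2 {Ω : Type*} [MeasurableSpace Ω] (P : Measure Ω) [IsProbabilityMeasure P]
    (m r : ℕ) (hr : 1 ≤ r) (β : ℝ) (hβ : 0 < β)
    (x : Fin (r + 1) → ℝ) (hx0 : 0 < x 0) (hx : StrictMono x) (hxr : x (Fin.last r) = 1)
    (γ : Fin (r + 1) → Matrix (Fin (m + 1)) (Fin (m + 1)) ℝ) (hγ0 : γ 0 = 0)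
    (hγ : ∀ p : Fin r, (γ p.succ - γ p.castSucc).PosSemidef)
    (u : Vertex r → ℕ → Ω → ℝ) (hu : IsRuelleCascade x u P)
    (Z : ℕ → (Fin r → ℕ) → Fin (m + 1) → Ω → ℝ) (hZ : IsCascadeField γ Z P)
    (huZ : IndepFun (fun (ω : Ω) (a : Vertex r) (n : ℕ) => u a n ω)
      (fun (ω : Ω) (i : ℕ) (α : Fin r → ℕ) (k : Fin (m + 1)) => Z i α k ω) P)
    (dN : ℕ → Fin (m + 1) → ℝ) (hdN : ∀ N : ℕ, 1 ≤ N → dN N ∈ admissibleSizes (m + 1) N)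
    (d : Fin (m + 1) → ℝ) (hd : Tendsto dN atTop (𝓝 d)) :
    (∀ᵐ ω ∂P, Summable fun α : Fin r → ℕ => leafWeight u α ω) ∧
    (∀ N : ℕ, 1 ≤ N →
      (∀ᵐ ω ∂P, Summable fun α : Fin r → ℕ => constrainedTerm β u Z N (dN N) α ω) ∧
      Integrable (logPartition β u Z N (dN N)) P) ∧
    BddBelow (Set.range (decoupledBound β x γ d)) ∧
    Tendsto (fun N : ℕ => constrainedFunctional P β u Z N (dN N)) atTop
      (𝓝 (⨅ lam : Fin m → ℝ, decoupledBound β x γ d lam)) := by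
  have hpos : ∀ p, 0 < x p := fun p => hx0.trans_le (hx.monotone (Fin.zero_le p))
  have hmono := hx.monotone
  -- Nothing is assumed about `dN 0`, so the count vector there is an arbitrary default.
  have hex : ∀ N : ℕ, ∃ n : Fin (m + 1) → ℕ, 1 ≤ N → (∀ k, (n k : ℝ) = N * dN N k) ∧
      ∑ k, n k = N ∧ constrainedConfigs N (dN N) = countConfigs N n := by
    intro N
    by_cases hN : 1 ≤ N
    · obtain ⟨n, hn⟩ := exists_countConfigs_eq (hdN N hN)
      exact ⟨n, fun _ => hn⟩
    · exact ⟨0, fun h => absurd h hN⟩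
  choose n hn using hex
  have hspec := fun (N : ℕ) (hN : 1 ≤ N) => logPartition_spec (β := β) hr hx0 hx hxr hγ0 hγ hu hZ huZ
    (hn N hN).2.1 (hn N hN).2.2
  have hdk : ∀ k, Tendsto (fun N : ℕ => dN N k) atTop (𝓝 (d k)) := fun k =>
    (tendsto_pi_nhds.1 hd) k
  have hsum : ∑ k, d k = 1 := by
    refine tendsto_nhds_unique (tendsto_finsetSum Finset.univ fun k _ => hdk k)
      (tendsto_const_nhds.congr' ?_)
    filter_upwards [eventually_ge_atTop 1] with N hN
    exact ((hdN N hN).1.2).symm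
  have hratio : ∀ k, Tendsto (fun N : ℕ => (n N k : ℝ) / N) atTop (𝓝 (d k)) := by
    intro k
    refine (hdk k).congr' ?_
    filter_upwards [eventually_ge_atTop 1] with N hN
    have hN0 : (N : ℝ) ≠ 0 := by positivity
    rw [(hn N hN).1 k, mul_div_cancel_left₀ _ hN0]
  obtain ⟨hbdd, hlim⟩ := tendsto_superadditive_div (a := countEnergy x γ β)
    (Φ := fun lam => Real.log (multiplierValue x γ β Finset.univ lam).toReal)
    (countEnergy_nonneg hpos hmono hxr) (countEnergy_add_le hpos hmono hxr)
    (sum_mul_add_countEnergy_le hpos hmono hxr)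
    (fun S lam h ε hε => exists_log_multiplierValue_le hpos hmono hxr S lam h hε)
    (fun N hN => (hn N hN).2.1) hratio
  have hrange := range_decoupledBound (γ := γ) (β := β) hpos hmono hxr hsum
  refine ⟨ae_summable_leafWeight hx0 hx hxr hγ0 hγ hu hZ huZ,
    fun N hN => ⟨(hspec N hN).1, (hspec N hN).2.1⟩, ?_, ?_⟩
  · rw [hrange]
    exact ⟨0, by rintro _ ⟨lam, rfl⟩; exact hbdd lam⟩
  -- The infimum depends only on the range, so it may be taken over all $\kappa$ multipliers.
  · rw [iInf, hrange]
    refine hlim.congr' ?_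
    filter_upwards [eventually_ge_atTop 1] with N hN
    rw [constrainedFunctional, (hspec N hN).2.2]
    ring
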